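/- **Setting.** Let $0<\alpha<1/2$. On $\mathbb{R}^2$ consider the stationary quasi-geostrophic equation $$(-\Delta)^{\alpha}\theta+v\cdot\nabla\theta=f,\qquad v=\nabla^{\perp}(-\Delta)^{-1/2}\theta,\qquad \nabla^\perp=(\partial_{x_2},-\partial_{x_1}),\tag{QG}$$ for real-valued $f,\theta$, in the sense of tempered distributions. Here $(-\Delta)^s=\mathscr F^{-1}|\xi|^{2s}\mathscr F$ and $\|u\|_{\dot H^s}=\|(-\Delta)^{s/2}u\|_{L^2(\mathbb{R}^2)}$. Elements of $\dot H^{-\alpha}\cap\dot H^{2-4\alpha}$ and of $\dot H^{\alpha}\cap\dot H^{2-2\alpha}$ are realized as the tempered distributions whose Fourier transform is a locally integrable function and for which both norms are finite; the norm of an intersection is the sum of the two norms. For $\delta>0$ put $$B_\delta=\{f\in\dot H^{-\alpha}(\mathbb{R}^2)\cap\dot H^{2-4\alpha}(\mathbb{R}^2)\ \text{real-valued}:\ \|f\|_{\dot H^{2-4\alpha}}\le\delta\}.$$ For $\delta,\eta>0$, a map $S:f\mapsto\theta[f]$ is called a *data-to-solution map with constants* $(\delta,\eta)$ if for every $f\in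 B_\delta$, $\theta[f]$ is the one and only solution $\theta\in\dot H^{\alpha}(\mathbb{R}^2)\cap\dot H^{2-2\alpha}(\mathbb{R}^2)$ of (QG) with $\|\theta\|_{\dot H^{2-2\alpha}}\le\eta$. **Theorem 1.3 (Non-uniform continuity of the solution map).** Let $0<\alpha<1/2$. There are $\delta,\eta>0$, depending on $\alpha$, for which a data-to-solution map with constants $(\delta,\eta)$ exists. For all $\delta,\eta>0$ and every data-to-solution map $S$ with constants $(\delta,\eta)$, the map $S$ is not uniformly continuous from $B_\delta$, with the norm of $\dot H^{-\alpha}\cap\dot H^{2-4\alpha}$, to $\dot H^{\alpha}\cap\dot H^{2-2\alpha}$. More precisely, there exist two sequences $\{f_n\}_{n\in\mathbb N}$ and $\{g_n\}_{n\in\mathbb N}$ in $\mathscr S(\mathbb{R}^2)\cap B_\delta$ such that $$\lim_{n\to\infty}\|f_n-g_n\|_{\dot H^{-\alpha}\cap\dot H^{2-4\alpha}}=0$$ and the corresponding solutions $\theta[f_n]=S(f_n)$ and $\theta[g_n]=S(g_n)$ satisfy $$\liminf_{n\to\infty}\|\theta[f_n]-\theta[g_n]\|_{\dot H^{2-2\alpha}}>0.$$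 -/

import Mathlib

open MeasureTheory Filter
open scoped SchwartzMap FourierTransform LineDeriv ENNReal Topology

noncomputable section

namespace QG

/-- The plane `ℝ²` with its Euclidean norm. -/
abbrev Plane : Type := EuclideanSpace ℝ (Fin 2)

/-- Tempered distributions on `ℝ²`. -/
abbrev Dist : Type := 𝓢'(Plane, ℂ)

/-- The tempered distribution defined by a Schwartz function. -/
def ofSchwartz (f : 𝓢(Plane, ℂ)) : Dist :=
  SchwartzMap.toTemperedDistributionCLM Plane ℂ volume f

/-- The tempered distribution `u` is (integration against) the locally integrable function `g`. -/
def IsFunction (u : Dist) (g : Plane → ℂ) : Prop :=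
  LocallyIntegrable g volume ∧
    ∀ φ : 𝓢(Plane, ℂ), Integrable (fun x => φ x * g x) volume ∧ u φ = ∫ x, φ x * g x

/-- The tempered distribution `u` is real-valued: it is real on real test functions. -/
def IsReal (u : Dist) : Prop :=
  ∀ φ : 𝓢(Plane, ℂ), (∀ x, (φ x).im = 0) → (u φ).im = 0

/-- `w = 𝓕⁻¹ m 𝓕 u`, the Fourier transforms of `u` and `w` being locally integrable functions. -/
def IsMultiplier (m : Plane → ℂ) (u w : Dist) : Prop :=
  ∃ F : Plane → ℂ, IsFunction (𝓕 u) F ∧ IsFunction (𝓕 w) (fun ξ => m ξ * F ξ)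

/-- The symbol of `(-Δ)^s`. Mathlib's Fourier transform has the kernel `exp (-2πi x·ξ)`, so that the
frequency variable is `2πξ`. -/
def fracLaplaceSymbol (s : ℝ) (ξ : Plane) : ℂ :=
  (((2 * Real.pi * ‖ξ‖) ^ (2 * s) : ℝ) : ℂ)

/-- The symbol of the partial derivative `∂_j`. -/
def derivSymbol (j : Fin 2) (ξ : Plane) : ℂ :=
  2 * (Real.pi : ℂ) * Complex.I * ((ξ j : ℝ) : ℂ)

/-- `w = (-Δ)^s u`. -/
def IsFracLaplace (s : ℝ) (u w : Dist) : Prop :=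
  IsMultiplier (fracLaplaceSymbol s) u w

/-- `(v₁, v₂) = ∇^⊥ (-Δ)^{-1/2} θ` with `∇^⊥ = (∂₂, -∂₁)`. -/
def IsVelocity (θ v₁ v₂ : Dist) : Prop :=
  IsMultiplier (fun ξ => derivSymbol 1 ξ * fracLaplaceSymbol (-1 / 2) ξ) θ v₁ ∧
    IsMultiplier (fun ξ => -derivSymbol 0 ξ * fracLaplaceSymbol (-1 / 2) ξ) θ v₂

/-- The `j`-th distributional partial derivative. -/
def partialDeriv (j : Fin 2) (u : Dist) : Dist :=
  ∂_{(EuclideanSpace.single j (1 : ℝ) : Plane)} u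

/-- `N = v · ∇θ` with `v = ∇^⊥ (-Δ)^{-1/2} θ`: the components of `v` and of the distributional
gradient of `θ` are locally integrable functions, and `N` is the function obtained by
multiplying them pointwise. -/
def IsAdvection (θ N : Dist) : Prop :=
  ∃ v₁ v₂ : Dist, IsVelocity θ v₁ v₂ ∧
    ∃ a₁ a₂ b₁ b₂ : Plane → ℂ,
      IsFunction v₁ a₁ ∧ IsFunction v₂ a₂ ∧
      IsFunction (partialDeriv 0 θ) b₁ ∧ IsFunction (partialDeriv 1 θ) b₂ ∧
      IsFunction N (fun x => a₁ x * b₁ x + a₂ x * b₂ x)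

/-- The homogeneous Sobolev norm `‖(-Δ)^{s/2} u‖_{L²} = ‖(2π|ξ|)^s û‖_{L²}`, with value `⊤` if it is
not finite or if `û` is not a locally integrable function. The function `F` representing `û` is
unique almost everywhere, so that the infimum is over a single value.

For `s < 1`, every class of tempered distributions modulo polynomials with finite `Ḣ^s` norm
has exactly one representative whose Fourier transform is a locally integrable function; the
space `Ḣ^s` is identified with these representatives. For `s ≥ 1` the norm is only used on
intersections with such a space. -/
def sobolevNorm (s : ℝ) (u : Dist) : ℝ≥0∞ :=
  ⨅ (F : Plane → ℂ) (_ : IsFunction (𝓕 u) F),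
    eLpNorm (fun ξ => (((2 * Real.pi * ‖ξ‖) ^ s : ℝ) : ℂ) * F ξ) 2 volume

/-- The norm of `Ḣ^{-α} ∩ Ḣ^{2-4α}`, the space of the external forces. -/
def dataNorm (α : ℝ) (f : Dist) : ℝ≥0∞ :=
  sobolevNorm (-α) f + sobolevNorm (2 - 4 * α) f

/-- The norm of `Ḣ^α ∩ Ḣ^{2-2α}`, the space of the solutions. -/
def solutionNorm (α : ℝ) (θ : Dist) : ℝ≥0∞ :=
  sobolevNorm α θ + sobolevNorm (2 - 2 * α) θ

/-- `θ` is a real-valued solution in `Ḣ^α ∩ Ḣ^{2-2α}` of the stationary quasi-geostrophic equation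
`(-Δ)^α θ + v · ∇θ = f`, `v = ∇^⊥ (-Δ)^{-1/2} θ`, in the sense of tempered distributions. -/
def IsSolution (α : ℝ) (f θ : Dist) : Prop :=
  IsReal θ ∧ solutionNorm α θ < ⊤ ∧
    ∃ L N : Dist, IsFracLaplace α θ L ∧ IsAdvection θ N ∧ L + N = f

/-- The real-valued external forces `f ∈ Ḣ^{-α} ∩ Ḣ^{2-4α}` with `‖f‖_{Ḣ^{2-4α}} ≤ δ`. -/
def smallData (α δ : ℝ) : Set Dist :=
  {f | IsReal f ∧ dataNorm α f < ⊤ ∧ sobolevNorm (2 - 4 * α) f ≤ ENNReal.ofReal δ}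

/-- `S` is the data-to-solution map with the smallness constants `δ`, `η`: for all forces of size at
most `δ`, `S f` is a solution of size at most `η`, and it is the only one. -/
def IsSolutionMap (α δ η : ℝ) (S : Dist → Dist) : Prop :=
  ∀ f ∈ smallData α δ,
    (IsSolution α f (S f) ∧ sobolevNorm (2 - 2 * α) (S f) ≤ ENNReal.ofReal η) ∧
      ∀ θ : Dist, IsSolution α f θ → sobolevNorm (2 - 2 * α) θ ≤ ENNReal.ofReal η → θ = S f

/-- Uniform continuity of `S` from the forces of size at most `δ`, with the norm of
`Ḣ^{-α} ∩ Ḣ^{2-4α}`, to `Ḣ^α ∩ Ḣ^{2-2α}`. -/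
def UniformlyContinuousMap (α δ : ℝ) (S : Dist → Dist) : Prop :=
  ∀ ε : ℝ≥0∞, 0 < ε → ∃ ρ : ℝ≥0∞, 0 < ρ ∧
    ∀ f ∈ smallData α δ, ∀ g ∈ smallData α δ,
      dataNorm α (f - g) < ρ → solutionNorm α (S f - S g) < ε

end QG

end

/-! On the Fourier side the equation reads `w ^ (2 * α) * F + B F F = f`, where `B` is a convolution
with the kernel `kerR a b`, up to a factor the cross product of a and b divided by |a|. Two
properties of this kernel carry the proof. The cross products of a with b and with a + b agree, so
the kernel is at most the smaller of the frequencies of b and a + b. And it is odd in a, so that for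
a real velocity the trilinear form `Tri U F G` is skew in F and G (`tri_skew`); this is
incompressibility.

Well-posedness. The dissipation has order 2α < 1, so the transport term loses derivatives and cannot
be treated as a perturbation. The velocity is frozen instead, and the linear equation is solved by
an energy estimate with the multiplier M + |ξ|^{4-6α}, which controls M‖θ‖² in Ḣ^α plus ‖θ‖² in
Ḣ^{2-2α}. Skewness replaces the transport term by a commutator, bounded by the Ḣ^{2-2α} norms alone
(`lintegral_commutator_le`, `coercive`), and Lions' theorem turns coercivity into existence
(`exists_of_coercive`, `exists_linear`). Differences of solutions are estimated only in the weaker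
norm Ḣ^α (`stability`). Hence the map from velocity to solution contracts the Ḣ^α distance on a set
that is bounded in Ḣ^{2-2α} (`exists_nonlinear`). The parameter M is free, and taking it small
removes any smallness condition in Ḣ^{-α}.

Failure of uniform continuity. Take a wave at the frequencies ±N e₁ with amplitude κ N^{2α-2}, which
is of order κ in Ḣ^{2-2α}, and a perturbation at frequencies of order one with amplitude N^{2α-1},
which tends to zero. Transport of the wave by the perturbation acts with strength N · N^{2α-1} =
N^{2α}, exactly that of the dissipation. So the perturbation has the same effect on the force as
adding to the wave a `response` of the same order as the wave itself. The two profiles wave +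
perturbation and wave + response are exact solutions for the forces that they generate. In the
difference of these forces the interaction of perturbation and wave cancels, and every other term
tends to zero (`force_sub_force`, `tendsto_force_sub_force`). The difference of the profiles
contains the response, which is bounded below in Ḣ^{2-2α} (`le_norm_B`,
`exists_le_nrm_waveL_sub_waveR`). With κ small in terms of δ and η, the uniqueness required of a
solution map identifies both profiles with its values. -/

noncomputable section

namespace QG

/-! ### Frequencies and the kernel of the nonlinearity. -/

/-- The frequency `2π|ξ|`. -/
def w (ξ : Plane) : ℝ := 2 * Real.pi * ‖ξ‖

lemma w_nonneg (ξ : Plane) : 0 ≤ w ξ := by unfold w; positivity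

lemma w_pos {ξ : Plane} (h : ξ ≠ 0) : 0 < w ξ := by
  unfold w; have := norm_pos_iff.2 h; positivity

@[simp] lemma w_neg (ξ : Plane) : w (-ξ) = w ξ := by simp [w]

lemma w_add_le (a b : Plane) : w (a + b) ≤ w a + w b := by
  unfold w
  rw [← mul_add]
  exact mul_le_mul_of_nonneg_left (norm_add_le a b) (by positivity)

@[fun_prop] lemma continuous_w : Continuous w := by unfold w; fun_prop

@[fun_prop] lemma measurable_w : Measurable w := continuous_w.measurable

lemma measurable_w_rpow (s : ℝ) : Measurable fun ξ => w ξ ^ s := measurable_w.pow_const s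

/-- The real kernel of the bilinear form `v · ∇θ` on the Fourier side. -/
def kerR (a b : Plane) : ℝ := -(2 * Real.pi) * (a 1 * b 0 - a 0 * b 1) / ‖a‖

lemma kerR_zero_left (b : Plane) : kerR 0 b = 0 := by simp [kerR]

lemma kerR_zero_right (a : Plane) : kerR a 0 = 0 := by simp [kerR]

lemma kerR_neg_left (a b : Plane) : kerR (-a) b = -kerR a b := by
  simp only [kerR, PiLp.neg_apply, norm_neg]; ring

lemma kerR_add_right (a b c : Plane) : kerR a (b + c) = kerR a b + kerR a c := by
  simp only [kerR, PiLp.add_apply]; ring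

lemma kerR_sub_right (a b c : Plane) : kerR a (b - c) = kerR a b - kerR a c := by
  simp only [kerR, PiLp.sub_apply]; ring

lemma kerR_smul_right (a b : Plane) (t : ℝ) : kerR a (t • b) = t * kerR a b := by
  simp only [kerR, PiLp.smul_apply, smul_eq_mul]; ring

lemma kerR_self (a : Plane) : kerR a a = 0 := by
  simp only [kerR]; ring

lemma kerR_add_self (a b : Plane) : kerR a (a + b) = kerR a b := by
  rw [kerR_add_right, kerR_self, zero_add]

lemma kerR_sub_self (a b : Plane) : kerR a (b - a) = kerR a b := by
  rw [kerR_sub_right, kerR_self, sub_zero]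

lemma abs_kerR_le (a b : Plane) : |kerR a b| ≤ w b := by
  rcases eq_or_ne a 0 with rfl | ha
  · rw [kerR_zero_left, abs_zero]; exact w_nonneg b
  have hpos : 0 < ‖a‖ := norm_pos_iff.2 ha
  have key : |a 1 * b 0 - a 0 * b 1| ≤ ‖a‖ * ‖b‖ := by
    apply abs_le_of_sq_le_sq _ (by positivity)
    rw [mul_pow, EuclideanSpace.norm_sq_eq, EuclideanSpace.norm_sq_eq]
    simp only [Fin.sum_univ_two, Real.norm_eq_abs, sq_abs]
    -- Lagrange's identity: |a|²|b|² minus the square of the cross product is the square of the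
    -- inner product.
    nlinarith [sq_nonneg (a 0 * b 0 + a 1 * b 1)]
  unfold kerR w
  rw [abs_div, abs_mul, abs_neg, abs_of_pos (by positivity : 0 < 2 * Real.pi), abs_of_pos hpos,
    div_le_iff₀ hpos]
  calc 2 * Real.pi * |a 1 * b 0 - a 0 * b 1| ≤ 2 * Real.pi * (‖a‖ * ‖b‖) := by gcongr
    _ = _ := by ring

/-- The cross product with a does not see multiples of a, so the derivative may be placed on the
output frequency. -/
lemma abs_kerR_le_add (a b : Plane) : |kerR a b| ≤ w (a + b) := by
  rw [← kerR_add_self]; exact abs_kerR_le _ _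

lemma measurable_kerR : Measurable fun p : Plane × Plane => kerR p.1 p.2 := by
  unfold kerR; fun_prop

/-! ### Pointwise bounds of the multipliers by scale-invariant weights. -/

/-- The model weight of the trilinear estimate. -/
def wt (β x y : ℝ) : ℝ := if x ≤ y then x ^ (-1 + β) * y ^ (-β) else 0

lemma wt_nonneg {β x y : ℝ} (hx : 0 ≤ x) (hy : 0 ≤ y) : 0 ≤ wt β x y := by
  unfold wt; split_ifs <;> positivity

/-- Since x ≤ y, the excess of the power of x over -1 + β can be traded for the same power of y;
total degree -1 makes the exponents match. -/
lemma rpow_mul_rpow_le_wt {β p q x y : ℝ} (hx : 0 < x) (hxy : x ≤ y) (hp : -1 + β ≤ p)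
    (hpq : p + q = -1) : x ^ p * y ^ q ≤ wt β x y := by
  have hy : 0 < y := hx.trans_le hxy
  rw [wt, if_pos hxy]
  have h1 : x ^ p = x ^ (-1 + β) * x ^ (p + 1 - β) := by
    rw [← Real.rpow_add hx]; congr 1; ring
  have h2 : y ^ (-β) = y ^ q * y ^ (p + 1 - β) := by
    rw [← Real.rpow_add hy]; congr 1; linarith
  rw [h1, h2]
  have h3 : x ^ (p + 1 - β) ≤ y ^ (p + 1 - β) :=
    Real.rpow_le_rpow hx.le hxy (by linarith)
  have h4 : 0 ≤ x ^ (-1 + β) * y ^ q := by positivity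
  nlinarith

/-- The sum of the three model weights. -/
def wt3 (β r s t : ℝ) : ℝ := wt β r s + wt β s r + wt β t r

lemma wt_le_wt3 {β r s t : ℝ} (hr : 0 ≤ r) (hs : 0 ≤ s) (ht : 0 ≤ t) :
    wt β r s ≤ wt3 β r s t ∧ wt β s r ≤ wt3 β r s t ∧ wt β t r ≤ wt3 β r s t := by
  have h1 := wt_nonneg (β := β) hr hs
  have h2 := wt_nonneg (β := β) hs hr
  have h3 := wt_nonneg (β := β) ht hr
  unfold wt3
  refine ⟨?_, ?_, ?_⟩ <;> linarith

lemma rpow_neg_le_of_le_two_mul {q x y : ℝ} (hx : 0 < x) (hxy : x ≤ 2 * y) (hq : 0 ≤ q)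
    (hq2 : q ≤ 2) : y ^ (-q) ≤ 4 * x ^ (-q) := by
  have hy : 0 < y := by linarith
  have h1 : (2 * y) ^ (-q) ≤ x ^ (-q) := Real.rpow_le_rpow_of_nonpos hx hxy (by linarith)
  rw [Real.mul_rpow (by norm_num) hy.le] at h1
  have h2 : (2 : ℝ) ^ (-2 : ℝ) ≤ 2 ^ (-q) :=
    Real.rpow_le_rpow_of_exponent_le (by norm_num) (by linarith)
  have h3 : (2 : ℝ) ^ (-2 : ℝ) = 1 / 4 := by
    rw [Real.rpow_neg (by norm_num)]; norm_num
  rw [h3] at h2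
  have h4 : 0 < y ^ (-q) := by positivity
  nlinarith

/-- By the triangle inequality the two larger frequencies are comparable, and powers of one may be
exchanged for powers of the other at the cost of a factor 4. What remains has degree -1, and the
smallest frequency carries the exponent -α, -1 + 2α or 1 - α. Each is at least -1 + α; for the first
this uses α ≤ 1/2. -/
lemma weight_bound_low {α r s t : ℝ} (hα0 : 0 < α) (hα1 : α < 1 / 2) (hr : 0 < r) (hs : 0 < s)
    (ht : 0 < t) (h1 : r ≤ s + t) (h2 : s ≤ r + t) :
    min s t * (r ^ (-α) * s ^ (-(2 - 2 * α)) * t ^ (-α)) ≤ 4 * wt3 α r s t := by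
  obtain ⟨k1, k2, k3⟩ := wt_le_wt3 (β := α) hr.le hs.le ht.le
  by_cases hrs : r ≤ s ∧ r ≤ t
  · have e1 : t ^ (-α) ≤ 4 * s ^ (-α) :=
      rpow_neg_le_of_le_two_mul hs (by linarith) hα0.le (by linarith)
    have e2 := rpow_mul_rpow_le_wt (β := α) (p := -α) (q := -1 + α) hr hrs.1 (by linarith)
      (by ring)
    have e3 : s * (s ^ (-(2 - 2 * α)) * s ^ (-α)) = s ^ (-1 + α) := by
      nth_rewrite 1 [← Real.rpow_one s]
      rw [← Real.rpow_add hs, ← Real.rpow_add hs]; congr 1; ring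
    calc min s t * (r ^ (-α) * s ^ (-(2 - 2 * α)) * t ^ (-α))
        ≤ s * (r ^ (-α) * s ^ (-(2 - 2 * α)) * (4 * s ^ (-α))) := by
          gcongr; exact min_le_left _ _
      _ = 4 * (r ^ (-α) * (s * (s ^ (-(2 - 2 * α)) * s ^ (-α)))) := by ring
      _ ≤ _ := by rw [e3]; linarith
  by_cases hst : s ≤ t ∧ s ≤ r
  · have e1 : t ^ (-α) ≤ 4 * r ^ (-α) :=
      rpow_neg_le_of_le_two_mul hr (by linarith) hα0.le (by linarith)
    have e2 := rpow_mul_rpow_le_wt (β := α) (p := -1 + 2 * α) (q := -(2 * α)) hs hst.2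
      (by linarith) (by ring)
    have e3 : s * s ^ (-(2 - 2 * α)) = s ^ (-1 + 2 * α) := by
      nth_rewrite 1 [← Real.rpow_one s]
      rw [← Real.rpow_add hs]; congr 1; ring
    have e4 : r ^ (-α) * r ^ (-α) = r ^ (-(2 * α)) := by
      rw [← Real.rpow_add hr]; congr 1; ring
    calc min s t * (r ^ (-α) * s ^ (-(2 - 2 * α)) * t ^ (-α))
        ≤ s * (r ^ (-α) * s ^ (-(2 - 2 * α)) * (4 * r ^ (-α))) := by
          gcongr; exact min_le_left _ _
      _ = 4 * ((s * s ^ (-(2 - 2 * α))) * (r ^ (-α) * r ^ (-α))) := by ring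
      _ ≤ _ := by rw [e3, e4]; linarith
  · have htr : t ≤ r ∧ t ≤ s := by grind
    have e1 : s ^ (-(2 - 2 * α)) ≤ 4 * r ^ (-(2 - 2 * α)) :=
      rpow_neg_le_of_le_two_mul hr (by linarith) (by linarith) (by linarith)
    have e2 := rpow_mul_rpow_le_wt (β := α) (p := 1 - α) (q := -2 + α) ht htr.1
      (by linarith) (by ring)
    have e3 : t * t ^ (-α) = t ^ (1 - α) := by
      nth_rewrite 1 [← Real.rpow_one t]
      rw [← Real.rpow_add ht]; congr 1
    have e4 : r ^ (-α) * r ^ (-(2 - 2 * α)) = r ^ (-2 + α) := by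
      rw [← Real.rpow_add hr]; congr 1; ring
    calc min s t * (r ^ (-α) * s ^ (-(2 - 2 * α)) * t ^ (-α))
        ≤ t * (r ^ (-α) * (4 * r ^ (-(2 - 2 * α))) * t ^ (-α)) := by
          gcongr; exact min_le_right _ _
      _ = 4 * ((t * t ^ (-α)) * (r ^ (-α) * r ^ (-(2 - 2 * α)))) := by ring
      _ ≤ _ := by rw [e3, e4]; linarith

lemma abs_rpow_sub_rpow_le {p s t m : ℝ} (hp1 : 1 ≤ p) (hp4 : p ≤ 4) (hs : 0 < s) (ht : 0 < t)
    (hsm : s ≤ m) (htm : t ≤ m) : |t ^ p - s ^ p| ≤ 4 * m ^ (p - 1) * |t - s| := by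
  have key := Convex.norm_image_sub_le_of_norm_deriv_le (f := fun x : ℝ => x ^ p)
    (s := Set.Icc (min s t) m) (x := s) (y := t) (C := 4 * m ^ (p - 1)) ?_ ?_ (convex_Icc _ _)
    ⟨min_le_left _ _, hsm⟩ ⟨min_le_right _ _, htm⟩
  · simpa [Real.norm_eq_abs] using key
  · intro x hx
    have : 0 < x := (lt_min hs ht).trans_le hx.1
    exact Real.differentiableAt_rpow_const_of_ne p this.ne'
  · intro x hx
    have hx0 : 0 < x := (lt_min hs ht).trans_le hx.1
    rw [Real.deriv_rpow_const, Real.norm_eq_abs, abs_of_nonneg (by positivity)]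
    gcongr
    exact hx.2

/-- The mean value theorem extracts from the difference of powers a factor r, the frequency of the
velocity, and lowers the remaining power by one. After this gain the smallest frequency carries the
exponent -1 + 2α in all three cases. The constant is 32 · 4, from the mean value bound at 2m and
from one exchange of comparable frequencies. -/
lemma weight_bound_high {α r s t : ℝ} (hα0 : 0 < α) (hα1 : α < 1 / 2) (hr : 0 < r) (hs : 0 < s)
    (ht : 0 < t) (h1 : r ≤ s + t) (h2 : s ≤ r + t) (h3 : t ≤ r + s) :
    min s t * |t ^ (4 - 6 * α) - s ^ (4 - 6 * α)| *
      (r ^ (-(2 - 2 * α)) * s ^ (-(2 - 2 * α)) * t ^ (-(2 - 2 * α))) ≤ 128 * wt3 α r s t := by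
  obtain ⟨k1, k2, k3⟩ := wt_le_wt3 (β := α) hr.le hs.le ht.le
  have hd : |t - s| ≤ r := abs_le.2 ⟨by linarith, by linarith⟩
  have two_pow : (2 : ℝ) ^ (4 - 6 * α - 1) ≤ 8 := by
    calc (2 : ℝ) ^ (4 - 6 * α - 1) ≤ 2 ^ (3 : ℝ) :=
          Real.rpow_le_rpow_of_exponent_le (by norm_num) (by linarith)
      _ = 8 := by norm_num
  have main : ∀ m, 0 < m → s ≤ 2 * m → t ≤ 2 * m →
      |t ^ (4 - 6 * α) - s ^ (4 - 6 * α)| ≤ 32 * (m ^ (4 - 6 * α - 1) * r) := by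
    intro m hm hsm htm
    have := abs_rpow_sub_rpow_le (p := 4 - 6 * α) (by linarith) (by linarith) hs ht hsm htm
    rw [Real.mul_rpow (by norm_num) hm.le] at this
    calc _ ≤ 4 * (2 ^ (4 - 6 * α - 1) * m ^ (4 - 6 * α - 1)) * |t - s| := this
      _ ≤ 4 * (8 * m ^ (4 - 6 * α - 1)) * r := by gcongr
      _ = _ := by ring
  have mulpow : ∀ x : ℝ, 0 < x → x * x ^ (-(2 - 2 * α)) = x ^ (-1 + 2 * α) := by
    intro x hx
    nth_rewrite 1 [← Real.rpow_one x]
    rw [← Real.rpow_add hx]; congr 1; ring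
  by_cases hrs : r ≤ s ∧ r ≤ t
  · have e0 := main s hs (by linarith) (by linarith)
    have e1 : t ^ (-(2 - 2 * α)) ≤ 4 * s ^ (-(2 - 2 * α)) :=
      rpow_neg_le_of_le_two_mul hs (by linarith) (by linarith) (by linarith)
    have e2 := rpow_mul_rpow_le_wt (β := α) (p := -1 + 2 * α) (q := -(2 * α)) hr hrs.1
      (by linarith) (by ring)
    have e3 : s * s ^ (4 - 6 * α - 1) * s ^ (-(2 - 2 * α)) * s ^ (-(2 - 2 * α))
        = s ^ (-(2 * α)) := by
      nth_rewrite 1 [← Real.rpow_one s]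
      rw [← Real.rpow_add hs, ← Real.rpow_add hs, ← Real.rpow_add hs]; congr 1; ring
    calc _ ≤ s * (32 * (s ^ (4 - 6 * α - 1) * r)) *
            (r ^ (-(2 - 2 * α)) * s ^ (-(2 - 2 * α)) * (4 * s ^ (-(2 - 2 * α)))) := by
          gcongr; exact min_le_left _ _
      _ = 128 * ((r * r ^ (-(2 - 2 * α))) *
            (s * s ^ (4 - 6 * α - 1) * s ^ (-(2 - 2 * α)) * s ^ (-(2 - 2 * α)))) := by ring
      _ ≤ _ := by rw [e3, mulpow r hr]; linarith
  have e3 : r * r ^ (4 - 6 * α - 1) * r ^ (-(2 - 2 * α)) * r ^ (-(2 - 2 * α))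
      = r ^ (-(2 * α)) := by
    nth_rewrite 1 [← Real.rpow_one r]
    rw [← Real.rpow_add hr, ← Real.rpow_add hr, ← Real.rpow_add hr]; congr 1; ring
  by_cases hst : s ≤ t ∧ s ≤ r
  · have e0 := main r hr (by linarith) (by linarith)
    have e1 : t ^ (-(2 - 2 * α)) ≤ 4 * r ^ (-(2 - 2 * α)) :=
      rpow_neg_le_of_le_two_mul hr (by linarith) (by linarith) (by linarith)
    have e2 := rpow_mul_rpow_le_wt (β := α) (p := -1 + 2 * α) (q := -(2 * α)) hs hst.2
      (by linarith) (by ring)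
    calc _ ≤ s * (32 * (r ^ (4 - 6 * α - 1) * r)) *
            (r ^ (-(2 - 2 * α)) * s ^ (-(2 - 2 * α)) * (4 * r ^ (-(2 - 2 * α)))) := by
          gcongr; exact min_le_left _ _
      _ = 128 * ((s * s ^ (-(2 - 2 * α))) *
            (r * r ^ (4 - 6 * α - 1) * r ^ (-(2 - 2 * α)) * r ^ (-(2 - 2 * α)))) := by ring
      _ ≤ _ := by rw [e3, mulpow s hs]; linarith
  · have htr : t ≤ r ∧ t ≤ s := by grind
    have e0 := main r hr (by linarith) (by linarith)
    have e1 : s ^ (-(2 - 2 * α)) ≤ 4 * r ^ (-(2 - 2 * α)) :=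
      rpow_neg_le_of_le_two_mul hr (by linarith) (by linarith) (by linarith)
    have e2 := rpow_mul_rpow_le_wt (β := α) (p := -1 + 2 * α) (q := -(2 * α)) ht htr.1
      (by linarith) (by ring)
    calc _ ≤ t * (32 * (r ^ (4 - 6 * α - 1) * r)) *
            (r ^ (-(2 - 2 * α)) * (4 * r ^ (-(2 - 2 * α))) * t ^ (-(2 - 2 * α))) := by
          gcongr; exact min_le_right _ _
      _ = 128 * ((t * t ^ (-(2 - 2 * α))) *
            (r * r ^ (4 - 6 * α - 1) * r ^ (-(2 - 2 * α)) * r ^ (-(2 - 2 * α)))) := by ring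
      _ ≤ _ := by rw [e3, mulpow t ht]; linarith

/-! ### Square integrals of the weights and the trilinear Cauchy–Schwarz bound. -/

lemma integral_wt_sq {β t : ℝ} (hβ : 0 < β) (ht : 0 < t) :
    Integrable (fun a : Plane => (wt β (w a) t) ^ 2) ∧
    ∫ a : Plane, (wt β (w a) t) ^ 2 =
      2 * (volume.real (Metric.ball (0 : Plane) 1) * ((2 * Real.pi) ^ (-2 : ℝ) / (2 * β))) := by
  set T : ℝ := t / (2 * Real.pi) with hT
  have hpi : 0 < 2 * Real.pi := by positivity
  have hT0 : 0 < T := by positivity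
  let g : ℝ → ℝ := fun y => (wt β (2 * Real.pi * y) t) ^ 2
  have hfin : Module.finrank ℝ Plane - 1 = 1 := by simp
  have hval : ∀ y ∈ Set.Ioi (0 : ℝ), y ^ (Module.finrank ℝ Plane - 1) • g y =
      (Set.Ioc 0 T).indicator
        (fun y => ((2 * Real.pi) ^ (-2 + 2 * β) * t ^ (-(2 * β))) * y ^ (-1 + 2 * β)) y := by
    intro y hy
    have hy0 : 0 < y := hy
    rw [hfin]
    simp only [g, wt, smul_eq_mul, pow_one]
    by_cases h : y ≤ T
    · have h' : 2 * Real.pi * y ≤ t := by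
        rw [hT, le_div_iff₀ hpi] at h; linarith
      rw [if_pos h', Set.indicator_of_mem (Set.mem_Ioc.2 ⟨hy0, h⟩), Real.mul_rpow hpi.le hy0.le]
      have e1 : ((2 * Real.pi) ^ (-1 + β)) ^ 2 = (2 * Real.pi) ^ (-2 + 2 * β) := by
        rw [← Real.rpow_natCast, ← Real.rpow_mul hpi.le]; congr 1; push_cast; ring
      have e2 : (t ^ (-β)) ^ 2 = t ^ (-(2 * β)) := by
        rw [← Real.rpow_natCast, ← Real.rpow_mul ht.le]; congr 1; push_cast; ring
      have e3 : y * (y ^ (-1 + β)) ^ 2 = y ^ (-1 + 2 * β) := by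
        rw [← Real.rpow_natCast, ← Real.rpow_mul hy0.le]
        nth_rewrite 1 [← Real.rpow_one y]
        rw [← Real.rpow_add hy0]; congr 1; push_cast; ring
      calc y * ((2 * Real.pi) ^ (-1 + β) * y ^ (-1 + β) * t ^ (-β)) ^ 2
          = ((2 * Real.pi) ^ (-1 + β)) ^ 2 * (t ^ (-β)) ^ 2 * (y * (y ^ (-1 + β)) ^ 2) := by ring
        _ = _ := by rw [e1, e2, e3]
    · have h' : ¬ 2 * Real.pi * y ≤ t := by
        rw [hT, le_div_iff₀ hpi] at h; contrapose! h; linarith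
      rw [if_neg h', Set.indicator_of_notMem (fun hh => h hh.2)]; simp
  have hint : IntegrableOn (fun y : ℝ =>
      ((2 * Real.pi) ^ (-2 + 2 * β) * t ^ (-(2 * β))) * y ^ (-1 + 2 * β)) (Set.Ioc 0 T) := by
    apply Integrable.const_mul
    rw [← IntegrableOn, ← intervalIntegrable_iff_integrableOn_Ioc_of_le hT0.le]
    exact intervalIntegral.intervalIntegrable_rpow' (by linarith)
  constructor
  · have := (integrable_fun_norm_addHaar (volume : Measure Plane) (f := g)).2
    apply this
    rw [integrableOn_congr_fun hval measurableSet_Ioi]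
    exact ((integrable_indicator_iff measurableSet_Ioc).2 hint).integrableOn
  · have := integral_fun_norm_addHaar (volume : Measure Plane) g
    change ∫ a : Plane, g ‖a‖ = _
    rw [this, setIntegral_congr_fun measurableSet_Ioi hval, setIntegral_indicator measurableSet_Ioc,
      Set.inter_eq_self_of_subset_right (fun x hx => hx.1), integral_const_mul,
      ← intervalIntegral.integral_of_le hT0.le, integral_rpow (Or.inl (by linarith))]
    have e : (2 * Real.pi) ^ (-2 + 2 * β) * t ^ (-(2 * β)) *
        ((T ^ (-1 + 2 * β + 1) - 0 ^ (-1 + 2 * β + 1)) / (-1 + 2 * β + 1)) =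
        (2 * Real.pi) ^ (-2 : ℝ) / (2 * β) := by
      rw [show -1 + 2 * β + 1 = 2 * β by ring, Real.zero_rpow (by positivity), sub_zero, hT,
        Real.div_rpow ht.le hpi.le, Real.rpow_add hpi, Real.rpow_neg ht.le]
      field_simp
    rw [e]; simp

/-- The bound for the model weights in the Schur-type test. -/
def wtConst (β : ℝ) : ℝ :=
  2 * (volume.real (Metric.ball (0 : Plane) 1) * ((2 * Real.pi) ^ (-2 : ℝ) / (2 * β)))

/-- The squared weight is homogeneous of degree -2 in the two frequencies, so in the plane its
integral over one of them does not depend on the other. -/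
lemma lintegral_wt_sq_le {β t : ℝ} (hβ : 0 < β) (ht : 0 ≤ t) :
    ∫⁻ a : Plane, ENNReal.ofReal (wt β (w a) t) ^ 2 ≤ ENNReal.ofReal (wtConst β) := by
  rcases ht.eq_or_lt with rfl | ht
  · have : ∀ a : Plane, wt β (w a) 0 = 0 := by
      intro a
      unfold wt
      split_ifs
      · rw [Real.zero_rpow (by linarith), mul_zero]
      · rfl
    simp [this]
  · obtain ⟨h1, h2⟩ := integral_wt_sq hβ ht
    rw [wtConst, ← h2, ofReal_integral_eq_lintegral_ofReal h1 (ae_of_all _ fun a => sq_nonneg _)]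
    apply le_of_eq
    congr 1; ext a
    rw [ENNReal.ofReal_pow (wt_nonneg (w_nonneg a) ht.le)]

/-- The `L²` norm of a function with values in `[0, ∞]`. -/
def l2 (f : Plane → ℝ≥0∞) : ℝ≥0∞ := (∫⁻ x, f x ^ 2) ^ (1 / 2 : ℝ)

lemma l2_sq (f : Plane → ℝ≥0∞) : l2 f ^ 2 = ∫⁻ x, f x ^ 2 := by
  unfold l2
  rw [← ENNReal.rpow_natCast, ← ENNReal.rpow_mul]; norm_num

lemma lintegral_mul_le_cs {X : Type*} [MeasurableSpace X] {μ : Measure X} {f g : X → ℝ≥0∞}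
    (hf : AEMeasurable f μ) (hg : AEMeasurable g μ) :
    ∫⁻ x, f x * g x ∂μ ≤ (∫⁻ x, f x ^ 2 ∂μ) ^ (1 / 2 : ℝ) * (∫⁻ x, g x ^ 2 ∂μ) ^ (1 / 2 : ℝ) := by
  have := ENNReal.lintegral_mul_le_Lp_mul_Lq μ Real.HolderConjugate.two_two hf hg
  simpa using this

lemma lintegral_prod_mul_add_sq {f h : Plane → ℝ≥0∞} (hf : Measurable f) (hh : Measurable h) :
    ∫⁻ p : Plane × Plane, (f p.1 * h (p.1 + p.2)) ^ 2 = (∫⁻ x, f x ^ 2) * ∫⁻ x, h x ^ 2 := by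
  rw [Measure.volume_eq_prod, lintegral_prod _ (by fun_prop)]
  simp only [mul_pow]
  have : ∀ x : Plane, ∫⁻ y : Plane, f x ^ 2 * h (x + y) ^ 2 = f x ^ 2 * ∫⁻ y, h y ^ 2 := by
    intro x
    rw [lintegral_const_mul _ (by fun_prop), lintegral_add_left_eq_self (fun y => h y ^ 2) x]
  simp_rw [this]
  rw [lintegral_mul_const _ (by fun_prop)]

/-- Cauchy–Schwarz on the product space, with f(a) h(a + b) against k(a, b) g(b). Translation
invariance factors the first norm; in the second, the integration over a is performed first. -/
lemma lintegral_tri_le_left {k : Plane × Plane → ℝ≥0∞} {C : ℝ≥0∞} (hk : Measurable k)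
    (hC : ∀ b, ∫⁻ a, k (a, b) ^ 2 ≤ C) {f g h : Plane → ℝ≥0∞} (hf : Measurable f)
    (hg : Measurable g) (hh : Measurable h) :
    ∫⁻ p : Plane × Plane, k p * (f p.1 * g p.2 * h (p.1 + p.2)) ≤
      C ^ (1 / 2 : ℝ) * (l2 f * l2 g * l2 h) := by
  calc ∫⁻ p : Plane × Plane, k p * (f p.1 * g p.2 * h (p.1 + p.2))
      = ∫⁻ p : Plane × Plane, (f p.1 * h (p.1 + p.2)) * (k p * g p.2) := by
        congr 1; ext p; ring
    _ ≤ _ := lintegral_mul_le_cs (by fun_prop) (by fun_prop)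
    _ ≤ ((∫⁻ x, f x ^ 2) * ∫⁻ x, h x ^ 2) ^ (1 / 2 : ℝ) *
        (C * ∫⁻ x, g x ^ 2) ^ (1 / 2 : ℝ) := by
        rw [lintegral_prod_mul_add_sq hf hh]
        gcongr
        rw [Measure.volume_eq_prod, lintegral_prod_symm _ (by fun_prop)]
        simp only [mul_pow]
        calc _ ≤ ∫⁻ y, C * g y ^ 2 := by
              apply lintegral_mono
              intro y
              dsimp only
              rw [lintegral_mul_const _ (by fun_prop)]
              gcongr
              exact hC y
          _ = _ := lintegral_const_mul _ (by fun_prop)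
    _ = _ := by
        rw [ENNReal.mul_rpow_of_nonneg _ _ (by norm_num),
          ENNReal.mul_rpow_of_nonneg _ _ (by norm_num)]
        unfold l2; ring

lemma lintegral_swap {k : Plane × Plane → ℝ≥0∞} (hk : Measurable k) :
    ∫⁻ p : Plane × Plane, k p.swap = ∫⁻ p, k p := by
  have : MeasurePreserving (Prod.swap : Plane × Plane → Plane × Plane) volume volume :=
    Measure.measurePreserving_swap
  exact this.lintegral_comp hk

lemma lintegral_tri_le_right {k : Plane × Plane → ℝ≥0∞} {C : ℝ≥0∞} (hk : Measurable k)
    (hC : ∀ a, ∫⁻ b, k (a, b) ^ 2 ≤ C) {f g h : Plane → ℝ≥0∞} (hf : Measurable f)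
    (hg : Measurable g) (hh : Measurable h) :
    ∫⁻ p : Plane × Plane, k p * (f p.1 * g p.2 * h (p.1 + p.2)) ≤
      C ^ (1 / 2 : ℝ) * (l2 f * l2 g * l2 h) := by
  have := lintegral_tri_le_left (k := fun p => k p.swap) (by fun_prop) hC hg hf hh
  rw [← lintegral_swap (by fun_prop)] at this
  simp only [Prod.swap_swap, Prod.fst_swap, Prod.snd_swap] at this
  calc _ = _ := by congr 1; ext p; rw [add_comm p.1, mul_comm (f p.1)]
    _ ≤ _ := this
    _ = _ := by ring

lemma measurable_wt (β : ℝ) : Measurable fun p : ℝ × ℝ => wt β p.1 p.2 := by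
  unfold wt
  exact Measurable.ite (measurableSet_le measurable_fst measurable_snd)
    ((measurable_fst.pow_const _).mul (measurable_snd.pow_const _)) measurable_const

lemma Measurable.wt {X : Type*} [MeasurableSpace X] {β : ℝ} {f g : X → ℝ} (hf : Measurable f)
    (hg : Measurable g) : Measurable fun x => wt β (f x) (g x) :=
  (measurable_wt β).comp (hf.prodMk hg)

/-- The constant of the trilinear estimate. -/
def triConst (β : ℝ) : ℝ≥0∞ := 3 * ENNReal.ofReal (wtConst β) ^ (1 / 2 : ℝ)

lemma triConst_ne_top (β : ℝ) : triConst β ≠ ⊤ := by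
  unfold triConst
  exact ENNReal.mul_ne_top (by norm_num) (ENNReal.rpow_ne_top_of_nonneg (by norm_num) (by simp))

/-- In each of the three weights the smaller frequency serves as the variable of integration: a for
fixed b, b for fixed a, and a + b for fixed a after a translation. -/
lemma lintegral_wt3_le {β : ℝ} (hβ : 0 < β) {f g h : Plane → ℝ≥0∞} (hf : Measurable f)
    (hg : Measurable g) (hh : Measurable h) :
    ∫⁻ p : Plane × Plane, ENNReal.ofReal (wt3 β (w p.1) (w p.2) (w (p.1 + p.2))) *
      (f p.1 * g p.2 * h (p.1 + p.2)) ≤ triConst β * (l2 f * l2 g * l2 h) := by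
  have m1 : Measurable fun p : Plane × Plane => wt β (w p.1) (w p.2) :=
    Measurable.wt (by fun_prop) (by fun_prop)
  have m2 : Measurable fun p : Plane × Plane => wt β (w p.2) (w p.1) :=
    Measurable.wt (by fun_prop) (by fun_prop)
  have m3 : Measurable fun p : Plane × Plane => wt β (w (p.1 + p.2)) (w p.1) :=
    Measurable.wt (by fun_prop) (by fun_prop)
  have b1 := lintegral_tri_le_left (k := fun p => ENNReal.ofReal (wt β (w p.1) (w p.2)))
    (by fun_prop) (fun b => lintegral_wt_sq_le hβ (w_nonneg b)) hf hg hh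
  have b2 := lintegral_tri_le_right (k := fun p => ENNReal.ofReal (wt β (w p.2) (w p.1)))
    (by fun_prop) (fun b => lintegral_wt_sq_le hβ (w_nonneg b)) hf hg hh
  have b3 := lintegral_tri_le_right (k := fun p => ENNReal.ofReal (wt β (w (p.1 + p.2)) (w p.1)))
    (by fun_prop) (fun a => by
      simp only
      rw [lintegral_add_left_eq_self (fun c => ENNReal.ofReal (wt β (w c) (w a)) ^ 2) a]
      exact lintegral_wt_sq_le hβ (w_nonneg a)) hf hg hh
  have split : ∀ p : Plane × Plane,
      ENNReal.ofReal (wt3 β (w p.1) (w p.2) (w (p.1 + p.2))) =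
      ENNReal.ofReal (wt β (w p.1) (w p.2)) + ENNReal.ofReal (wt β (w p.2) (w p.1)) +
        ENNReal.ofReal (wt β (w (p.1 + p.2)) (w p.1)) := by
    intro p
    have h1 := wt_nonneg (β := β) (w_nonneg p.1) (w_nonneg p.2)
    have h2 := wt_nonneg (β := β) (w_nonneg p.2) (w_nonneg p.1)
    have h3 := wt_nonneg (β := β) (w_nonneg (p.1 + p.2)) (w_nonneg p.1)
    rw [wt3, ENNReal.ofReal_add (by positivity) h3, ENNReal.ofReal_add h1 h2]
  simp only [split, add_mul]
  rw [lintegral_add_left (by fun_prop), lintegral_add_left (by fun_prop)]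
  calc _ ≤ _ := add_le_add (add_le_add b1 b2) b3
    _ = _ := by unfold triConst; ring

/-- Young's inequality `L¹ * L² ⊆ L²`. -/
lemma lintegral_young {p q : Plane → ℝ≥0∞} (hp : Measurable p) (hq : Measurable q) :
    ∫⁻ ξ, (∫⁻ a, p a * q (ξ - a)) ^ 2 ≤ (∫⁻ a, p a) ^ 2 * ∫⁻ a, q a ^ 2 := by
  have key : ∀ ξ, (∫⁻ a, p a * q (ξ - a)) ^ 2 ≤ (∫⁻ a, p a) * ∫⁻ a, p a * q (ξ - a) ^ 2 := by
    intro ξ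
    -- Cauchy–Schwarz for the measure p(a) da, with its density split into two square roots.
    have := lintegral_mul_le_cs (μ := volume) (f := fun a => p a ^ (1 / 2 : ℝ))
      (g := fun a => p a ^ (1 / 2 : ℝ) * q (ξ - a)) (by fun_prop) (by fun_prop)
    have e : ∀ x : ℝ≥0∞, x ^ (1 / 2 : ℝ) * x ^ (1 / 2 : ℝ) = x := fun x => by
      rw [← ENNReal.rpow_add_of_nonneg _ _ (by norm_num) (by norm_num)]; norm_num
    have e' : ∀ x : ℝ≥0∞, (x ^ (1 / 2 : ℝ)) ^ 2 = x := fun x => by rw [sq, e]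
    simp only [mul_pow, e', ← mul_assoc, e] at this
    calc _ ≤ _ := pow_le_pow_left₀ (by positivity) this 2
      _ = _ := by rw [mul_pow, e', e']
  calc _ ≤ ∫⁻ ξ, (∫⁻ a, p a) * ∫⁻ a, p a * q (ξ - a) ^ 2 := lintegral_mono key
    _ = (∫⁻ a, p a) * ∫⁻ ξ, ∫⁻ a, p a * q (ξ - a) ^ 2 := lintegral_const_mul _
        (Measurable.lintegral_prod_right' (f := fun z : Plane × Plane => p z.2 * q (z.1 - z.2) ^ 2)
          (by fun_prop))
    _ = (∫⁻ a, p a) * ∫⁻ a, ∫⁻ ξ, p a * q (ξ - a) ^ 2 := by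
        rw [lintegral_lintegral_swap (by fun_prop)]
    _ = (∫⁻ a, p a) * ∫⁻ a, p a * ∫⁻ ξ, q ξ ^ 2 := by
        congr 1; apply lintegral_congr; intro a
        rw [lintegral_const_mul _ (by fun_prop), lintegral_sub_right_eq_self (fun ξ => q ξ ^ 2) a]
    _ = _ := by rw [lintegral_mul_const _ hp]; ring

/-! ### Homogeneous norms and admissible functions on the Fourier side. -/

/-- The homogeneous Sobolev norm in terms of the Fourier transform. -/
def nrm (s : ℝ) (F : Plane → ℂ) : ℝ≥0∞ :=
  eLpNorm (fun ξ => ((w ξ ^ s : ℝ) : ℂ) * F ξ) 2 volume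

/-- The modulus of the weighted Fourier transform. -/
def mag (s : ℝ) (F : Plane → ℂ) (ξ : Plane) : ℝ≥0∞ := ENNReal.ofReal (w ξ ^ s) * ‖F ξ‖ₑ

lemma enorm_weight_mul (s : ℝ) (F : Plane → ℂ) (ξ : Plane) :
    ‖((w ξ ^ s : ℝ) : ℂ) * F ξ‖ₑ = mag s F ξ := by
  rw [enorm_mul, mag, ← ofReal_norm, Complex.norm_real, Real.norm_eq_abs,
    abs_of_nonneg (Real.rpow_nonneg (w_nonneg ξ) s)]

lemma eLpNorm_two_eq_l2 (F : Plane → ℂ) : eLpNorm F 2 volume = l2 (fun ξ => ‖F ξ‖ₑ) := by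
  rw [eLpNorm_eq_lintegral_rpow_enorm_toReal (by norm_num) (by norm_num), l2]
  simp

lemma nrm_eq_l2 (s : ℝ) (F : Plane → ℂ) : nrm s F = l2 (mag s F) := by
  rw [nrm, eLpNorm_two_eq_l2]
  simp only [enorm_weight_mul]

lemma nrm_sq (s : ℝ) (F : Plane → ℂ) : nrm s F ^ 2 = ∫⁻ ξ, mag s F ξ ^ 2 := by
  rw [nrm_eq_l2, l2_sq]

lemma measurable_mag {s : ℝ} {F : Plane → ℂ} (hF : Measurable F) : Measurable (mag s F) := by
  unfold mag
  have := measurable_w_rpow s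
  fun_prop

lemma nrm_congr {s : ℝ} {F G : Plane → ℂ} (h : F =ᵐ[volume] G) : nrm s F = nrm s G :=
  eLpNorm_congr_ae (by filter_upwards [h] with ξ hξ; rw [hξ])

lemma measurable_weight_mul {s : ℝ} {F : Plane → ℂ} (hF : Measurable F) :
    Measurable fun ξ => ((w ξ ^ s : ℝ) : ℂ) * F ξ := by
  have := measurable_w_rpow s
  fun_prop

lemma nrm_add_le {s : ℝ} {F G : Plane → ℂ} (hF : Measurable F) (hG : Measurable G) :
    nrm s (F + G) ≤ nrm s F + nrm s G := by
  have := eLpNorm_add_le (p := 2) (μ := (volume : Measure Plane))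
    (measurable_weight_mul (s := s) hF).aestronglyMeasurable
    (measurable_weight_mul (s := s) hG).aestronglyMeasurable (by norm_num)
  refine le_trans (le_of_eq ?_) this
  unfold nrm; congr 1; ext ξ; simp [mul_add]

lemma nrm_sub_le {s : ℝ} {F G : Plane → ℂ} (hF : Measurable F) (hG : Measurable G) :
    nrm s (F - G) ≤ nrm s F + nrm s G := by
  have := eLpNorm_sub_le (p := 2) (μ := (volume : Measure Plane))
    (measurable_weight_mul (s := s) hF).aestronglyMeasurable
    (measurable_weight_mul (s := s) hG).aestronglyMeasurable (by norm_num)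
  refine le_trans (le_of_eq ?_) this
  unfold nrm; congr 1; ext ξ; simp [mul_sub]

lemma nrm_eq_zero_iff {s : ℝ} {F : Plane → ℂ} (hF : Measurable F) :
    nrm s F = 0 ↔ F =ᵐ[volume] 0 := by
  unfold nrm
  rw [eLpNorm_eq_zero_iff (measurable_weight_mul hF).aestronglyMeasurable (by norm_num)]
  have h0 : ∀ᵐ ξ : Plane, ξ ≠ 0 := by simp [ae_iff]
  constructor
  · intro h
    filter_upwards [h, h0] with ξ hξ h0ξ
    have : (w ξ ^ s : ℝ) ≠ 0 := (Real.rpow_pos_of_pos (w_pos h0ξ) s).ne'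
    simpa [this] using hξ
  · intro h
    filter_upwards [h] with ξ hξ
    simp [hξ]

/-- Interpolation between two homogeneous Sobolev norms. -/
lemma mag_le_add {s s₁ s₂ : ℝ} (h1 : s₁ ≤ s) (h2 : s ≤ s₂) (F : Plane → ℂ) {ξ : Plane}
    (hξ : ξ ≠ 0) : mag s F ξ ≤ mag s₁ F ξ + mag s₂ F ξ := by
  unfold mag
  rw [← add_mul, ← ENNReal.ofReal_add (Real.rpow_nonneg (w_nonneg _) _)
    (Real.rpow_nonneg (w_nonneg _) _)]
  gcongr
  have hw := w_pos hξ
  have p1 := Real.rpow_nonneg hw.le s₁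
  have p2 := Real.rpow_nonneg hw.le s₂
  rcases le_total (w ξ) 1 with h | h
  · have := Real.rpow_le_rpow_of_exponent_ge hw h h1
    linarith
  · have := Real.rpow_le_rpow_of_exponent_le h h2
    linarith

lemma ae_ne_zero : ∀ᵐ ξ : Plane, ξ ≠ 0 := by simp [ae_iff]

lemma nrm_interp {s s₁ s₂ : ℝ} (h1 : s₁ ≤ s) (h2 : s ≤ s₂) {F : Plane → ℂ} (hF : Measurable F) :
    nrm s F ≤ nrm s₁ F + nrm s₂ F := by
  simp only [nrm_eq_l2]
  have e : ∀ f : Plane → ℝ≥0∞, l2 f = eLpNorm f 2 volume := by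
    intro f
    rw [eLpNorm_eq_lintegral_rpow_enorm_toReal (by norm_num) (by norm_num), l2]
    simp
  simp only [e]
  calc _ ≤ eLpNorm (mag s₁ F + mag s₂ F) 2 volume := by
        apply eLpNorm_mono_enorm_ae
        filter_upwards [ae_ne_zero] with ξ hξ
        simpa using mag_le_add h1 h2 F hξ
    _ ≤ _ := eLpNorm_add_le (measurable_mag hF).aestronglyMeasurable
        (measurable_mag hF).aestronglyMeasurable (by norm_num)

/-- A measurable function that is the Fourier transform of an element of `Ḣ^α ∩ Ḣ^{2-2α}`. -/
structure Adm (α : ℝ) (F : Plane → ℂ) : Prop where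
  meas : Measurable F
  low : nrm α F < ⊤
  high : nrm (2 - 2 * α) F < ⊤

/-- Hermitian symmetry: `F` is the Fourier transform of a real function. -/
def Herm (F : Plane → ℂ) : Prop := ∀ᵐ ξ, F (-ξ) = starRingEnd ℂ (F ξ)

lemma Adm.sub {α : ℝ} {F G : Plane → ℂ} (hF : Adm α F) (hG : Adm α G) : Adm α (F - G) :=
  ⟨hF.meas.sub hG.meas, (nrm_sub_le hF.meas hG.meas).trans_lt (ENNReal.add_lt_top.2 ⟨hF.low, hG.low⟩),
    (nrm_sub_le hF.meas hG.meas).trans_lt (ENNReal.add_lt_top.2 ⟨hF.high, hG.high⟩)⟩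

lemma Adm.nrm_lt_top {α s : ℝ} {F : Plane → ℂ} (hF : Adm α F) (h1 : α ≤ s) (h2 : s ≤ 2 - 2 * α) :
    nrm s F < ⊤ :=
  (nrm_interp h1 h2 hF.meas).trans_lt (ENNReal.add_lt_top.2 ⟨hF.low, hF.high⟩)

lemma lintegral_mul_le_l2 {f g : Plane → ℝ≥0∞} (hf : Measurable f) (hg : Measurable g) :
    ∫⁻ x, f x * g x ≤ l2 f * l2 g :=
  lintegral_mul_le_cs hf.aemeasurable hg.aemeasurable

lemma l2_japanese_lt_top {q : ℝ} (hq : 1 < q) :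
    l2 (fun ξ : Plane => ENNReal.ofReal (4 * (1 + ‖ξ‖) ^ (-q))) < ⊤ := by
  have hint : Integrable (fun ξ : Plane => 16 * (1 + ‖ξ‖) ^ (-(2 * q))) volume :=
    (integrable_one_add_norm (by simp; linarith)).const_mul 16
  apply ENNReal.rpow_lt_top_of_nonneg (by norm_num)
  have : ∀ ξ : Plane, ENNReal.ofReal (4 * (1 + ‖ξ‖) ^ (-q)) ^ 2 =
      ENNReal.ofReal (16 * (1 + ‖ξ‖) ^ (-(2 * q))) := by
    intro ξ
    have hp : (0 : ℝ) < 1 + ‖ξ‖ := by positivity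
    rw [← ENNReal.ofReal_pow (by positivity), mul_pow, ← Real.rpow_natCast ((1 + ‖ξ‖) ^ (-q)),
      ← Real.rpow_mul hp.le]
    congr 2
    · norm_num
    · congr 1; push_cast; ring
  simp only [this]
  exact hint.lintegral_lt_top.ne

/-- The weight |ξ|^{-α} is square integrable near the origin, and |ξ|^{-(2-2α)} is so near infinity
because 2 - 2α > 1; Cauchy–Schwarz applies in both regions. Integrability of F makes the velocity
bounded and puts the first factor of `B` into L¹, ready for Young's inequality. -/
lemma Adm.lintegral_lt_top {α : ℝ} (hα0 : 0 < α) (hα1 : α < 1 / 2) {F : Plane → ℂ}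
    (hF : Adm α F) : ∫⁻ ξ, ‖F ξ‖ₑ < ⊤ := by
  -- With β = 1 - α and second argument 1, the model weight is x ^ (-α) for x ≤ 1 and zero beyond.
  have mw : Measurable fun ξ : Plane => ENNReal.ofReal (wt (1 - α) (w ξ) 1) :=
    (Measurable.wt (by fun_prop) (by fun_prop)).ennreal_ofReal
  have hj := l2_japanese_lt_top (q := 2 - 2 * α) (by linarith)
  have hw : l2 (fun ξ : Plane => ENNReal.ofReal (wt (1 - α) (w ξ) 1)) < ⊤ := by
    apply ENNReal.rpow_lt_top_of_nonneg (by norm_num)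
    exact ((lintegral_wt_sq_le (by linarith) zero_le_one).trans_lt ENNReal.ofReal_lt_top).ne
  have mj : Measurable fun ξ : Plane => ENNReal.ofReal (4 * (1 + ‖ξ‖) ^ (-(2 - 2 * α))) := by
    fun_prop
  calc ∫⁻ ξ, ‖F ξ‖ₑ ≤ ∫⁻ ξ, (ENNReal.ofReal (wt (1 - α) (w ξ) 1) * mag α F ξ +
        ENNReal.ofReal (4 * (1 + ‖ξ‖) ^ (-(2 - 2 * α))) * mag (2 - 2 * α) F ξ) := by
        apply lintegral_mono_ae
        filter_upwards [ae_ne_zero] with ξ hξ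
        have hw := w_pos hξ
        unfold mag
        rcases le_or_gt (w ξ) 1 with h | h
        · apply le_add_right
          rw [← mul_assoc, ← ENNReal.ofReal_mul (wt_nonneg hw.le zero_le_one), wt, if_pos h,
            Real.one_rpow, mul_one, ← Real.rpow_add hw, show -1 + (1 - α) + α = 0 by ring]
          simp
        · apply le_add_left
          rw [← mul_assoc, ← ENNReal.ofReal_mul (by positivity)]
          have h2 : 1 + ‖ξ‖ ≤ 2 * w ξ := by
            have : ‖ξ‖ ≤ w ξ := by
              unfold w
              nlinarith [norm_nonneg ξ, Real.pi_gt_three]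
            linarith
          have := rpow_neg_le_of_le_two_mul (q := 2 - 2 * α) (by positivity : 0 < 1 + ‖ξ‖) h2
            (by linarith) (by linarith)
          have h3 : (1 : ℝ) ≤ 4 * (1 + ‖ξ‖) ^ (-(2 - 2 * α)) * w ξ ^ (2 - 2 * α) := by
            calc (1 : ℝ) = w ξ ^ (-(2 - 2 * α)) * w ξ ^ (2 - 2 * α) := by
                  rw [← Real.rpow_add hw]; simp
              _ ≤ _ := by gcongr
          calc ‖F ξ‖ₑ = 1 * ‖F ξ‖ₑ := (one_mul _).symm
            _ ≤ _ := by
              gcongr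
              rw [← ENNReal.ofReal_one]
              exact ENNReal.ofReal_le_ofReal h3
    _ ≤ l2 (fun ξ : Plane => ENNReal.ofReal (wt (1 - α) (w ξ) 1)) * l2 (mag α F) +
        l2 (fun ξ : Plane => ENNReal.ofReal (4 * (1 + ‖ξ‖) ^ (-(2 - 2 * α)))) *
          l2 (mag (2 - 2 * α) F) := by
        rw [lintegral_add_left (by have := measurable_mag (s := α) hF.meas; fun_prop)]
        exact add_le_add (lintegral_mul_le_l2 mw (measurable_mag hF.meas))
          (lintegral_mul_le_l2 mj (measurable_mag hF.meas))
    _ < ⊤ := by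
        rw [← nrm_eq_l2, ← nrm_eq_l2]
        exact ENNReal.add_lt_top.2 ⟨ENNReal.mul_lt_top hw hF.low, ENNReal.mul_lt_top hj hF.high⟩

/-! ### The bilinear and trilinear forms and their estimates. -/

/-- The integrand of the trilinear form. -/
def tk (U F G : Plane → ℂ) (p : Plane × Plane) : ℂ :=
  (kerR p.1 p.2 : ℂ) * U p.1 * F p.2 * starRingEnd ℂ (G (p.1 + p.2))

/-- The trilinear form `⟨v · ∇θ, g⟩` on the Fourier side. -/
def Tri (U F G : Plane → ℂ) : ℂ := ∫ p, tk U F G p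

/-- The Fourier transform of `v · ∇θ`. -/
def B (U F : Plane → ℂ) (ξ : Plane) : ℂ := ∫ a, (kerR a (ξ - a) : ℂ) * U a * F (ξ - a)

lemma enorm_ofReal (x : ℝ) : ‖(x : ℂ)‖ₑ = ENNReal.ofReal |x| := by
  rw [← ofReal_norm, Complex.norm_real, Real.norm_eq_abs]

lemma enorm_tk (U F G : Plane → ℂ) (p : Plane × Plane) :
    ‖tk U F G p‖ₑ =
      ENNReal.ofReal |kerR p.1 p.2| * (‖U p.1‖ₑ * ‖F p.2‖ₑ * ‖G (p.1 + p.2)‖ₑ) := by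
  unfold tk
  rw [enorm_mul, enorm_mul, enorm_mul, enorm_ofReal, RCLike.enorm_conj]
  ring

lemma measurable_tk {U F G : Plane → ℂ} (hU : Measurable U) (hF : Measurable F)
    (hG : Measurable G) : Measurable (tk U F G) := by
  have := measurable_kerR
  have hc : Measurable (starRingEnd ℂ) := Complex.continuous_conj.measurable
  unfold tk
  exact (((Complex.measurable_ofReal.comp this).mul (hU.comp measurable_fst)).mul
    (hF.comp measurable_snd)).mul (hc.comp (hG.comp (measurable_fst.add measurable_snd)))

lemma enorm_eq_mag (s : ℝ) (F : Plane → ℂ) {ξ : Plane} (hξ : ξ ≠ 0) :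
    ‖F ξ‖ₑ = ENNReal.ofReal (w ξ ^ (-s)) * mag s F ξ := by
  have hw := w_pos hξ
  rw [mag, ← mul_assoc, ← ENNReal.ofReal_mul (by positivity), ← Real.rpow_add hw]
  simp

lemma mul_enorm_le_wt3 {α m C : ℝ} {s₁ s₂ s₃ : ℝ} {a b : Plane} (hm : 0 ≤ m)
    (ha : a ≠ 0) (hb : b ≠ 0) (hab : a + b ≠ 0)
    (h : m * (w a ^ (-s₁) * w b ^ (-s₂) * w (a + b) ^ (-s₃)) ≤ C * wt3 α (w a) (w b) (w (a + b)))
    (U F G : Plane → ℂ) (hC : 0 ≤ C) :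
    ENNReal.ofReal m * (‖U a‖ₑ * ‖F b‖ₑ * ‖G (a + b)‖ₑ) ≤
      ENNReal.ofReal C * (ENNReal.ofReal (wt3 α (w a) (w b) (w (a + b))) *
        (mag s₁ U a * mag s₂ F b * mag s₃ G (a + b))) := by
  rw [enorm_eq_mag s₁ U ha, enorm_eq_mag s₂ F hb, enorm_eq_mag s₃ G hab]
  have p1 := Real.rpow_nonneg (w_nonneg a) (-s₁)
  have p2 := Real.rpow_nonneg (w_nonneg b) (-s₂)
  have p3 := Real.rpow_nonneg (w_nonneg (a + b)) (-s₃)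
  calc _ = ENNReal.ofReal (m * (w a ^ (-s₁) * w b ^ (-s₂) * w (a + b) ^ (-s₃))) *
        (mag s₁ U a * mag s₂ F b * mag s₃ G (a + b)) := by
        rw [ENNReal.ofReal_mul hm, ENNReal.ofReal_mul (by positivity), ENNReal.ofReal_mul p1]
        ring
    _ ≤ ENNReal.ofReal (C * wt3 α (w a) (w b) (w (a + b))) *
        (mag s₁ U a * mag s₂ F b * mag s₃ G (a + b)) := by gcongr
    _ = _ := by rw [ENNReal.ofReal_mul hC]; ring

lemma w_triangle (a b : Plane) :
    w a ≤ w b + w (a + b) ∧ w b ≤ w a + w (a + b) ∧ w (a + b) ≤ w a + w b := by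
  refine ⟨?_, ?_, w_add_le a b⟩
  · have := w_add_le (a + b) (-b)
    rw [w_neg, add_neg_cancel_right] at this; linarith
  · have := w_add_le (a + b) (-a)
    rw [w_neg, add_neg_cancel_comm] at this; linarith

/-- Disposes of the degenerate frequencies, where the negative powers in the weights carry no
information. -/
lemma kerR_eq_zero_of {a b : Plane} (h : ¬ (a ≠ 0 ∧ b ≠ 0 ∧ a + b ≠ 0)) : kerR a b = 0 := by
  by_cases ha : a = 0
  · rw [ha, kerR_zero_left]
  by_cases hb : b = 0
  · rw [hb, kerR_zero_right]
  · have hab : a + b = 0 := by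
      by_contra hab; exact h ⟨ha, hb, hab⟩
    rw [← kerR_add_self, hab, kerR_zero_right]

/-- The trilinear estimate in `Ḣ^α × Ḣ^{2-2α} × Ḣ^α`. -/
lemma lintegral_tk_le {α : ℝ} (hα0 : 0 < α) (hα1 : α < 1 / 2) {U F G : Plane → ℂ}
    (hU : Measurable U) (hF : Measurable F) (hG : Measurable G) :
    ∫⁻ p, ‖tk U F G p‖ₑ ≤ 4 * triConst α * (nrm α U * nrm (2 - 2 * α) F * nrm α G) := by
  calc ∫⁻ p, ‖tk U F G p‖ₑ ≤ ∫⁻ p : Plane × Plane, ENNReal.ofReal 4 *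
        (ENNReal.ofReal (wt3 α (w p.1) (w p.2) (w (p.1 + p.2))) *
          (mag α U p.1 * mag (2 - 2 * α) F p.2 * mag α G (p.1 + p.2))) := by
        apply lintegral_mono
        rintro ⟨a, b⟩
        dsimp only
        rw [enorm_tk]
        by_cases h : a ≠ 0 ∧ b ≠ 0 ∧ a + b ≠ 0
        · obtain ⟨ha, hb, hab⟩ := h
          obtain ⟨t1, t2, t3⟩ := w_triangle a b
          refine le_trans ?_ (mul_enorm_le_wt3 (m := min (w b) (w (a + b))) (s₁ := α)
            (s₂ := 2 - 2 * α) (s₃ := α) (le_min (w_nonneg b) (w_nonneg _)) ha hb hab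
            (weight_bound_low hα0 hα1 (w_pos ha) (w_pos hb) (w_pos hab) t1 t2) U F G (by norm_num))
          gcongr
          exact le_min (abs_kerR_le a b) (abs_kerR_le_add a b)
        · rw [kerR_eq_zero_of h]; simp
    _ ≤ _ := by
        rw [lintegral_const_mul' _ _ ENNReal.ofReal_ne_top, nrm_eq_l2, nrm_eq_l2, nrm_eq_l2,
          mul_assoc]
        simp only [ENNReal.ofReal_ofNat]
        gcongr
        exact lintegral_wt3_le hα0 (measurable_mag hU) (measurable_mag hF) (measurable_mag hG)

/-- The commutator estimate in `Ḣ^{2-2α}`. -/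
lemma lintegral_commutator_le {α : ℝ} (hα0 : 0 < α) (hα1 : α < 1 / 2) {U F G : Plane → ℂ}
    (hU : Measurable U) (hF : Measurable F) (hG : Measurable G) :
    ∫⁻ p : Plane × Plane, ENNReal.ofReal |w (p.1 + p.2) ^ (4 - 6 * α) - w p.2 ^ (4 - 6 * α)| *
      ‖tk U F G p‖ₑ ≤
      128 * triConst α * (nrm (2 - 2 * α) U * nrm (2 - 2 * α) F * nrm (2 - 2 * α) G) := by
  calc _ ≤ ∫⁻ p : Plane × Plane, ENNReal.ofReal 128 *
        (ENNReal.ofReal (wt3 α (w p.1) (w p.2) (w (p.1 + p.2))) *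
          (mag (2 - 2 * α) U p.1 * mag (2 - 2 * α) F p.2 * mag (2 - 2 * α) G (p.1 + p.2))) := by
        apply lintegral_mono
        rintro ⟨a, b⟩
        dsimp only
        rw [enorm_tk]
        by_cases h : a ≠ 0 ∧ b ≠ 0 ∧ a + b ≠ 0
        · obtain ⟨ha, hb, hab⟩ := h
          obtain ⟨t1, t2, t3⟩ := w_triangle a b
          refine le_trans ?_ (mul_enorm_le_wt3
            (m := min (w b) (w (a + b)) * |w (a + b) ^ (4 - 6 * α) - w b ^ (4 - 6 * α)|)
            (s₁ := 2 - 2 * α) (s₂ := 2 - 2 * α) (s₃ := 2 - 2 * α)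
            (mul_nonneg (le_min (w_nonneg b) (w_nonneg _)) (abs_nonneg _)) ha hb hab
            (weight_bound_high hα0 hα1 (w_pos ha) (w_pos hb) (w_pos hab) t1 t2 t3) U F G
            (by norm_num))
          rw [← mul_assoc, ← ENNReal.ofReal_mul (abs_nonneg _), mul_comm |_ - _|]
          gcongr
          exact le_min (abs_kerR_le a b) (abs_kerR_le_add a b)
        · rw [kerR_eq_zero_of h]; simp
    _ ≤ _ := by
        rw [lintegral_const_mul' _ _ ENNReal.ofReal_ne_top, nrm_eq_l2, nrm_eq_l2, nrm_eq_l2,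
          mul_assoc]
        simp only [ENNReal.ofReal_ofNat]
        gcongr
        exact lintegral_wt3_le hα0 (measurable_mag hU) (measurable_mag hF) (measurable_mag hG)

lemma Adm.tk_integrable {α : ℝ} (hα0 : 0 < α) (hα1 : α < 1 / 2) {U F G : Plane → ℂ}
    (hU : Adm α U) (hF : Adm α F) (hG : Adm α G) : Integrable (tk U F G) volume := by
  refine ⟨(measurable_tk hU.meas hF.meas hG.meas).aestronglyMeasurable, ?_⟩
  refine (lintegral_tk_le hα0 hα1 hU.meas hF.meas hG.meas).trans_lt ?_
  exact ENNReal.mul_lt_top (ENNReal.mul_lt_top (by norm_num) (triConst_ne_top α).lt_top)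
    (ENNReal.mul_lt_top (ENNReal.mul_lt_top hU.low hF.high) hG.low)

lemma measurable_B_integrand {U F : Plane → ℂ} (hU : Measurable U) (hF : Measurable F) :
    Measurable fun p : Plane × Plane => (kerR p.2 (p.1 - p.2) : ℂ) * U p.2 * F (p.1 - p.2) := by
  have h1 : Measurable fun p : Plane × Plane => kerR p.2 (p.1 - p.2) :=
    measurable_kerR.comp (measurable_snd.prodMk (measurable_fst.sub measurable_snd))
  fun_prop

lemma measurable_B {U F : Plane → ℂ} (hU : Measurable U) (hF : Measurable F) :
    Measurable (B U F) :=
  (measurable_B_integrand hU hF).stronglyMeasurable.integral_prod_right'.measurable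

/-- Young's inequality for a bilinear integral operator dominated by a convolution. -/
lemma bilin_young {κ : Plane → Plane → ℂ} {p q : Plane → ℝ≥0∞} (hp : Measurable p)
    (hq : Measurable q) (hp1 : ∫⁻ a, p a < ⊤) (hq2 : l2 q < ⊤)
    (hκm : Measurable fun z : Plane × Plane => κ z.1 z.2)
    (hκ : ∀ ξ a, ‖κ ξ a‖ₑ ≤ p a * q (ξ - a)) :
    (∀ᵐ ξ, Integrable (κ ξ) volume) ∧
      eLpNorm (fun ξ => ∫ a, κ ξ a) 2 volume ≤ (∫⁻ a, p a) * l2 q := by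
  have hY := lintegral_young hp hq
  have hfin : (∫⁻ a, p a) ^ 2 * ∫⁻ a, q a ^ 2 < ⊤ := by
    rw [← l2_sq]
    exact ENNReal.mul_lt_top (ENNReal.pow_lt_top hp1) (ENNReal.pow_lt_top hq2)
  have hmeas : Measurable fun ξ => ∫⁻ a, p a * q (ξ - a) :=
    Measurable.lintegral_prod_right' (f := fun z : Plane × Plane => p z.2 * q (z.1 - z.2))
      (by fun_prop)
  constructor
  · have := ae_lt_top (hmeas.pow_const 2) (hY.trans_lt hfin).ne
    filter_upwards [this] with ξ hξ
    refine ⟨(hκm.comp measurable_prodMk_left).aestronglyMeasurable, ?_⟩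
    refine (lintegral_mono (hκ ξ)).trans_lt ?_
    by_contra h
    rw [not_lt, top_le_iff] at h
    simp [h] at hξ
  · rw [eLpNorm_two_eq_l2]
    calc _ ≤ l2 (fun ξ => ∫⁻ a, p a * q (ξ - a)) := by
          unfold l2
          gcongr with ξ
          exact (enorm_integral_le_lintegral_enorm _).trans (lintegral_mono (hκ ξ))
      _ ≤ ((∫⁻ a, p a) ^ 2 * ∫⁻ a, q a ^ 2) ^ (1 / 2 : ℝ) := by
          unfold l2; gcongr
      _ = _ := by
          rw [ENNReal.mul_rpow_of_nonneg _ _ (by norm_num), l2, ← ENNReal.rpow_natCast,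
            ← ENNReal.rpow_mul]
          norm_num

lemma enorm_B_integrand_le (U F : Plane → ℂ) (ξ a : Plane) :
    ‖(kerR a (ξ - a) : ℂ) * U a * F (ξ - a)‖ₑ ≤ ‖U a‖ₑ * mag 1 F (ξ - a) := by
  rw [enorm_mul, enorm_mul, enorm_ofReal, mag, Real.rpow_one]
  calc _ ≤ ENNReal.ofReal (w (ξ - a)) * ‖U a‖ₑ * ‖F (ξ - a)‖ₑ := by
        gcongr; exact abs_kerR_le _ _
    _ = _ := by ring

lemma B_young {U F : Plane → ℂ} (hU : Measurable U) (hF : Measurable F)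
    (hU1 : ∫⁻ ξ, ‖U ξ‖ₑ < ⊤) (hF1 : nrm 1 F < ⊤) :
    (∀ᵐ ξ, Integrable (fun a => (kerR a (ξ - a) : ℂ) * U a * F (ξ - a)) volume) ∧
      eLpNorm (B U F) 2 volume ≤ (∫⁻ ξ, ‖U ξ‖ₑ) * nrm 1 F := by
  rw [nrm_eq_l2] at *
  exact bilin_young (κ := fun ξ a => (kerR a (ξ - a) : ℂ) * U a * F (ξ - a)) hU.enorm
    (measurable_mag hF) hU1 hF1 (measurable_B_integrand hU hF) (enorm_B_integrand_le U F)

/-! ### Skew-symmetry of the transport term and stability in the weaker norm. -/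

section Adm

variable {α : ℝ} {U U' F F' G : Plane → ℂ}

lemma Adm.integrable (hα0 : 0 < α) (hα1 : α < 1 / 2) (hF : Adm α F) : Integrable F volume :=
  ⟨hF.meas.aestronglyMeasurable, hF.lintegral_lt_top hα0 hα1⟩

lemma Adm.B_integrable (hα0 : 0 < α) (hα1 : α < 1 / 2) (hU : Adm α U) (hF : Adm α F) :
    ∀ᵐ ξ, Integrable (fun a => (kerR a (ξ - a) : ℂ) * U a * F (ξ - a)) volume :=
  (B_young hU.meas hF.meas (hU.lintegral_lt_top hα0 hα1)
    (hF.nrm_lt_top (by linarith) (by linarith))).1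

lemma Adm.B_memLp (hα0 : 0 < α) (hα1 : α < 1 / 2) (hU : Adm α U) (hF : Adm α F) :
    MemLp (B U F) 2 volume :=
  ⟨(measurable_B hU.meas hF.meas).aestronglyMeasurable,
    (B_young hU.meas hF.meas (hU.lintegral_lt_top hα0 hα1)
      (hF.nrm_lt_top (by linarith) (by linarith))).2.trans_lt
      (ENNReal.mul_lt_top (hU.lintegral_lt_top hα0 hα1)
        (hF.nrm_lt_top (by linarith) (by linarith)))⟩

lemma Adm.B_sub_right (hα0 : 0 < α) (hα1 : α < 1 / 2) (hU : Adm α U) (hF : Adm α F)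
    (hF' : Adm α F') : ∀ᵐ ξ, B U (F - F') ξ = B U F ξ - B U F' ξ := by
  filter_upwards [hU.B_integrable hα0 hα1 hF, hU.B_integrable hα0 hα1 hF'] with ξ h1 h2
  unfold B
  rw [← integral_sub h1 h2]
  congr 1; ext a; simp only [Pi.sub_apply]; ring

lemma Adm.B_sub_left (hα0 : 0 < α) (hα1 : α < 1 / 2) (hU : Adm α U) (hU' : Adm α U')
    (hF : Adm α F) : ∀ᵐ ξ, B (U - U') F ξ = B U F ξ - B U' F ξ := by
  filter_upwards [hU.B_integrable hα0 hα1 hF, hU'.B_integrable hα0 hα1 hF] with ξ h1 h2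
  unfold B
  rw [← integral_sub h1 h2]
  congr 1; ext a; simp only [Pi.sub_apply]; ring

lemma B_congr (hU : U =ᵐ[volume] U') (hF : F =ᵐ[volume] F') (ξ : Plane) :
    B U F ξ = B U' F' ξ := by
  unfold B
  apply integral_congr_ae
  have : ∀ᵐ a, F (ξ - a) = F' (ξ - a) :=
    (Measure.measurePreserving_sub_left volume ξ).quasiMeasurePreserving.ae hF
  filter_upwards [hU, this] with a h1 h2
  rw [h1, h2]

/-- The shear (a, b) ↦ (a, a + b) preserves the measure and prepares Fubini's theorem. Integrability
of the pairing comes from the trilinear estimate, since G need not be square integrable. -/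
lemma Adm.tri_eq (hα0 : 0 < α) (hα1 : α < 1 / 2) (hU : Adm α U) (hF : Adm α F) (hG : Adm α G) :
    Integrable (fun ξ => B U F ξ * starRingEnd ℂ (G ξ)) volume ∧
      Tri U F G = ∫ ξ, B U F ξ * starRingEnd ℂ (G ξ) := by
  let h : Plane × Plane → ℂ := fun p =>
    ((kerR p.1 (p.2 - p.1) : ℂ) * U p.1 * F (p.2 - p.1)) * starRingEnd ℂ (G p.2)
  have hmp : MeasurePreserving (fun z : Plane × Plane => (z.1, z.1 + z.2)) volume volume :=
    measurePreserving_prod_add volume volume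
  have hcomp : tk U F G = h ∘ fun z : Plane × Plane => (z.1, z.1 + z.2) := by
    ext ⟨a, b⟩
    simp only [tk, h, Function.comp, add_sub_cancel_left]
  have hme : MeasurableEmbedding (fun z : Plane × Plane => (z.1, z.1 + z.2)) :=
    (MeasurableEquiv.shearAddRight Plane).measurableEmbedding
  have hint : Integrable h volume := by
    rw [← hmp.integrable_comp_emb hme, ← hcomp]
    exact hU.tk_integrable hα0 hα1 hF hG
  have e : Tri U F G = ∫ p, h p := by
    rw [← hmp.integral_comp hme, Tri, hcomp]; rfl
  have e2 : ∀ ξ, ∫ a, h (a, ξ) = B U F ξ * starRingEnd ℂ (G ξ) := by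
    intro ξ
    simp only [h, B]
    rw [integral_mul_const]
  constructor
  · have := hint.integral_prod_right
    simpa only [e2] using this
  · rw [e, Measure.volume_eq_prod, integral_prod_symm _ hint]
    simp only [e2]

/-- The substitution (a, b) ↦ (-a, a + b) exchanges the arguments of F and G, changes the sign of
the kernel and conjugates U. In physical space this is integration by parts against a real
divergence-free field. -/
lemma tri_skew (hU : Herm U) : Tri U F G = -starRingEnd ℂ (Tri U G F) := by
  have hmp : MeasurePreserving (fun z : Plane × Plane => (-z.1, z.1 + z.2)) volume volume := by
    have h1 : MeasurePreserving (fun z : Plane × Plane => (z.1, z.1 + z.2)) volume volume :=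
      measurePreserving_prod_add volume volume
    have h2 : MeasurePreserving (Prod.map Neg.neg id : Plane × Plane → Plane × Plane)
        volume volume :=
      (Measure.measurePreserving_neg volume).prod (MeasurePreserving.id volume)
    exact h2.comp h1
  have hme : MeasurableEmbedding (fun z : Plane × Plane => (-z.1, z.1 + z.2)) := by
    have h2 : MeasurableEmbedding (Prod.map Neg.neg id : Plane × Plane → Plane × Plane) :=
      ((MeasurableEquiv.neg Plane).prodCongr (MeasurableEquiv.refl Plane)).measurableEmbedding
    exact h2.comp (MeasurableEquiv.shearAddRight Plane).measurableEmbedding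
  unfold Tri
  rw [← hmp.integral_comp hme, ← integral_conj, ← integral_neg]
  apply integral_congr_ae
  have hU2 : ∀ᵐ p : Plane × Plane, U (-p.1) = starRingEnd ℂ (U p.1) :=
    Measure.quasiMeasurePreserving_fst.ae hU
  filter_upwards [hU2] with p hp
  simp only [tk, kerR_neg_left, kerR_add_self, hp, neg_add_cancel_left]
  simp only [map_mul, Complex.conj_ofReal, Complex.ofReal_neg, Complex.conj_conj]
  ring

lemma tri_self_re (hU : Herm U) : (Tri U F F).re = 0 := by
  have := congrArg Complex.re (tri_skew (F := F) (G := F) hU)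
  simp only [Complex.neg_re, Complex.conj_re] at this
  linarith

/-- `F` solves the linear transport equation with velocity given by `U`, on the Fourier side. -/
def Solves (α : ℝ) (U F f : Plane → ℂ) : Prop :=
  ∀ᵐ ξ, ((w ξ ^ (2 * α) : ℝ) : ℂ) * F ξ + B U F ξ = f ξ

lemma mag_sq_eq (s : ℝ) (F : Plane → ℂ) (ξ : Plane) :
    mag s F ξ ^ 2 = ENNReal.ofReal ((w ξ ^ s) ^ 2 * ‖F ξ‖ ^ 2) := by
  have := Real.rpow_nonneg (w_nonneg ξ) s
  rw [mag, mul_pow, ENNReal.ofReal_mul (by positivity), ENNReal.ofReal_pow this,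
    ENNReal.ofReal_pow (norm_nonneg _), ofReal_norm]

lemma rpow_sq {x : ℝ} (hx : 0 ≤ x) (s : ℝ) : (x ^ s) ^ 2 = x ^ (2 * s) := by
  rw [← Real.rpow_natCast, ← Real.rpow_mul hx]; congr 1; push_cast; ring

/-- The difference D satisfies Λ^{2α} D + B(U, D) = -B(U - U', F'), with Λ^{2α} the dissipation.
Paired with D, the term B(U, D) has zero real part by skewness, and the trilinear estimate bounds
the right-hand side; one factor `nrm α D` cancels. The higher regularity is spent on F', and the
differences are only measured in Ḣ^α. -/
lemma stability (hα0 : 0 < α) (hα1 : α < 1 / 2) {f : Plane → ℂ} (hU : Adm α U) (hUH : Herm U)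
    (hU' : Adm α U') (hF : Adm α F) (hF' : Adm α F') (h : Solves α U F f)
    (h' : Solves α U' F' f) :
    nrm α (F - F') ≤ 4 * triConst α * (nrm (2 - 2 * α) F' * nrm α (U - U')) := by
  set D := F - F' with hDdef
  have hD : Adm α D := hF.sub hF'
  have hV : Adm α (U - U') := hU.sub hU'
  have eq : ∀ᵐ ξ, ((w ξ ^ (2 * α) : ℝ) : ℂ) * D ξ = -(B U D ξ + B (U - U') F' ξ) := by
    filter_upwards [h, h', hU.B_sub_right hα0 hα1 hF hF', hU.B_sub_left hα0 hα1 hU' hF'] with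
      ξ h1 h2 h3 h4
    rw [hDdef, h3, h4, Pi.sub_apply]
    linear_combination h1 - h2
  obtain ⟨i1, t1⟩ := hU.tri_eq hα0 hα1 hD hD
  obtain ⟨i2, t2⟩ := hV.tri_eq hα0 hα1 hF' hD
  have eq2 : ∀ᵐ ξ, (((w ξ ^ α) ^ 2 * ‖D ξ‖ ^ 2 : ℝ) : ℂ) =
      -(B U D ξ * starRingEnd ℂ (D ξ) + B (U - U') F' ξ * starRingEnd ℂ (D ξ)) := by
    filter_upwards [eq] with ξ hξ
    rw [← add_mul, ← neg_mul, ← hξ, mul_assoc, Complex.mul_conj, Complex.normSq_eq_norm_sq,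
      rpow_sq (w_nonneg ξ)]
    push_cast; ring
  have hint : Integrable (fun ξ => (((w ξ ^ α) ^ 2 * ‖D ξ‖ ^ 2 : ℝ) : ℂ)) volume :=
    (integrable_congr eq2).2 (i1.add i2).neg
  have hint' : Integrable (fun ξ => (w ξ ^ α) ^ 2 * ‖D ξ‖ ^ 2) volume := by
    simpa only [RCLike.re_eq_complex_re, Complex.ofReal_re] using hint.re
  have key : ((∫ ξ, (w ξ ^ α) ^ 2 * ‖D ξ‖ ^ 2 : ℝ) : ℂ) = -(Tri U D D + Tri (U - U') F' D) := by
    rw [← integral_complex_ofReal, integral_congr_ae eq2, integral_neg, integral_add i1 i2, t1, t2]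
  have key2 : ∫ ξ, (w ξ ^ α) ^ 2 * ‖D ξ‖ ^ 2 ≤ ‖Tri (U - U') F' D‖ := by
    have := congrArg Complex.re key
    rw [Complex.ofReal_re, Complex.neg_re, Complex.add_re, tri_self_re hUH, zero_add] at this
    rw [this]
    calc _ ≤ |(Tri (U - U') F' D).re| := neg_le_abs _
      _ ≤ _ := Complex.abs_re_le_norm _
  have key3 : nrm α D ^ 2 ≤ 4 * triConst α * (nrm α (U - U') * nrm (2 - 2 * α) F' * nrm α D) := by
    calc nrm α D ^ 2 = ENNReal.ofReal (∫ ξ, (w ξ ^ α) ^ 2 * ‖D ξ‖ ^ 2) := by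
          rw [nrm_sq, ofReal_integral_eq_lintegral_ofReal hint'
            (ae_of_all _ fun ξ => by positivity)]
          congr 1; ext ξ; rw [mag_sq_eq]
      _ ≤ ENNReal.ofReal ‖Tri (U - U') F' D‖ := ENNReal.ofReal_le_ofReal key2
      _ = ‖Tri (U - U') F' D‖ₑ := ofReal_norm _
      _ ≤ ∫⁻ p, ‖tk (U - U') F' D p‖ₑ := enorm_integral_le_lintegral_enorm _
      _ ≤ _ := lintegral_tk_le hα0 hα1 hV.meas hF'.meas hD.meas
  rcases eq_or_ne (nrm α D) 0 with h0 | h0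
  · rw [h0]; exact zero_le
  · rw [← ENNReal.mul_le_mul_iff_left h0 hD.low.ne]
    calc nrm α D * nrm α D = nrm α D ^ 2 := (sq _).symm
      _ ≤ _ := key3
      _ = _ := by ring

end Adm

/-! ### Lions' theorem and the test functions. -/

/-- Lions' projection theorem: a form that is only defined for test elements in the second
argument, but coercive on them, represents every functional. -/
lemma exists_of_coercive {E H : Type*} [AddCommGroup E] [Module ℂ E] [NormedAddCommGroup H]
    [InnerProductSpace ℂ H] [CompleteSpace H] (X Y : E →ₗ[ℂ] H) {c : ℝ} (hc : 0 < c)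
    (hco : ∀ e, c * ‖X e‖ ^ 2 ≤ (inner ℂ (Y e) (X e)).re) (g : H) :
    ∃ F : H, ‖F‖ ≤ ‖g‖ / c ∧ ∀ e, inner ℂ (Y e) F = inner ℂ (X e) g := by
  have hXY : ∀ e, ‖X e‖ ≤ ‖Y e‖ / c := by
    intro e
    rw [le_div_iff₀ hc]
    rcases eq_or_ne (‖X e‖) 0 with h | h
    · rw [h]; simp
    · have h1 := (hco e).trans (((Complex.re_le_norm _)).trans (norm_inner_le_norm _ _))
      have h2 : 0 < ‖X e‖ := lt_of_le_of_ne (norm_nonneg _) h.symm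
      nlinarith
  -- Coercivity bounds X e by Y e, so the pairing of g with X e is a bounded functional of Y e. It
  -- extends from the range of Y by Hahn–Banach and is represented by a vector of H.
  let φ₀ : E →ₗ[ℂ] ℂ := (innerSL ℂ g).toLinearMap ∘ₗ X
  have hker : LinearMap.ker Y ≤ LinearMap.ker φ₀ := by
    intro e he
    rw [LinearMap.mem_ker] at he ⊢
    have : ‖X e‖ ≤ 0 := by simpa [he] using hXY e
    have : X e = 0 := norm_le_zero_iff.1 this
    simp [φ₀, this]
  let ψ : LinearMap.range Y →ₗ[ℂ] ℂ :=
    (LinearMap.ker Y).liftQ φ₀ hker ∘ₗ Y.quotKerEquivRange.symm.toLinearMap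
  have hψ : ∀ e, ψ ⟨Y e, LinearMap.mem_range_self Y e⟩ = inner ℂ g (X e) := by
    intro e
    simp only [ψ, LinearMap.comp_apply, LinearEquiv.coe_coe]
    rw [LinearMap.quotKerEquivRange_symm_apply_image Y e]
    simp [φ₀]
  have hb : ∀ y : LinearMap.range Y, ‖ψ y‖ ≤ ‖g‖ / c * ‖y‖ := by
    rintro ⟨y, e, rfl⟩
    rw [hψ]
    calc _ ≤ ‖g‖ * ‖X e‖ := norm_inner_le_norm _ _
      _ ≤ ‖g‖ * (‖Y e‖ / c) := by gcongr; exact hXY e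
      _ = ‖g‖ / c * ‖Y e‖ := by ring
  obtain ⟨G, hG, hGn⟩ := exists_extension_norm_eq (LinearMap.range Y) (ψ.mkContinuous _ hb)
  refine ⟨(InnerProductSpace.toDual ℂ H).symm G, ?_, ?_⟩
  · rw [LinearIsometryEquiv.norm_map, hGn]
    exact LinearMap.mkContinuous_norm_le _ (by positivity) _
  · intro e
    have h1 := hG ⟨Y e, LinearMap.mem_range_self Y e⟩
    rw [LinearMap.mkContinuous_apply, hψ] at h1
    rw [← inner_conj_symm, InnerProductSpace.toDual_symm_apply, h1, inner_conj_symm]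

/-- Bounded measurable functions with bounded support. -/
def testFunctions : Submodule ℂ (Plane → ℂ) where
  carrier := {Ψ | Measurable Ψ ∧ ∃ n : ℝ, ∀ ξ, ‖Ψ ξ‖ ≤ n ∧ (n < ‖ξ‖ → Ψ ξ = 0)}
  zero_mem' := ⟨measurable_const, 0, fun ξ => by simp⟩
  add_mem' := by
    rintro Ψ Φ ⟨m1, n1, h1⟩ ⟨m2, n2, h2⟩
    refine ⟨m1.add m2, n1 + n2, fun ξ => ⟨(norm_add_le _ _).trans
      (add_le_add (h1 ξ).1 (h2 ξ).1), fun h => ?_⟩⟩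
    have p1 := (norm_nonneg _).trans (h1 ξ).1
    have p2 := (norm_nonneg _).trans (h2 ξ).1
    rw [Pi.add_apply, (h1 ξ).2 (by linarith), (h2 ξ).2 (by linarith), add_zero]
  smul_mem' := by
    rintro c Ψ ⟨m1, n1, h1⟩
    -- One number bounds both the values and the support; the maximum keeps the support covered when
    -- ‖c‖ < 1.
    refine ⟨m1.const_smul c, max (‖c‖ * n1) n1, fun ξ => ⟨?_, fun h => ?_⟩⟩
    · rw [Pi.smul_apply, norm_smul]
      exact le_max_of_le_left (by gcongr; exact (h1 ξ).1)
    · rw [Pi.smul_apply, (h1 ξ).2 ((le_max_right _ _).trans_lt h), smul_zero]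

lemma memLp_of_bounded {G : Plane → ℂ} (hG : Measurable G) {C n : ℝ}
    (h : ∀ ξ, ‖ξ‖ ≤ n → ‖G ξ‖ ≤ C) (h0 : ∀ ξ, n < ‖ξ‖ → G ξ = 0) (p : ℝ≥0∞) :
    MemLp G p volume := by
  have : MemLp ((Metric.closedBall (0 : Plane) n).indicator fun _ => C) p volume :=
    memLp_indicator_const p measurableSet_closedBall C (Or.inr measure_closedBall_lt_top.ne)
  refine this.mono' hG.aestronglyMeasurable (ae_of_all _ fun ξ => ?_)
  by_cases hξ : ‖ξ‖ ≤ n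
  · rw [Set.indicator_of_mem (by simpa using hξ)]; exact h ξ hξ
  · rw [Set.indicator_of_notMem (by simpa using hξ), h0 ξ (not_le.1 hξ), norm_zero]

lemma nrm_lt_top_of_bounded {G : Plane → ℂ} (hG : Measurable G) {C n s : ℝ} (hs : 0 ≤ s)
    (h : ∀ ξ, ‖ξ‖ ≤ n → ‖G ξ‖ ≤ C) (h0 : ∀ ξ, n < ‖ξ‖ → G ξ = 0) : nrm s G < ⊤ := by
  refine (memLp_of_bounded (C := (2 * Real.pi * n) ^ s * C) (n := n) (measurable_weight_mul hG)
    (fun ξ hξ => ?_) (fun ξ hξ => by rw [h0 ξ hξ, mul_zero]) 2).2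
  have := w_nonneg ξ
  rw [norm_mul, Complex.norm_real, Real.norm_eq_abs, abs_of_nonneg (by positivity)]
  have h2 := h ξ hξ
  have h3 := (norm_nonneg _).trans h2
  have h4 : w ξ ≤ 2 * Real.pi * n := by unfold w; gcongr
  exact mul_le_mul (Real.rpow_le_rpow this h4 hs) h2 (norm_nonneg _)
    (Real.rpow_nonneg (this.trans h4) s)

lemma adm_of_bounded {α : ℝ} (hα0 : 0 < α) (hα1 : α < 1 / 2) {G : Plane → ℂ}
    (hG : Measurable G) {C n : ℝ} (h : ∀ ξ, ‖ξ‖ ≤ n → ‖G ξ‖ ≤ C)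
    (h0 : ∀ ξ, n < ‖ξ‖ → G ξ = 0) : Adm α G :=
  ⟨hG, nrm_lt_top_of_bounded hG hα0.le h h0, nrm_lt_top_of_bounded hG (by linarith) h h0⟩

lemma adm_of_mem_testFunctions {α : ℝ} (hα0 : 0 < α) (hα1 : α < 1 / 2) {Ψ : Plane → ℂ}
    (h : Ψ ∈ testFunctions) : Adm α Ψ := by
  obtain ⟨m, n, h⟩ := h
  exact adm_of_bounded hα0 hα1 m (fun ξ _ => (h ξ).1) (fun ξ => (h ξ).2)

lemma memLp_two_of_mem_testFunctions {Ψ : Plane → ℂ} (h : Ψ ∈ testFunctions) :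
    MemLp Ψ 2 volume := by
  obtain ⟨m, n, h⟩ := h
  exact memLp_of_bounded m (fun ξ _ => (h ξ).1) (fun ξ => (h ξ).2) 2

/-! ### The linear equation with a frozen velocity. -/

section Linear

variable {α M : ℝ}

/-- The weight `M + |ξ|^{4-6α}` in the energy estimate. -/
def mw (α M : ℝ) (ξ : Plane) : ℝ := M + w ξ ^ (4 - 6 * α)

lemma mw_pos (hM : 0 < M) (ξ : Plane) : 0 < mw α M ξ := by
  have := Real.rpow_nonneg (w_nonneg ξ) (4 - 6 * α)
  unfold mw; linarith

@[fun_prop] lemma measurable_mw : Measurable (mw α M) := by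
  have := measurable_w_rpow (4 - 6 * α)
  unfold mw; fun_prop

lemma le_mw (ξ : Plane) : M ≤ mw α M ξ := by
  have := Real.rpow_nonneg (w_nonneg ξ) (4 - 6 * α)
  unfold mw; linarith

lemma sqrt_rpow {x : ℝ} (hx : 0 ≤ x) : √(x ^ (4 - 6 * α)) = x ^ (2 - 3 * α) := by
  rw [Real.sqrt_eq_rpow, ← Real.rpow_mul hx]; congr 1; ring

lemma rpow_le_sqrt_mw (hM : 0 < M) (ξ : Plane) : w ξ ^ (2 - 3 * α) ≤ √(mw α M ξ) := by
  rw [← sqrt_rpow (w_nonneg ξ)]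
  apply Real.sqrt_le_sqrt
  unfold mw; linarith

lemma sqrt_mw_le (hM : 0 < M) (ξ : Plane) : √(mw α M ξ) ≤ √M + w ξ ^ (2 - 3 * α) := by
  rw [← sqrt_rpow (w_nonneg ξ)]
  have h := Real.rpow_nonneg (w_nonneg ξ) (4 - 6 * α)
  rw [Real.sqrt_le_left (by positivity), add_sq, Real.sq_sqrt hM.le, Real.sq_sqrt h]
  have := mul_nonneg (Real.sqrt_nonneg M) (Real.sqrt_nonneg (w ξ ^ (4 - 6 * α)))
  unfold mw
  linarith

/-- Geometric mean of the two bounds of the kernel. The factor `w ξ ^ α` compensates the weight `w ξ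
^ (-α)`, singular at the origin, in `memLp_rpow_mul_B`. -/
lemma abs_kerR_le_interp (hα0 : 0 < α) (hα1 : α < 1) (a ξ : Plane) :
    |kerR a (ξ - a)| ≤ w ξ ^ α * w (ξ - a) ^ (1 - α) := by
  have hp := Real.rpow_nonneg (w_nonneg ξ) α
  have h1 : |kerR a (ξ - a)| ≤ w ξ := by
    simpa using abs_kerR_le_add a (ξ - a)
  have h2 := abs_kerR_le a (ξ - a)
  have h0 := abs_nonneg (kerR a (ξ - a))
  calc |kerR a (ξ - a)| = |kerR a (ξ - a)| ^ α * |kerR a (ξ - a)| ^ (1 - α) := by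
        rw [← Real.rpow_add_of_nonneg h0 hα0.le (by linarith)]; simp
    _ ≤ _ := by gcongr

lemma memLp_rpow_mul_B (hα0 : 0 < α) (hα1 : α < 1 / 2) {U Ψ : Plane → ℂ} (hU : Adm α U)
    (hΨ : Adm α Ψ) (hΨ' : nrm (1 - α) Ψ < ⊤) :
    MemLp (fun ξ => ((w ξ ^ (-α) : ℝ) : ℂ) * B U Ψ ξ) 2 volume := by
  refine ⟨(measurable_weight_mul (measurable_B hU.meas hΨ.meas)).aestronglyMeasurable, ?_⟩
  have := (bilin_young (κ := fun ξ a => ((w ξ ^ (-α) : ℝ) : ℂ) *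
    ((kerR a (ξ - a) : ℂ) * U a * Ψ (ξ - a))) hU.meas.enorm
    (measurable_mag (s := 1 - α) hΨ.meas) (hU.lintegral_lt_top hα0 hα1)
    (by rwa [← nrm_eq_l2]) ?_ ?_).2
  · simp only [integral_const_mul] at this
    refine this.trans_lt (ENNReal.mul_lt_top (hU.lintegral_lt_top hα0 hα1) ?_)
    rwa [← nrm_eq_l2]
  · have h1 := measurable_B_integrand hU.meas hΨ.meas
    have h2 : Measurable fun z : Plane × Plane => w z.1 ^ (-α) :=
      (measurable_w_rpow (-α)).comp measurable_fst
    fun_prop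
  · intro ξ a
    have p0 := Real.rpow_nonneg (w_nonneg ξ) (-α)
    rw [enorm_mul, enorm_mul, enorm_mul, enorm_ofReal, enorm_ofReal, abs_of_nonneg p0, mag]
    calc _ = ENNReal.ofReal (w ξ ^ (-α) * |kerR a (ξ - a)|) * (‖U a‖ₑ * ‖Ψ (ξ - a)‖ₑ) := by
          rw [ENNReal.ofReal_mul p0]; ring
      _ ≤ ENNReal.ofReal (w (ξ - a) ^ (1 - α)) * (‖U a‖ₑ * ‖Ψ (ξ - a)‖ₑ) := by
          gcongr
          have hb := Real.rpow_nonneg (w_nonneg (ξ - a)) (1 - α)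
          rcases eq_or_ne ξ 0 with rfl | hξ
          · have : kerR a (0 - a) = 0 := by
              rw [kerR_sub_self, kerR_zero_right]
            rw [this, abs_zero, mul_zero]; exact hb
          · have hw := w_pos hξ
            calc w ξ ^ (-α) * |kerR a (ξ - a)|
                ≤ w ξ ^ (-α) * (w ξ ^ α * w (ξ - a) ^ (1 - α)) := by
                  gcongr; exact abs_kerR_le_interp hα0 (by linarith) a ξ
              _ = w (ξ - a) ^ (1 - α) := by
                  rw [← mul_assoc, ← Real.rpow_add hw]; simp
      _ = _ := by ring

/-- The isometric image of a test function in the energy space. -/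
def xf (α M : ℝ) (Ψ : Plane → ℂ) (ξ : Plane) : ℂ := ((w ξ ^ α / √(mw α M ξ) : ℝ) : ℂ) * Ψ ξ

/-- The adjoint operator applied to a test function, in the energy space. -/
def yf (α M : ℝ) (U Ψ : Plane → ℂ) (ξ : Plane) : ℂ :=
  xf α M Ψ ξ - (((√(mw α M ξ))⁻¹ : ℝ) : ℂ) * (((w ξ ^ (-α) : ℝ) : ℂ) * B U Ψ ξ)

lemma memLp_xf (hα0 : 0 < α) (hM : 0 < M) {Ψ : Plane → ℂ} (h : Ψ ∈ testFunctions) :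
    MemLp (xf α M Ψ) 2 volume := by
  obtain ⟨m, n, h⟩ := h
  have hm : Measurable fun ξ => w ξ ^ α / √(mw α M ξ) := by
    have := measurable_w_rpow α
    fun_prop
  refine memLp_of_bounded (C := (2 * Real.pi * n) ^ α / √M * n) (n := n) ?_ (fun ξ hξ => ?_)
    (fun ξ hξ => ?_) 2
  · unfold xf; fun_prop
  · have := w_nonneg ξ
    have h3 := (norm_nonneg _).trans (h ξ).1
    rw [xf, norm_mul, Complex.norm_real, Real.norm_eq_abs, abs_of_nonneg (by positivity)]
    have h4 : w ξ ≤ 2 * Real.pi * n := by unfold w; gcongr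
    gcongr
    · exact le_mw ξ
    · exact (h ξ).1
  · rw [xf, (h ξ).2 hξ, mul_zero]

lemma memLp_yf (hα0 : 0 < α) (hα1 : α < 1 / 2) (hM : 0 < M) {U Ψ : Plane → ℂ} (hU : Adm α U)
    (h : Ψ ∈ testFunctions) : MemLp (yf α M U Ψ) 2 volume := by
  have hΨ := adm_of_mem_testFunctions hα0 hα1 h
  have hB := memLp_rpow_mul_B hα0 hα1 hU hΨ (by
    obtain ⟨m, n, h⟩ := h
    exact nrm_lt_top_of_bounded m (by linarith) (fun ξ _ => (h ξ).1) (fun ξ => (h ξ).2))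
  refine (memLp_xf hα0 hM h).sub ?_
  refine (hB.const_mul (((√M)⁻¹ : ℝ) : ℂ)).mono ?_ (ae_of_all _ fun ξ => ?_)
  · have h1 := hB.1
    have h2 : Measurable fun ξ => (((√(mw α M ξ))⁻¹ : ℝ) : ℂ) := by fun_prop
    exact h2.aestronglyMeasurable.mul h1
  · rw [norm_mul _ (_ * _), norm_mul _ (_ * _), Complex.norm_real (√(mw α M ξ))⁻¹,
      Complex.norm_real (√M)⁻¹, Real.norm_eq_abs, Real.norm_eq_abs, abs_of_nonneg (by positivity),
      abs_of_nonneg (by positivity)]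
    gcongr
    exact le_mw ξ

/-- `xf` as a linear map. -/
def xMap (hα0 : 0 < α) (hM : 0 < M) : testFunctions →ₗ[ℂ] Lp ℂ 2 (volume : Measure Plane) where
  toFun Ψ := (memLp_xf hα0 hM Ψ.2).toLp _
  map_add' Ψ Φ := by
    rw [← MemLp.toLp_add]
    apply MemLp.toLp_congr
    exact ae_of_all _ fun ξ => by simp [xf]; ring
  map_smul' c Ψ := by
    rw [RingHom.id_apply, ← MemLp.toLp_const_smul]
    apply MemLp.toLp_congr
    exact ae_of_all _ fun ξ => by simp [xf]; ring

/-- `yf` as a linear map. -/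
def yMap (hα0 : 0 < α) (hα1 : α < 1 / 2) (hM : 0 < M) {U : Plane → ℂ} (hU : Adm α U) :
    testFunctions →ₗ[ℂ] Lp ℂ 2 (volume : Measure Plane) where
  toFun Ψ := (memLp_yf hα0 hα1 hM hU Ψ.2).toLp _
  map_add' Ψ Φ := by
    rw [← MemLp.toLp_add]
    apply MemLp.toLp_congr
    filter_upwards [hU.B_integrable hα0 hα1 (adm_of_mem_testFunctions hα0 hα1 Ψ.2),
      hU.B_integrable hα0 hα1 (adm_of_mem_testFunctions hα0 hα1 Φ.2)] with ξ h1 h2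
    have : B U (Ψ + Φ) ξ = B U Ψ ξ + B U Φ ξ := by
      unfold B
      rw [← integral_add h1 h2]
      congr 1; ext a; simp only [Pi.add_apply]; ring
    simp [xf, yf, this]; ring
  map_smul' c Ψ := by
    rw [RingHom.id_apply, ← MemLp.toLp_const_smul]
    apply MemLp.toLp_congr
    refine ae_of_all _ fun ξ => ?_
    have : B U (c • Ψ) ξ = c * B U Ψ ξ := by
      unfold B
      rw [← integral_const_mul]
      congr 1; ext a; simp only [Pi.smul_apply, smul_eq_mul]; ring
    simp [xf, yf, this]; ring

/-- The Fourier transform of the element of the energy space represented by `A`. -/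
def uf (α M : ℝ) (A : Plane → ℂ) (ξ : Plane) : ℂ :=
  ((w ξ ^ (-α) / √(mw α M ξ) : ℝ) : ℂ) * A ξ

lemma measurable_uf {A : Plane → ℂ} (hA : Measurable A) : Measurable (uf α M A) := by
  have := measurable_w_rpow (-α)
  unfold uf; fun_prop

/-- As 2α + (4 - 6α) = 2(2 - 2α), the squared L² norm of A is M times the squared Ḣ^α norm of `uf α
M A` plus its squared Ḣ^{2-2α} norm. This lemma and `nrm_uf_high` extract the two parts. -/
lemma nrm_uf_low (hM : 0 < M) {A : Plane → ℂ} (hA : MemLp A 2 volume) :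
    nrm α (uf α M A) < ⊤ := by
  refine ((eLpNorm_mono_ae ?_).trans_lt (hA.const_mul (((√M)⁻¹ : ℝ) : ℂ)).2)
  filter_upwards [ae_ne_zero] with ξ hξ
  have hw := w_pos hξ
  have e : w ξ ^ α * (w ξ ^ (-α) / √(mw α M ξ)) = (√(mw α M ξ))⁻¹ := by
    rw [← mul_div_assoc, ← Real.rpow_add hw]; simp
  rw [uf, ← mul_assoc, ← Complex.ofReal_mul, e, norm_mul, norm_mul, Complex.norm_real,
    Complex.norm_real, Real.norm_eq_abs, Real.norm_eq_abs, abs_of_nonneg (by positivity),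
    abs_of_nonneg (by positivity)]
  gcongr
  exact le_mw ξ

lemma nrm_uf_high (hM : 0 < M) (A : Plane → ℂ) :
    nrm (2 - 2 * α) (uf α M A) ≤ eLpNorm A 2 volume := by
  apply eLpNorm_mono_ae
  filter_upwards [ae_ne_zero] with ξ hξ
  have hw := w_pos hξ
  have hm := mw_pos (α := α) hM ξ
  have e : w ξ ^ (2 - 2 * α) * (w ξ ^ (-α) / √(mw α M ξ)) = w ξ ^ (2 - 3 * α) / √(mw α M ξ) := by
    rw [← mul_div_assoc, ← Real.rpow_add hw]; congr 2; ring
  rw [uf, ← mul_assoc, ← Complex.ofReal_mul, e, norm_mul, Complex.norm_real, Real.norm_eq_abs,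
    abs_of_nonneg (by positivity)]
  have : w ξ ^ (2 - 3 * α) / √(mw α M ξ) ≤ 1 :=
    (div_le_one (by positivity)).2 (rpow_le_sqrt_mw hM ξ)
  calc _ ≤ 1 * ‖A ξ‖ := by gcongr
    _ = _ := one_mul _

lemma adm_uf (hM : 0 < M) {A : Plane → ℂ} (hAm : Measurable A) (hA : MemLp A 2 volume) :
    Adm α (uf α M A) :=
  ⟨measurable_uf hAm, nrm_uf_low hM hA, (nrm_uf_high hM A).trans_lt hA.2⟩

/-- The pairing is the weak form, tested with Ψ, of the linear equation for `uf α M A'`. The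
transport operator has been moved to Ψ, and by skewness its adjoint is its negative, which is the
minus sign in `yf`. -/
lemma inner_yMap (hα0 : 0 < α) (hα1 : α < 1 / 2) (hM : 0 < M) {U : Plane → ℂ} (hU : Adm α U)
    (hUH : Herm U) (Ψ : testFunctions) (A : Lp ℂ 2 (volume : Measure Plane)) {A' : Plane → ℂ}
    (hA'm : Measurable A') (hA' : A' =ᵐ[volume] A) :
    Integrable (fun ξ => ((w ξ ^ (2 * α) : ℝ) : ℂ) * uf α M A' ξ *
      starRingEnd ℂ ((Ψ : Plane → ℂ) ξ)) volume ∧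
    inner ℂ (yMap hα0 hα1 hM hU Ψ) A = (∫ ξ, ((w ξ ^ (2 * α) : ℝ) : ℂ) * uf α M A' ξ *
      starRingEnd ℂ ((Ψ : Plane → ℂ) ξ)) + Tri U (uf α M A') Ψ := by
  have hΨ := adm_of_mem_testFunctions hα0 hα1 Ψ.2
  have hF : Adm α (uf α M A') := adm_uf hM hA'm ((memLp_congr_ae hA').2 (Lp.memLp A))
  obtain ⟨i1, t1⟩ := hU.tri_eq hα0 hα1 hΨ hF
  have hY : yMap hα0 hα1 hM hU Ψ =ᵐ[volume] yf α M U Ψ :=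
    MemLp.coeFn_toLp (memLp_yf hα0 hα1 hM hU Ψ.2)
  have i1' : Integrable (fun ξ => starRingEnd ℂ (B U Ψ ξ * starRingEnd ℂ (uf α M A' ξ)))
      volume := Complex.conjCLE.toContinuousLinearMap.integrable_comp i1
  have hae : ∀ᵐ ξ, ((w ξ ^ (2 * α) : ℝ) : ℂ) * uf α M A' ξ * starRingEnd ℂ ((Ψ : Plane → ℂ) ξ) =
      inner ℂ (yMap hα0 hα1 hM hU Ψ ξ) (A ξ) +
        starRingEnd ℂ (B U Ψ ξ * starRingEnd ℂ (uf α M A' ξ)) := by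
    filter_upwards [hY, hA', ae_ne_zero] with ξ h1 h2 h3
    have hw := w_pos h3
    have hm := mw_pos (α := α) hM ξ
    rw [h1, ← h2, RCLike.inner_apply, yf, xf, uf]
    have e1 : w ξ ^ (2 * α) * (w ξ ^ (-α) / √(mw α M ξ)) = w ξ ^ α / √(mw α M ξ) := by
      rw [← mul_div_assoc, ← Real.rpow_add hw]; congr 2; ring
    rw [← mul_assoc, ← Complex.ofReal_mul, e1]
    simp only [map_sub, map_mul, Complex.conj_ofReal, Complex.conj_conj]
    push_cast
    ring
  have i2 : Integrable (fun ξ => inner ℂ (yMap hα0 hα1 hM hU Ψ ξ) (A ξ)) volume :=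
    L2.integrable_inner _ _
  refine ⟨(integrable_congr hae).2 (i2.add i1'), ?_⟩
  rw [integral_congr_ae hae, integral_add i2 i1', integral_conj, ← t1, tri_skew hUH, L2.inner_def,
    map_neg, Complex.conj_conj, neg_add_cancel_right]

end Linear

variable {α M : ℝ}

lemma eLpNorm_le_enorm_of_ae {f : Plane → ℂ} {A : Lp ℂ 2 (volume : Measure Plane)}
    (h : f =ᵐ[volume] A) : eLpNorm f 2 volume = ENNReal.ofReal ‖A‖ := by
  rw [eLpNorm_congr_ae h, Lp.norm_def, ENNReal.ofReal_toReal (Lp.memLp A).2.ne]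

lemma quasiMeasurePreserving_add :
    Measure.QuasiMeasurePreserving (fun p : Plane × Plane => p.1 + p.2) volume volume :=
  Measure.quasiMeasurePreserving_snd.comp
    (measurePreserving_prod_add (volume : Measure Plane) volume).quasiMeasurePreserving

lemma measurable_xf {Ψ : Plane → ℂ} (h : Measurable Ψ) : Measurable (xf α M Ψ) := by
  have := measurable_w_rpow α
  unfold xf; fun_prop

/-- The vector `xMap Ψ` represents F = Ψ / (M + |ξ|^{4-6α}), so this is the energy estimate with
that multiplier. The dissipation gives ‖x‖². By skewness the real part of the transport term is half
that of Tri U F Ψ - Tri U Ψ F, where M drops out and the power of the frequency enters as a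
commutator; smallness of U bounds this difference by ‖x‖². -/
lemma coercive (hα0 : 0 < α) (hα1 : α < 1 / 2) (hM : 0 < M) {U : Plane → ℂ} (hU : Adm α U)
    (hUH : Herm U) (hUs : 128 * triConst α * nrm (2 - 2 * α) U ≤ 1) (Ψ : testFunctions) :
    1 / 2 * ‖xMap hα0 hM Ψ‖ ^ 2 ≤
      (inner ℂ (yMap hα0 hα1 hM hU Ψ) (xMap hα0 hM Ψ)).re := by
  set x := xMap hα0 hM Ψ with hx
  have hX : xf α M Ψ =ᵐ[volume] x := (MemLp.coeFn_toLp (memLp_xf hα0 hM Ψ.2)).symm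
  have hxm : Measurable (xf α M Ψ) := measurable_xf Ψ.2.1
  obtain ⟨-, e⟩ := inner_yMap hα0 hα1 hM hU hUH Ψ x hxm hX
  set F := uf α M (xf α M Ψ) with hFdef
  have hF : Adm α F := adm_uf hM hxm (memLp_xf hα0 hM Ψ.2)
  have hΨ : Adm α (Ψ : Plane → ℂ) := adm_of_mem_testFunctions hα0 hα1 Ψ.2
  have first : (∫ ξ, ((w ξ ^ (2 * α) : ℝ) : ℂ) * F ξ * starRingEnd ℂ ((Ψ : Plane → ℂ) ξ)) =
      inner ℂ x x := by
    rw [L2.inner_def]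
    apply integral_congr_ae
    filter_upwards [hX, ae_ne_zero] with ξ h1 h2
    have hw := w_pos h2
    rw [← h1, RCLike.inner_apply, hFdef, uf, xf]
    have e1 : w ξ ^ (2 * α) * w ξ ^ (-α) = w ξ ^ α := by
      rw [← Real.rpow_add hw]; congr 1; ring
    rw [map_mul, Complex.conj_ofReal]
    calc _ = (((w ξ ^ (2 * α) * w ξ ^ (-α)) / √(mw α M ξ) * (w ξ ^ α / √(mw α M ξ)) : ℝ) : ℂ) *
          ((Ψ : Plane → ℂ) ξ * starRingEnd ℂ ((Ψ : Plane → ℂ) ξ)) := by push_cast; ring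
      _ = _ := by rw [e1]; push_cast; ring
  have hΨF : ∀ᵐ ξ, (Ψ : Plane → ℂ) ξ = (mw α M ξ : ℂ) * F ξ := by
    filter_upwards [ae_ne_zero] with ξ h2
    have hw := w_pos h2
    have hm := mw_pos (α := α) hM ξ
    rw [hFdef, uf, xf, ← mul_assoc, ← mul_assoc, ← Complex.ofReal_mul, ← Complex.ofReal_mul]
    have e1 : mw α M ξ * (w ξ ^ (-α) / √(mw α M ξ)) * (w ξ ^ α / √(mw α M ξ)) = 1 := by
      have e2 : w ξ ^ (-α) * w ξ ^ α = 1 := by rw [← Real.rpow_add hw]; simp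
      have e3 : √(mw α M ξ) * √(mw α M ξ) = mw α M ξ := Real.mul_self_sqrt hm.le
      have : 0 < √(mw α M ξ) := Real.sqrt_pos.2 hm
      field_simp
      rw [mul_assoc, e2, sq, e3, mul_one]
    rw [e1]; simp
  have i1 := hU.tk_integrable hα0 hα1 hF hΨ
  have i2 := hU.tk_integrable hα0 hα1 hΨ hF
  have diff : Tri U F Ψ - Tri U Ψ F =
      ∫ p : Plane × Plane, ((mw α M (p.1 + p.2) - mw α M p.2 : ℝ) : ℂ) * tk U F F p := by
    unfold Tri
    rw [← integral_sub i1 i2]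
    apply integral_congr_ae
    filter_upwards [quasiMeasurePreserving_add.ae hΨF,
      Measure.quasiMeasurePreserving_snd.ae hΨF] with p h1 h2
    simp only [tk, h1, h2, map_mul, Complex.conj_ofReal]
    push_cast; ring
  have hnF : nrm (2 - 2 * α) F ≤ ENNReal.ofReal ‖x‖ := by
    rw [← eLpNorm_le_enorm_of_ae hX]; exact nrm_uf_high hM _
  have bound : ‖Tri U F Ψ - Tri U Ψ F‖ ≤ ‖x‖ ^ 2 := by
    rw [← ENNReal.ofReal_le_ofReal_iff (by positivity), ofReal_norm, diff]
    calc _ ≤ ∫⁻ p : Plane × Plane,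
          ‖((mw α M (p.1 + p.2) - mw α M p.2 : ℝ) : ℂ) * tk U F F p‖ₑ :=
          enorm_integral_le_lintegral_enorm _
      _ = ∫⁻ p : Plane × Plane,
          ENNReal.ofReal |w (p.1 + p.2) ^ (4 - 6 * α) - w p.2 ^ (4 - 6 * α)| * ‖tk U F F p‖ₑ := by
          apply lintegral_congr
          intro p
          rw [enorm_mul, enorm_ofReal]
          unfold mw
          rw [add_sub_add_left_eq_sub]
      _ ≤ _ := lintegral_commutator_le hα0 hα1 hU.meas hF.meas hF.meas
      _ = (128 * triConst α * nrm (2 - 2 * α) U) * (nrm (2 - 2 * α) F * nrm (2 - 2 * α) F) := by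
          ring
      _ ≤ 1 * (ENNReal.ofReal ‖x‖ * ENNReal.ofReal ‖x‖) := by gcongr
      _ = _ := by rw [one_mul, ← ENNReal.ofReal_mul (norm_nonneg _), sq]
  have re_eq : (Tri U F Ψ - Tri U Ψ F).re = 2 * (Tri U F Ψ).re := by
    have := congrArg Complex.re (tri_skew (F := F) (G := (Ψ : Plane → ℂ)) hUH)
    simp only [Complex.neg_re, Complex.conj_re] at this
    rw [Complex.sub_re]; linarith
  have h3 := (abs_le.1 ((Complex.abs_re_le_norm _).trans bound)).1
  rw [e, first, inner_self_eq_norm_sq_to_K, Complex.add_re]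
  have h4 : (((‖x‖ : ℝ) : ℂ) ^ 2).re = ‖x‖ ^ 2 := by
    rw [← Complex.ofReal_pow, Complex.ofReal_re]
  simp only [Complex.coe_algebraMap]
  rw [h4]
  linarith

/-- Solvability of the linear equation with a velocity that is small in `Ḣ^{2-2α}`. -/
lemma exists_linear (hα0 : 0 < α) (hα1 : α < 1 / 2) (hM : 0 < M) {U f : Plane → ℂ}
    (hU : Adm α U) (hUH : Herm U) (hUs : 128 * triConst α * nrm (2 - 2 * α) U ≤ 1)
    (hf : Measurable f) (hf1 : nrm (-α) f < ⊤) (hf2 : nrm (2 - 4 * α) f < ⊤) :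
    ∃ F, Adm α F ∧ Solves α U F f ∧
      nrm (2 - 2 * α) F ≤ 2 * (ENNReal.ofReal √M * nrm (-α) f + nrm (2 - 4 * α) f) := by
  -- The force in the coordinates of the energy space, chosen so that its pairing with `xMap Ψ` is
  -- the integral of f against the conjugate of Ψ. The weight is at most √M |ξ|^{-α} + |ξ|^{2-4α},
  -- up to the normalization of the frequency, which produces the two data norms.
  let gf : Plane → ℂ := fun ξ => ((√(mw α M ξ) * w ξ ^ (-α) : ℝ) : ℂ) * f ξ
  have hgm : Measurable gf := by
    have := measurable_w_rpow (-α)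
    fun_prop
  have hgn : eLpNorm gf 2 volume ≤ ENNReal.ofReal √M * nrm (-α) f + nrm (2 - 4 * α) f := by
    have e1 : ENNReal.ofReal √M * nrm (-α) f =
        eLpNorm (fun ξ => ((√M : ℝ) : ℂ) * (((w ξ ^ (-α) : ℝ) : ℂ) * f ξ)) 2 volume := by
      have := eLpNorm_const_smul ((√M : ℝ) : ℂ) (fun ξ => ((w ξ ^ (-α) : ℝ) : ℂ) * f ξ) 2
        (volume : Measure Plane)
      rw [enorm_ofReal, abs_of_nonneg (Real.sqrt_nonneg M)] at this
      exact this.symm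
    rw [e1, nrm_eq_l2]
    have m1 : Measurable fun ξ => ‖((√M : ℝ) : ℂ) * (((w ξ ^ (-α) : ℝ) : ℂ) * f ξ)‖ₑ := by
      have := measurable_w_rpow (-α)
      fun_prop
    rw [eLpNorm_two_eq_l2, eLpNorm_two_eq_l2]
    have e : ∀ f : Plane → ℝ≥0∞, l2 f = eLpNorm f 2 volume := by
      intro f
      rw [eLpNorm_eq_lintegral_rpow_enorm_toReal (by norm_num) (by norm_num), l2]
      simp
    simp only [e]
    refine le_trans (eLpNorm_mono_enorm_ae ?_) (eLpNorm_add_le m1.aestronglyMeasurable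
      (measurable_mag (s := 2 - 4 * α) hf).aestronglyMeasurable (by norm_num))
    filter_upwards [ae_ne_zero] with ξ hξ
    have hw := w_pos hξ
    have p := Real.rpow_nonneg hw.le (-α)
    simp only [enorm_eq_self, Pi.add_apply, gf]
    rw [enorm_mul, enorm_mul, enorm_mul, enorm_ofReal, enorm_ofReal, enorm_ofReal, mag,
      abs_of_nonneg (by positivity), abs_of_nonneg (by positivity), abs_of_nonneg (by positivity),
      ← mul_assoc, ← add_mul, ← ENNReal.ofReal_mul (by positivity),
      ← ENNReal.ofReal_add (by positivity) (by positivity)]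
    gcongr
    calc √(mw α M ξ) * w ξ ^ (-α) ≤ (√M + w ξ ^ (2 - 3 * α)) * w ξ ^ (-α) := by
          gcongr; exact sqrt_mw_le hM ξ
      _ = _ := by rw [add_mul, ← Real.rpow_add hw]; congr 2; ring
  have hg : MemLp gf 2 volume := by
    refine ⟨hgm.aestronglyMeasurable, hgn.trans_lt ?_⟩
    exact ENNReal.add_lt_top.2 ⟨ENNReal.mul_lt_top ENNReal.ofReal_lt_top hf1, hf2⟩
  obtain ⟨A, hAn, hA⟩ := exists_of_coercive (xMap hα0 hM) (yMap hα0 hα1 hM hU)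
    (c := 1 / 2) (by norm_num) (coercive hα0 hα1 hM hU hUH hUs) (hg.toLp gf)
  have hAm : Measurable (A : Plane → ℂ) := (Lp.stronglyMeasurable A).measurable
  set F := uf α M A with hFdef
  have hF : Adm α F := adm_uf hM hAm (Lp.memLp A)
  refine ⟨F, hF, ?_, ?_⟩
  · let Z : Plane → ℂ := fun ξ => ((w ξ ^ (2 * α) : ℝ) : ℂ) * F ξ + B U F ξ - f ξ
    have hZm : Measurable Z :=
      ((measurable_weight_mul hF.meas).add (measurable_B hU.meas hF.meas)).sub hf
    have hZ : ∀ Ψ : testFunctions,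
        ∫ ξ, Z ξ * starRingEnd ℂ ((Ψ : Plane → ℂ) ξ) = 0 := by
      intro Ψ
      obtain ⟨j1, e1⟩ := inner_yMap hα0 hα1 hM hU hUH Ψ A hAm (Filter.EventuallyEq.refl _ _)
      obtain ⟨j2, e2⟩ := hU.tri_eq hα0 hα1 hF (adm_of_mem_testFunctions hα0 hα1 Ψ.2)
      have hae : ∀ᵐ ξ, inner ℂ (xMap hα0 hM Ψ ξ) (hg.toLp gf ξ) =
          f ξ * starRingEnd ℂ ((Ψ : Plane → ℂ) ξ) := by
        have hX : xMap hα0 hM Ψ =ᵐ[volume] xf α M Ψ := MemLp.coeFn_toLp (memLp_xf hα0 hM Ψ.2)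
        filter_upwards [hX, hg.coeFn_toLp, ae_ne_zero] with ξ h1 h2 h3
        have hw := w_pos h3
        have hm := mw_pos (α := α) hM ξ
        rw [h1, h2, RCLike.inner_apply, xf, map_mul, Complex.conj_ofReal]
        have e1 : √(mw α M ξ) * w ξ ^ (-α) * (w ξ ^ α / √(mw α M ξ)) = 1 := by
          have e2 : w ξ ^ (-α) * w ξ ^ α = 1 := by rw [← Real.rpow_add hw]; simp
          have : 0 < √(mw α M ξ) := Real.sqrt_pos.2 hm
          field_simp
          exact e2
        calc _ = ((√(mw α M ξ) * w ξ ^ (-α) * (w ξ ^ α / √(mw α M ξ)) : ℝ) : ℂ) *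
              (f ξ * starRingEnd ℂ ((Ψ : Plane → ℂ) ξ)) := by simp only [gf]; push_cast; ring
          _ = _ := by rw [e1]; simp
      have j3 : Integrable (fun ξ => f ξ * starRingEnd ℂ ((Ψ : Plane → ℂ) ξ)) volume :=
        (integrable_congr hae).1 (L2.integrable_inner _ _)
      have h := hA Ψ
      rw [e1, e2, L2.inner_def, integral_congr_ae hae, ← integral_add j1 j2] at h
      have : ∀ ξ, Z ξ * starRingEnd ℂ ((Ψ : Plane → ℂ) ξ) =
          (((w ξ ^ (2 * α) : ℝ) : ℂ) * F ξ * starRingEnd ℂ ((Ψ : Plane → ℂ) ξ) +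
            B U F ξ * starRingEnd ℂ ((Ψ : Plane → ℂ) ξ)) -
          f ξ * starRingEnd ℂ ((Ψ : Plane → ℂ) ξ) := by intro ξ; simp only [Z]; ring
      simp only [this]
      exact (integral_sub (j1.add j2) j3).trans (sub_eq_zero.2 h)
    -- Test functions need no smoothness, so the residual itself, cut off where it and the frequency
    -- are at most n, is one. Testing with it shows that its square has integral zero.
    have hZn : ∀ n : ℕ, ∀ᵐ ξ, ‖Z ξ‖ ≤ n → ‖ξ‖ ≤ n → Z ξ = 0 := by
      intro n
      let S : Set Plane := {ξ | ‖Z ξ‖ ≤ n ∧ ‖ξ‖ ≤ n}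
      have hS : MeasurableSet S :=
        (measurableSet_le hZm.norm measurable_const).inter
          (measurableSet_le measurable_norm measurable_const)
      have hmem : S.indicator Z ∈ testFunctions := by
        refine ⟨hZm.indicator hS, n, fun ξ => ⟨?_, fun h => ?_⟩⟩
        · by_cases hξ : ξ ∈ S
          · rw [Set.indicator_of_mem hξ]; exact hξ.1
          · rw [Set.indicator_of_notMem hξ]; simp
        · exact Set.indicator_of_notMem (fun hξ => not_lt.2 hξ.2 h) _
      have h0 := hZ ⟨_, hmem⟩
      have hL2 : Integrable (fun ξ => ‖S.indicator Z ξ‖ ^ 2) volume :=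
        (memLp_two_of_mem_testFunctions hmem).integrable_norm_pow (by norm_num)
      have e : ∀ ξ, Z ξ * starRingEnd ℂ (S.indicator Z ξ) =
          ((‖S.indicator Z ξ‖ ^ 2 : ℝ) : ℂ) := by
        intro ξ
        by_cases hξ : ξ ∈ S
        · rw [Set.indicator_of_mem hξ, Complex.mul_conj, Complex.normSq_eq_norm_sq]
        · rw [Set.indicator_of_notMem hξ]; simp
      simp only [e] at h0
      rw [integral_complex_ofReal, Complex.ofReal_eq_zero,
        integral_eq_zero_iff_of_nonneg (fun ξ => by positivity) hL2] at h0
      filter_upwards [h0] with ξ h h1 h2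
      have hξ : ξ ∈ S := ⟨h1, h2⟩
      simpa [Set.indicator_of_mem hξ] using h
    filter_upwards [ae_all_iff.2 hZn] with ξ h
    obtain ⟨n, hn⟩ := exists_nat_ge (max ‖Z ξ‖ ‖ξ‖)
    have := h n ((le_max_left _ _).trans hn) ((le_max_right _ _).trans hn)
    exact sub_eq_zero.1 this
  · calc _ ≤ ENNReal.ofReal ‖A‖ := by
          rw [← eLpNorm_le_enorm_of_ae (Filter.EventuallyEq.refl _ _)]
          exact nrm_uf_high hM _
      _ ≤ ENNReal.ofReal (‖hg.toLp gf‖ / (1 / 2)) := ENNReal.ofReal_le_ofReal hAn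
      _ = 2 * eLpNorm gf 2 volume := by
          rw [eLpNorm_le_enorm_of_ae hg.coeFn_toLp.symm, div_div_eq_mul_div, div_one, mul_comm,
            ENNReal.ofReal_mul (by norm_num)]
          norm_num
      _ ≤ _ := by gcongr

/-! ### Real data and a real velocity give a real solution. -/

/-- The Fourier transform of the complex conjugate. -/
def refl (F : Plane → ℂ) (ξ : Plane) : ℂ := starRingEnd ℂ (F (-ξ))

lemma nrm_refl (s : ℝ) (F : Plane → ℂ) : nrm s (refl F) = nrm s F := by
  rw [nrm_eq_l2, nrm_eq_l2, l2, l2]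
  congr 1
  rw [← lintegral_neg_eq_self (fun ξ => mag s F ξ ^ 2)]
  congr 1; ext ξ
  simp [mag, refl]

lemma Adm.refl {F : Plane → ℂ} (hF : Adm α F) : Adm α (refl F) :=
  ⟨Complex.continuous_conj.measurable.comp (hF.meas.comp measurable_neg),
    (nrm_refl _ F).trans_lt hF.low, (nrm_refl _ F).trans_lt hF.high⟩

lemma kerR_neg_neg (a b : Plane) : kerR (-a) (-b) = kerR a b := by
  rw [kerR_neg_left, ← neg_one_smul ℝ b, kerR_smul_right]; ring

lemma B_refl {U : Plane → ℂ} (hU : Herm U) (F : Plane → ℂ) (ξ : Plane) :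
    B U (refl F) ξ = starRingEnd ℂ (B U F (-ξ)) := by
  unfold B
  rw [← integral_neg_eq_self, ← integral_conj]
  apply integral_congr_ae
  filter_upwards [hU] with a ha
  rw [ha, refl]
  simp only [map_mul, Complex.conj_ofReal]
  rw [← kerR_neg_neg, neg_neg, show -(ξ - -a) = -ξ - a by abel]

/-- The reflected conjugate of F solves the same linear equation, and `stability` with equal
velocities makes the solution unique. -/
lemma Solves.herm (hα0 : 0 < α) (hα1 : α < 1 / 2) {U F f : Plane → ℂ} (hU : Adm α U)
    (hUH : Herm U) (hF : Adm α F) (hf : Herm f) (h : Solves α U F f) : Herm F := by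
  have h' : Solves α U (refl F) f := by
    have hneg : ∀ᵐ ξ : Plane, ((w (-ξ) ^ (2 * α) : ℝ) : ℂ) * F (-ξ) + B U F (-ξ) = f (-ξ) :=
      (Measure.measurePreserving_neg volume).quasiMeasurePreserving.ae h
    filter_upwards [hneg, hf] with ξ h1 h2
    rw [B_refl hUH, refl]
    have := congrArg (starRingEnd ℂ) h1
    rwa [map_add, map_mul, Complex.conj_ofReal, w_neg, h2, Complex.conj_conj] at this
  have key := stability hα0 hα1 hU hUH hU hF hF.refl h h'
  have h0 : nrm α (U - U) = 0 := (nrm_eq_zero_iff (hU.sub hU).meas).2 (by simp)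
  rw [h0, mul_zero, mul_zero, nonpos_iff_eq_zero, nrm_eq_zero_iff (hF.sub hF.refl).meas] at key
  filter_upwards [key] with ξ hξ
  have : F ξ = starRingEnd ℂ (F (-ξ)) := sub_eq_zero.1 hξ
  rw [this, Complex.conj_conj]

/-! ### The nonlinear equation: contraction in the weaker norm. -/

variable {α : ℝ}

/-- The real-valued elements of size at most `R`, as a subset of `L²` through `θ ↦ |ξ|^α θ̂`. -/
def ballSet (α R : ℝ) : Set (Lp ℂ 2 (volume : Measure Plane)) :=
  {A | Herm A ∧ eLpNorm (fun ξ => ((w ξ ^ (2 - 3 * α) : ℝ) : ℂ) * A ξ) 2 volume ≤ ENNReal.ofReal R}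

/-- Along a subsequence convergence holds almost everywhere; symmetry passes to the limit, and the
stronger norm is lower semicontinuous by Fatou. The set is thus complete for the weaker metric, as
the fixed point theorem requires. -/
lemma isClosed_ballSet (α R : ℝ) : IsClosed (ballSet α R) := by
  rw [isClosed_iff_clusterPt]
  intro A hA
  rw [← mem_closure_iff_clusterPt, mem_closure_iff_seq_limit] at hA
  obtain ⟨u, hu, hlim⟩ := hA
  obtain ⟨ns, -, hns⟩ := (tendstoInMeasure_of_tendsto_Lp hlim).exists_seq_tendsto_ae
  constructor
  · have hneg : ∀ᵐ ξ, Tendsto (fun i => u (ns i) (-ξ)) atTop (𝓝 (A (-ξ))) :=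
      (Measure.measurePreserving_neg volume).quasiMeasurePreserving.ae hns
    filter_upwards [hns, hneg, ae_all_iff.2 fun i => (hu (ns i)).1] with ξ h1 h2 h3
    refine tendsto_nhds_unique h2 ?_
    simp only [h3]
    exact (Complex.continuous_conj.tendsto _).comp h1
  · have := Lp.eLpNorm_lim_le_liminf_eLpNorm (p := 2) (μ := (volume : Measure Plane))
      (f := fun i ξ => ((w ξ ^ (2 - 3 * α) : ℝ) : ℂ) * u (ns i) ξ)
      (fun i => (measurable_weight_mul (Lp.stronglyMeasurable _).measurable).aestronglyMeasurable)
      (fun ξ => ((w ξ ^ (2 - 3 * α) : ℝ) : ℂ) * A ξ)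
      (by filter_upwards [hns] with ξ h using h.const_mul _)
    refine this.trans ?_
    refine (liminf_le_liminf (v := fun _ => ENNReal.ofReal R)
      (Eventually.of_forall fun i => (hu (ns i)).2)).trans ?_
    simp

/-- The Fourier transform of the function represented by `A`. -/
def unweight (α : ℝ) (A : Plane → ℂ) (ξ : Plane) : ℂ := ((w ξ ^ (-α) : ℝ) : ℂ) * A ξ

lemma measurable_unweight {A : Plane → ℂ} (hA : Measurable A) : Measurable (unweight α A) :=
  measurable_weight_mul hA

lemma nrm_unweight (s : ℝ) (A : Plane → ℂ) :
    nrm s (unweight α A) = eLpNorm (fun ξ => ((w ξ ^ (s - α) : ℝ) : ℂ) * A ξ) 2 volume := by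
  apply eLpNorm_congr_ae
  filter_upwards [ae_ne_zero] with ξ hξ
  rw [unweight, ← mul_assoc, ← Complex.ofReal_mul, ← Real.rpow_add (w_pos hξ), sub_eq_add_neg]

lemma nrm_unweight_self (A : Plane → ℂ) : nrm α (unweight α A) = eLpNorm A 2 volume := by
  rw [nrm_unweight]; simp

lemma unweight_sub (A A' : Plane → ℂ) : unweight α (A - A') = unweight α A - unweight α A' := by
  ext ξ; simp [unweight, mul_sub]

lemma adm_unweight {R : ℝ} {A : Lp ℂ 2 (volume : Measure Plane)} (h : A ∈ ballSet α R) :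
    Adm α (unweight α A) ∧ Herm (unweight α A) ∧
      nrm (2 - 2 * α) (unweight α A) ≤ ENNReal.ofReal R := by
  have e : nrm (2 - 2 * α) (unweight α A) ≤ ENNReal.ofReal R := by
    rw [nrm_unweight, show 2 - 2 * α - α = 2 - 3 * α by ring]; exact h.2
  refine ⟨⟨measurable_unweight (Lp.stronglyMeasurable A).measurable, ?_,
    e.trans_lt ENNReal.ofReal_lt_top⟩, ?_, e⟩
  · rw [nrm_unweight_self]; exact (Lp.memLp A).2
  · filter_upwards [h.1] with ξ h1
    rw [unweight, unweight, w_neg, h1, map_mul, Complex.conj_ofReal]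

lemma weight_unweight {F : Plane → ℂ} :
    unweight α (fun ξ => ((w ξ ^ α : ℝ) : ℂ) * F ξ) =ᵐ[volume] F := by
  filter_upwards [ae_ne_zero] with ξ hξ
  rw [unweight, ← mul_assoc, ← Complex.ofReal_mul, ← Real.rpow_add (w_pos hξ)]
  simp

lemma Solves.congr {U U' F F' f : Plane → ℂ} (hU : U =ᵐ[volume] U') (hF : F =ᵐ[volume] F')
    (h : Solves α U F f) : Solves α U' F' f := by
  filter_upwards [h, hF] with ξ h1 h2
  rw [← B_congr hU hF, ← h2, h1]

lemma exists_pos_small (α : ℝ) :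
    ∃ R : ℝ, 0 < R ∧ 128 * triConst α * ENNReal.ofReal R ≤ 1 := by
  have hC : 128 * triConst α ≠ ⊤ := ENNReal.mul_ne_top (by norm_num) (triConst_ne_top α)
  refine ⟨((128 * triConst α).toReal + 1)⁻¹, by positivity, ?_⟩
  rw [← ENNReal.ofReal_toReal hC, ENNReal.toReal_ofReal ENNReal.toReal_nonneg,
    ← ENNReal.ofReal_mul ENNReal.toReal_nonneg, ENNReal.ofReal_le_one, ← div_eq_mul_inv]
  exact (div_le_one (by positivity)).2 (by linarith)

/-- Existence for the nonlinear equation on the Fourier side. -/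
lemma exists_nonlinear (hα0 : 0 < α) (hα1 : α < 1 / 2) {R : ℝ} (hR : 0 < R)
    (hRs : 128 * triConst α * ENNReal.ofReal R ≤ 1) {f : Plane → ℂ} (hf : Measurable f)
    (hfH : Herm f) (hf1 : nrm (-α) f < ⊤) (hf2 : nrm (2 - 4 * α) f ≤ ENNReal.ofReal (R / 4)) :
    ∃ F, Adm α F ∧ Herm F ∧ Solves α F F f ∧ nrm (2 - 2 * α) F ≤ ENNReal.ofReal R := by
  -- M depends on f: it makes the share of the Ḣ^{-α} norm negligible, however large that norm is.
  -- So R depends only on the size of f in Ḣ^{2-4α}.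
  obtain ⟨M, hM, hMs⟩ : ∃ M : ℝ, 0 < M ∧
      ENNReal.ofReal √M * nrm (-α) f ≤ ENNReal.ofReal (R / 4) := by
    set n := (nrm (-α) f).toReal with hn
    refine ⟨(R / 4 / (n + 1)) ^ 2, by positivity, ?_⟩
    rw [Real.sqrt_sq (by positivity), ← ENNReal.ofReal_toReal hf1.ne, ← hn,
      ← ENNReal.ofReal_mul (by positivity)]
    apply ENNReal.ofReal_le_ofReal
    have hn0 : 0 ≤ n := ENNReal.toReal_nonneg
    rw [div_mul_eq_mul_div, div_le_iff₀ (by positivity)]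
    nlinarith
  -- The map sends a velocity in the ball to the solution of the linear equation; outside the ball
  -- the value is immaterial.
  have step : ∀ A : Lp ℂ 2 (volume : Measure Plane), ∃ A' : Lp ℂ 2 (volume : Measure Plane),
      A ∈ ballSet α R → A' ∈ ballSet α R ∧ Solves α (unweight α A) (unweight α A') f := by
    intro A
    by_cases hA : A ∈ ballSet α R
    swap; · exact ⟨0, fun h => absurd h hA⟩
    obtain ⟨hU, hUH, hUn⟩ := adm_unweight hA
    have hUs : 128 * triConst α * nrm (2 - 2 * α) (unweight α A) ≤ 1 :=
      (mul_le_mul_right hUn _).trans hRs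
    obtain ⟨F, hF, hFs, hFn⟩ := exists_linear hα0 hα1 hM hU hUH hUs hf hf1
      (hf2.trans_lt ENNReal.ofReal_lt_top)
    have hFH := hFs.herm hα0 hα1 hU hUH hF hfH
    have hmem : MemLp (fun ξ => ((w ξ ^ α : ℝ) : ℂ) * F ξ) 2 volume :=
      ⟨(measurable_weight_mul hF.meas).aestronglyMeasurable, hF.low⟩
    have hA' := hmem.coeFn_toLp
    have hneg : ∀ᵐ ξ : Plane, hmem.toLp _ (-ξ) = ((w (-ξ) ^ α : ℝ) : ℂ) * F (-ξ) :=
      (Measure.measurePreserving_neg volume).quasiMeasurePreserving.ae hA'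
    have hun : F =ᵐ[volume] unweight α (hmem.toLp _) := by
      filter_upwards [weight_unweight (α := α) (F := F), hA'] with ξ h1 h2
      rw [unweight, h2]
      exact h1.symm
    refine ⟨hmem.toLp _, fun _ => ⟨⟨?_, ?_⟩, hFs.congr (Filter.EventuallyEq.refl _ _) hun⟩⟩
    · filter_upwards [hA', hneg, hFH] with ξ h1 h2 h3
      rw [h1, h2, h3, w_neg, map_mul, Complex.conj_ofReal]
    · have := nrm_unweight (α := α) (2 - 2 * α) (hmem.toLp _)
      rw [show 2 - 2 * α - α = 2 - 3 * α by ring] at this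
      rw [← this, ← nrm_congr hun]
      calc _ ≤ _ := hFn
        _ ≤ 2 * (ENNReal.ofReal (R / 4) + ENNReal.ofReal (R / 4)) := by gcongr
        _ = ENNReal.ofReal R := by
          rw [← ENNReal.ofReal_add (by positivity) (by positivity),
            show (2 : ℝ≥0∞) = ENNReal.ofReal 2 by norm_num, ← ENNReal.ofReal_mul (by norm_num)]
          congr 1; ring
  choose T hT using step
  have hmaps : Set.MapsTo T (ballSet α R) (ballSet α R) := fun A hA => (hT A hA).1
  -- The smallness 128 C R ≤ 1 used for coercivity already makes the factor 4 C R in `stability` at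
  -- most 1/32.
  have hcontr : ContractingWith (1 / 2) (hmaps.restrict T (ballSet α R) (ballSet α R)) := by
    refine ⟨by rw [← NNReal.coe_lt_coe]; norm_num, ?_⟩
    rintro ⟨A, hA⟩ ⟨A', hA'⟩
    obtain ⟨hU, hUH, hUn⟩ := adm_unweight hA
    obtain ⟨hU', -, -⟩ := adm_unweight hA'
    obtain ⟨hF, -, -⟩ := adm_unweight (hT A hA).1
    obtain ⟨hF', -, hFn'⟩ := adm_unweight (hT A' hA').1
    have key := stability hα0 hα1 hU hUH hU' hF hF' (hT A hA).2 (hT A' hA').2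
    have e : ∀ A A' : Lp ℂ 2 (volume : Measure Plane),
        nrm α (unweight α A - unweight α A') = edist A A' := by
      intro A A'
      rw [← unweight_sub, nrm_unweight_self, Lp.edist_def]
    rw [e, e] at key
    change edist (T A) (T A') ≤ _ * edist A A'
    refine key.trans ?_
    rw [← mul_assoc]
    gcongr
    calc 4 * triConst α * nrm (2 - 2 * α) (unweight α (T A'))
        ≤ 4 * triConst α * ENNReal.ofReal R := by gcongr
      _ = 1 / 32 * (128 * triConst α * ENNReal.ofReal R) := by
          rw [← mul_assoc, ← mul_assoc]
          congr 2
          rw [one_div, show (128 : ℝ≥0∞) = 32 * 4 by norm_num, ← mul_assoc,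
            ENNReal.inv_mul_cancel (by norm_num) (by norm_num), one_mul]
      _ ≤ 1 / 32 * 1 := by gcongr
      _ ≤ _ := by
          rw [mul_one, ENNReal.coe_div (by norm_num)]
          simp only [ENNReal.coe_one, ENNReal.coe_ofNat, one_div, ENNReal.inv_le_inv]
          norm_num
  have h0 : (0 : Lp ℂ 2 (volume : Measure Plane)) ∈ ballSet α R := by
    have hz := Lp.coeFn_zero ℂ 2 (volume : Measure Plane)
    have hneg : ∀ᵐ ξ : Plane, (0 : Lp ℂ 2 (volume : Measure Plane)) (-ξ) = 0 :=
      (Measure.measurePreserving_neg volume).quasiMeasurePreserving.ae hz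
    constructor
    · filter_upwards [hz, hneg] with ξ h1 h2
      rw [h1, h2]; simp
    · rw [eLpNorm_congr_ae (g := 0) (by filter_upwards [hz] with ξ h1; rw [h1]; simp)]
      simp
  obtain ⟨A, hA, hfix, -⟩ := ContractingWith.exists_fixedPoint'
    (isClosed_ballSet α R).isComplete hmaps hcontr h0 (edist_ne_top _ _)
  obtain ⟨hF, hFH, hFn⟩ := adm_unweight hA
  refine ⟨_, hF, hFH, ?_, hFn⟩
  have := (hT A hA).2
  rwa [hfix] at this

/-- Uniqueness for the nonlinear equation on the Fourier side. -/
lemma unique_nonlinear (hα0 : 0 < α) (hα1 : α < 1 / 2) {R : ℝ}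
    (hRs : 128 * triConst α * ENNReal.ofReal R ≤ 1) {f F F' : Plane → ℂ} (hF : Adm α F)
    (hFH : Herm F) (hF' : Adm α F') (hFn : nrm (2 - 2 * α) F' ≤ ENNReal.ofReal R)
    (h : Solves α F F f) (h' : Solves α F' F' f) : F =ᵐ[volume] F' := by
  have key := stability hα0 hα1 hF hFH hF' hF hF' h h'
  -- Each solution is its own velocity, so `stability` bounds the difference by 1/32 of itself. Its
  -- finiteness then forces it to vanish.
  have hle : 32 * nrm α (F - F') ≤ nrm α (F - F') := by
    calc 32 * nrm α (F - F')
        ≤ 32 * (4 * triConst α * (nrm (2 - 2 * α) F' * nrm α (F - F'))) := by gcongr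
      _ = (128 * triConst α * nrm (2 - 2 * α) F') * nrm α (F - F') := by ring
      _ ≤ (128 * triConst α * ENNReal.ofReal R) * nrm α (F - F') := by gcongr
      _ ≤ 1 * nrm α (F - F') := by gcongr
      _ = _ := one_mul _
  have hfin := (hF.sub hF').low.ne
  have h0 : nrm α (F - F') = 0 := by
    lift nrm α (F - F') to NNReal using hfin with x
    norm_cast at hle ⊢
    rw [← NNReal.coe_le_coe] at hle
    push_cast at hle
    have := x.2
    exact NNReal.coe_eq_zero.1 (by linarith [x.coe_nonneg])
  rw [nrm_eq_zero_iff (hF.sub hF').meas] at h0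
  filter_upwards [h0] with ξ hξ
  exact sub_eq_zero.1 hξ

/-! ### Tempered distributions represented by functions. -/

section IsFunction

variable {u v : Dist} {g h F : Plane → ℂ}

lemma ae_eq_of_integral_schwartz_eq (hg : LocallyIntegrable g volume)
    (hh : LocallyIntegrable h volume)
    (H : ∀ φ : 𝓢(Plane, ℂ), ∫ x, φ x * g x = ∫ x, φ x * h x) : g =ᵐ[volume] h := by
  apply ae_eq_of_integral_contDiff_smul_eq hg hh
  intro φ hφ hc
  have hc' : HasCompactSupport fun x => (φ x : ℂ) := hc.comp_left (g := fun t : ℝ => (t : ℂ)) (by simp)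
  exact H (hc'.toSchwartzMap (Complex.ofRealCLM.contDiff.comp hφ))

lemma IsFunction.ae_unique (h1 : IsFunction u g) (h2 : IsFunction u h) : g =ᵐ[volume] h :=
  ae_eq_of_integral_schwartz_eq h1.1 h2.1 fun φ => by rw [← (h1.2 φ).2, ← (h2.2 φ).2]

lemma IsFunction.congr (h1 : IsFunction u g) (hgh : g =ᵐ[volume] h) : IsFunction u h := by
  refine ⟨h1.1.congr hgh, fun φ => ?_⟩
  have e : (fun x => φ x * g x) =ᵐ[volume] fun x => φ x * h x := by
    filter_upwards [hgh] with x hx; rw [hx]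
  exact ⟨(integrable_congr e).1 (h1.2 φ).1, by rw [(h1.2 φ).2, integral_congr_ae e]⟩

lemma IsFunction.dist_ext (h1 : IsFunction u g) (h2 : IsFunction v g) : u = v := by
  ext φ
  rw [(h1.2 φ).2, (h2.2 φ).2]

lemma IsFunction.add (h1 : IsFunction u g) (h2 : IsFunction v h) :
    IsFunction (u + v) (fun x => g x + h x) := by
  refine ⟨h1.1.add h2.1, fun φ => ?_⟩
  simp only [mul_add]
  refine ⟨(h1.2 φ).1.add (h2.2 φ).1, ?_⟩
  rw [integral_add (h1.2 φ).1 (h2.2 φ).1, ← (h1.2 φ).2, ← (h2.2 φ).2]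
  rfl

lemma IsFunction.sub (h1 : IsFunction u g) (h2 : IsFunction v h) :
    IsFunction (u - v) (fun x => g x - h x) := by
  refine ⟨h1.1.sub h2.1, fun φ => ?_⟩
  simp only [mul_sub]
  refine ⟨(h1.2 φ).1.sub (h2.2 φ).1, ?_⟩
  rw [integral_sub (h1.2 φ).1 (h2.2 φ).1, ← (h1.2 φ).2, ← (h2.2 φ).2]
  rfl

lemma exists_isFunction_of_memLp {p : ℝ≥0∞} [hp : Fact (1 ≤ p)] (hg : MemLp g p volume) :
    ∃ u : Dist, IsFunction u g := by
  refine ⟨Lp.toTemperedDistribution (hg.toLp g), hg.locallyIntegrable hp.out, fun φ => ⟨?_, ?_⟩⟩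
  · have := ENNReal.HolderConjugate.inv_one_sub_inv' hp.out
    exact (hg.integrable_mul (φ.memLp (1 - p⁻¹)⁻¹)).congr (ae_of_all _ fun x => mul_comm _ _)
  · rw [Lp.toTemperedDistribution_apply]
    apply integral_congr_ae
    filter_upwards [hg.coeFn_toLp] with x hx
    rw [hx, smul_eq_mul]

lemma isFunction_ofSchwartz (f : 𝓢(Plane, ℂ)) : IsFunction (ofSchwartz f) f := by
  refine ⟨(f.memLp 2).locallyIntegrable (by norm_num), fun φ => ⟨?_, ?_⟩⟩
  · exact (φ.memLp 2).integrable_mul (f.memLp 2)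
  · exact SchwartzMap.toTemperedDistributionCLM_apply_apply volume f φ

lemma fourier_ofSchwartz (f : 𝓢(Plane, ℂ)) : 𝓕 (ofSchwartz f) = ofSchwartz (𝓕 f) :=
  TemperedDistribution.fourier_toTemperedDistributionCLM_eq f

lemma exists_fourier_isFunction {p : ℝ≥0∞} [Fact (1 ≤ p)] (hg : MemLp g p volume) :
    ∃ u : Dist, IsFunction (𝓕 u) g := by
  obtain ⟨u, hu⟩ := exists_isFunction_of_memLp hg
  exact ⟨(𝓕⁻ u : Dist), by rwa [FourierTransform.fourier_fourierInv_eq]⟩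

lemma dist_ext_of_fourier (h1 : IsFunction (𝓕 u) g) (h2 : IsFunction (𝓕 v) g) : u = v := by
  have hu : (𝓕⁻ (𝓕 u : Dist) : Dist) = u := FourierTransform.fourierInv_fourier_eq u
  have hv : (𝓕⁻ (𝓕 v : Dist) : Dist) = v := FourierTransform.fourierInv_fourier_eq v
  rw [← hu, ← hv, h1.dist_ext h2]

lemma sobolevNorm_eq (s : ℝ) (h1 : IsFunction (𝓕 u) F) : sobolevNorm s u = nrm s F := by
  apply le_antisymm
  · exact iInf₂_le F h1
  · refine le_iInf₂ fun G hG => ?_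
    exact (nrm_congr (h1.ae_unique hG)).le

lemma exists_of_sobolevNorm_lt_top {s : ℝ} (hs : sobolevNorm s u < ⊤) :
    ∃ F, Measurable F ∧ IsFunction (𝓕 u) F := by
  unfold sobolevNorm at hs
  rw [iInf_lt_iff] at hs
  obtain ⟨F, hF⟩ := hs
  rw [iInf_lt_iff] at hF
  obtain ⟨hF, -⟩ := hF
  obtain ⟨F', hF', hFF'⟩ := hF.1.aestronglyMeasurable
  exact ⟨F', hF'.measurable, hF.congr hFF'⟩

end IsFunction

/-! ### Real distributions and Hermitian transforms. -/

section Real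

/-- The complex conjugate of a Schwartz function. -/
def schwartzConj (φ : 𝓢(Plane, ℂ)) : 𝓢(Plane, ℂ) :=
  SchwartzMap.postcompCLM (𝕜 := ℝ) (Complex.conjCLE : ℂ →L[ℝ] ℂ) φ

@[simp] lemma schwartzConj_apply (φ : 𝓢(Plane, ℂ)) (x : Plane) :
    schwartzConj φ x = starRingEnd ℂ (φ x) := rfl

/-- The reflected complex conjugate of a Schwartz function. -/
def schwartzRefl (φ : 𝓢(Plane, ℂ)) : 𝓢(Plane, ℂ) :=
  SchwartzMap.compCLMOfContinuousLinearEquiv ℝ (ContinuousLinearEquiv.neg ℝ) (schwartzConj φ)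

@[simp] lemma schwartzRefl_apply (φ : 𝓢(Plane, ℂ)) (x : Plane) :
    schwartzRefl φ x = starRingEnd ℂ (φ (-x)) := rfl

lemma fourier_schwartzRefl (φ : 𝓢(Plane, ℂ)) : 𝓕 (schwartzRefl φ) = schwartzConj (𝓕 φ) := by
  ext ξ
  rw [schwartzConj_apply, SchwartzMap.fourier_coe, SchwartzMap.fourier_coe, Real.fourier_eq,
    Real.fourier_eq, ← integral_conj, ← integral_neg_eq_self]
  congr 1; ext x
  simp only [schwartzRefl_apply, neg_neg, Circle.smul_def, smul_eq_mul, map_mul, inner_neg_left]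
  congr 1
  rw [← Circle.coe_inv_eq_conj, ← AddChar.map_neg_eq_inv, neg_neg]

/-- Split φ into its real and imaginary parts, on both of which u takes real values. -/
lemma IsReal.apply_conj {u : Dist} (hu : IsReal u) (φ : 𝓢(Plane, ℂ)) :
    u (schwartzConj φ) = starRingEnd ℂ (u φ) := by
  set r : 𝓢(Plane, ℂ) := (1 / 2 : ℂ) • (φ + schwartzConj φ) with hr
  set s : 𝓢(Plane, ℂ) := (-Complex.I / 2 : ℂ) • (φ - schwartzConj φ) with hs
  have hr0 : (u r).im = 0 := by
    apply hu
    intro x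
    simp [hr]
  have hs0 : (u s).im = 0 := by
    apply hu
    intro x
    simp [hs]
  have e1 : φ = r + Complex.I • s := by
    ext x
    simp only [hr, hs, add_apply, smul_apply, sub_apply,
      smul_eq_mul]
    linear_combination ((φ x - schwartzConj φ x) / 2) * Complex.I_sq
  have e2 : schwartzConj φ = r - Complex.I • s := by
    ext x
    simp only [hr, hs, add_apply, smul_apply, sub_apply,
      smul_eq_mul]
    linear_combination (-(φ x - schwartzConj φ x) / 2) * Complex.I_sq
  have c1 : starRingEnd ℂ (u r) = u r := Complex.conj_eq_iff_im.2 hr0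
  have c2 : starRingEnd ℂ (u s) = u s := Complex.conj_eq_iff_im.2 hs0
  clear_value r s
  rw [e2]
  nth_rewrite 1 [e1]
  simp only [map_sub, map_add, map_smul, smul_eq_mul, map_mul, c1, c2, Complex.conj_I]
  ring

/-- The Fourier transform carries the reflected conjugate of a test function to the conjugate of its
transform. So u commutes with conjugation exactly when the reflection of F and its conjugate define
the same distribution. -/
lemma isReal_iff_herm {u : Dist} {F : Plane → ℂ} (hF : IsFunction (𝓕 u) F) :
    IsReal u ↔ Herm F := by
  have hneg : LocallyIntegrable (fun x => F (-x)) volume := by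
    rw [locallyIntegrable_iff]
    intro k hk
    have h1 : IntegrableOn F (-k) volume := hF.1.integrableOn_isCompact hk.neg
    have h2 := ((Measure.measurePreserving_neg (volume : Measure Plane)).integrableOn_comp_preimage
      (MeasurableEquiv.neg Plane).measurableEmbedding).2 h1
    simpa [Function.comp_def] using h2
  have hconj : LocallyIntegrable (fun x => starRingEnd ℂ (F x)) volume := by
    rw [locallyIntegrable_iff]
    intro k hk
    exact Complex.conjCLE.toContinuousLinearMap.integrable_comp (hF.1.integrableOn_isCompact hk)
  have e1 : ∀ φ, 𝓕 u (schwartzRefl φ) = ∫ x, schwartzConj φ x * F (-x) := by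
    intro φ
    rw [(hF.2 _).2, ← integral_neg_eq_self]
    simp
  have e2 : ∀ φ, starRingEnd ℂ (𝓕 u φ) = ∫ x, schwartzConj φ x * starRingEnd ℂ (F x) := by
    intro φ
    rw [(hF.2 _).2, ← integral_conj]
    simp
  constructor
  · intro hu
    apply ae_eq_of_integral_schwartz_eq hneg hconj
    intro φ
    have hφ : φ = schwartzConj (schwartzConj φ) := by ext x; simp
    rw [hφ, ← e1, ← e2, TemperedDistribution.fourier_apply, TemperedDistribution.fourier_apply,
      fourier_schwartzRefl, hu.apply_conj]
  · intro hH φ hφ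
    have h1 : 𝓕 u (schwartzRefl (𝓕⁻ φ)) = starRingEnd ℂ (𝓕 u (𝓕⁻ φ)) := by
      rw [e1, e2]
      apply integral_congr_ae
      filter_upwards [hH] with x hx
      rw [hx]
    rw [TemperedDistribution.fourier_apply, TemperedDistribution.fourier_apply,
      fourier_schwartzRefl, FourierTransform.fourier_fourierInv_eq] at h1
    have h2 : schwartzConj φ = φ := by
      ext x
      exact Complex.conj_eq_iff_im.2 (hφ x)
    rw [h2] at h1
    exact Complex.conj_eq_iff_im.1 h1.symm

end Real

/-! ### Fourier inversion for integrable functions and the convolution theorem. -/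

section FourierInv

variable {g : Plane → ℂ}

/-- The character `exp (2πi η·x)`. -/
def phase (η x : Plane) : ℂ := Complex.exp ((2 * Real.pi * inner ℝ η x : ℝ) * Complex.I)

@[simp] lemma norm_phase (η x : Plane) : ‖phase η x‖ = 1 := Complex.norm_exp_ofReal_mul_I _

lemma continuous_phase : Continuous fun z : Plane × Plane => phase z.2 z.1 := by
  unfold phase; fun_prop

lemma fourierInv_eq_integral (g : Plane → ℂ) (x : Plane) :
    𝓕⁻ g x = ∫ η, phase η x * g η := by
  rw [Real.fourierInv_eq']; rfl

lemma continuous_fourierInv (hg : Integrable g volume) : Continuous (𝓕⁻ g) := by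
  have h : Continuous (𝓕 g) :=
    VectorFourier.fourierIntegral_continuous Real.continuous_fourierChar
      (by simpa using continuous_inner) hg
  have : (𝓕⁻ g) = fun x => 𝓕 g (-x) := by
    ext x; exact Real.fourierInv_eq_fourier_neg g x
  rw [this]
  exact h.comp continuous_neg

lemma norm_fourierInv_le (g : Plane → ℂ) (x : Plane) : ‖𝓕⁻ g x‖ ≤ ∫ η, ‖g η‖ := by
  rw [fourierInv_eq_integral]
  refine (norm_integral_le_integral_norm _).trans (le_of_eq ?_)
  congr 1; ext η
  simp

lemma integral_fourier_mul_eq_of_integrable (φ : 𝓢(Plane, ℂ)) (hg : Integrable g volume) :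
    ∫ ξ, 𝓕 φ ξ * g ξ = ∫ x, φ x * 𝓕 g x := by
  have := VectorFourier.integral_fourierIntegral_smul_eq_flip (e := Real.fourierChar)
    (L := innerₗ Plane) (μ := volume) (ν := volume) (f := φ) (g := g)
    Real.continuous_fourierChar (by simpa using continuous_inner) φ.integrable hg
  rw [flip_innerₗ] at this
  exact this

lemma isFunction_fourierInv {v : Dist} (hg : Integrable g volume) (h : IsFunction (𝓕 v) g) :
    IsFunction v (𝓕⁻ g) := by
  refine ⟨(continuous_fourierInv hg).locallyIntegrable, fun φ => ⟨?_, ?_⟩⟩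
  · exact φ.integrable.mul_bdd (c := ∫ η, ‖g η‖) (continuous_fourierInv hg).aestronglyMeasurable
      (ae_of_all _ fun x => norm_fourierInv_le g x)
  · have e : v φ = 𝓕 v (𝓕⁻ φ) := by
      rw [TemperedDistribution.fourier_apply, FourierTransform.fourier_fourierInv_eq]
    rw [e, (h.2 _).2, ← integral_neg_eq_self]
    have h1 : ∀ ξ : Plane, 𝓕⁻ φ (-ξ) = 𝓕 φ ξ := by
      intro ξ
      rw [SchwartzMap.fourierInv_coe, SchwartzMap.fourier_coe, Real.fourierInv_eq_fourier_neg,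
        neg_neg]
    simp only [h1]
    rw [integral_fourier_mul_eq_of_integrable φ hg.comp_neg]
    congr 1; ext x
    rw [Real.fourierInv_eq_fourier_comp_neg]

lemma fourier_translate (φ : 𝓢(Plane, ℂ)) (η x : Plane) :
    𝓕 (SchwartzMap.compSubConstCLM ℂ (-η) φ) x =
      phase η x * 𝓕 φ x := by
  rw [SchwartzMap.fourier_coe, SchwartzMap.fourier_coe]
  have := congrFun (VectorFourier.fourierIntegral_comp_add_right Real.fourierChar volume
    (innerₗ Plane) φ η) x
  have e : (SchwartzMap.compSubConstCLM ℂ (-η) φ : Plane → ℂ) = (φ : Plane → ℂ) ∘ fun v => v + η := by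
    ext v; simp
  rw [e]
  refine this.trans ?_
  rw [Circle.smul_def, Real.fourierChar_apply]
  rfl

lemma schwartz_mul_integrable_conv {G : Plane → ℂ} (hg : Measurable g) (hG : Measurable G)
    (hg1 : Integrable g volume) (hG2 : MemLp G 2 volume) (φ : 𝓢(Plane, ℂ)) :
    Integrable (fun z : Plane × Plane => φ z.1 * (g z.2 * G (z.1 - z.2)))
      (volume.prod volume) := by
  refine ⟨?_, ?_⟩
  · have : Measurable fun z : Plane × Plane => φ z.1 * (g z.2 * G (z.1 - z.2)) := by
      have := φ.continuous.measurable
      fun_prop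
    exact this.aestronglyMeasurable
  · have hφm : Measurable fun x => ‖φ x‖ₑ := φ.continuous.measurable.enorm
    have hcm : Measurable fun ξ => ∫⁻ a, ‖g a‖ₑ * ‖G (ξ - a)‖ₑ :=
      Measurable.lintegral_prod_right' (f := fun z : Plane × Plane => ‖g z.2‖ₑ * ‖G (z.1 - z.2)‖ₑ)
        (by fun_prop)
    have hm : Measurable fun z : Plane × Plane => ‖φ z.1‖ₑ * (‖g z.2‖ₑ * ‖G (z.1 - z.2)‖ₑ) :=
      (hφm.comp measurable_fst).mul (by fun_prop)
    simp only [HasFiniteIntegral, enorm_mul]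
    rw [lintegral_prod _ hm.aemeasurable]
    have e : ∀ x : Plane, ∫⁻ y, ‖φ x‖ₑ * (‖g y‖ₑ * ‖G (x - y)‖ₑ) =
        ‖φ x‖ₑ * ∫⁻ y, ‖g y‖ₑ * ‖G (x - y)‖ₑ := by
      intro x
      have hm' : Measurable fun y => ‖g y‖ₑ * ‖G (x - y)‖ₑ := by fun_prop
      exact lintegral_const_mul _ hm'
    simp only [e]
    have hle := lintegral_mul_le_l2 (f := fun x => ‖φ x‖ₑ)
      (g := fun ξ => ∫⁻ a, ‖g a‖ₑ * ‖G (ξ - a)‖ₑ) hφm hcm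
    have h1 : l2 (fun x => ‖φ x‖ₑ) < ⊤ := by
      rw [← eLpNorm_two_eq_l2 (φ : Plane → ℂ)]
      exact (SchwartzMap.memLp φ 2 volume).2
    have h2 : l2 (fun ξ => ∫⁻ a, ‖g a‖ₑ * ‖G (ξ - a)‖ₑ) < ⊤ := by
      unfold l2
      apply ENNReal.rpow_lt_top_of_nonneg (by norm_num)
      have hY := lintegral_young (p := fun a => ‖g a‖ₑ) (q := fun a => ‖G a‖ₑ) hg.enorm hG.enorm
      have h3 := hG2.2
      rw [eLpNorm_two_eq_l2] at h3
      rw [← l2_sq (fun a => ‖G a‖ₑ)] at hY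
      exact ne_top_of_le_ne_top
        (ENNReal.mul_lt_top (ENNReal.pow_lt_top hg1.2) (ENNReal.pow_lt_top h3)).ne hY
    exact lt_of_le_of_lt hle (ENNReal.mul_lt_top h1 h2)

/-- The Fourier transform of a product is the convolution of the Fourier transforms. -/
lemma integral_fourier_mul_prod {β : Dist} {b G : Plane → ℂ} (hg : Measurable g)
    (hG : Measurable G) (hg1 : Integrable g volume) (hG2 : MemLp G 2 volume)
    (hb : IsFunction β b) (hβ : IsFunction (𝓕 β) G) (φ : 𝓢(Plane, ℂ)) :
    Integrable (fun ξ => φ ξ * ∫ η, g η * G (ξ - η)) volume ∧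
      Integrable (fun x => 𝓕 φ x * (𝓕⁻ g x * b x)) volume ∧
      ∫ x, 𝓕 φ x * (𝓕⁻ g x * b x) = ∫ ξ, φ ξ * ∫ η, g η * G (ξ - η) := by
  have hconv := schwartz_mul_integrable_conv hg hG hg1 hG2 φ
  have hbφ := (hb.2 (𝓕 φ)).1
  have hprod : Integrable (fun z : Plane × Plane =>
      phase z.2 z.1 * ((𝓕 φ z.1 * b z.1) * g z.2))
      (volume.prod volume) := by
    refine (hbφ.mul_prod hg1).bdd_mul (c := 1) ?_ (ae_of_all _ fun z => by simp)
    exact continuous_phase.aestronglyMeasurable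
  have e0 : ∀ x, ∫ η, phase η x * ((𝓕 φ x * b x) * g η) =
      𝓕 φ x * (𝓕⁻ g x * b x) := by
    intro x
    rw [fourierInv_eq_integral, ← integral_mul_const, ← integral_const_mul]
    congr 1; ext η; ring
  -- A phase in x is a translation by η in frequency, where b may be replaced by its transform G.
  have e1 : ∀ η, ∫ x, phase η x * ((𝓕 φ x * b x) * g η) =
      ∫ ξ, φ ξ * (g η * G (ξ - η)) := by
    intro η
    have h1 : ∫ x, 𝓕 (SchwartzMap.compSubConstCLM ℂ (-η) φ) x * b x =
        ∫ ξ, SchwartzMap.compSubConstCLM ℂ (-η) φ ξ * G ξ := by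
      rw [← (hb.2 _).2, ← (hβ.2 _).2, TemperedDistribution.fourier_apply]
    calc _ = g η * ∫ x, 𝓕 (SchwartzMap.compSubConstCLM ℂ (-η) φ) x * b x := by
          rw [← integral_const_mul]
          congr 1; ext x
          rw [fourier_translate]; ring
      _ = g η * ∫ ξ, φ ξ * G (ξ - η) := by
          rw [h1, ← integral_sub_right_eq_self _ η]
          simp
      _ = _ := by
          rw [← integral_const_mul]
          congr 1; ext ξ; ring
  refine ⟨?_, ?_, ?_⟩
  · have := hconv.integral_prod_left
    simpa only [integral_const_mul] using this
  · have := hprod.integral_prod_left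
    simpa only [e0] using this
  · calc _ = ∫ x, ∫ η, phase η x * ((𝓕 φ x * b x) * g η) := by
          simp only [e0]
      _ = ∫ η, ∫ x, phase η x * ((𝓕 φ x * b x) * g η) :=
          integral_integral_swap hprod
      _ = ∫ η, ∫ ξ, φ ξ * (g η * G (ξ - η)) := by simp only [e1]
      _ = ∫ ξ, ∫ η, φ ξ * (g η * G (ξ - η)) := (integral_integral_swap hconv).symm
      _ = _ := by simp only [integral_const_mul]

end FourierInv

/-! ### The Fourier transform of the advection term. -/

/-- The symbols of the components of the velocity. -/
def velSymbol (j : Fin 2) (ξ : Plane) : ℂ :=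
  if j = 0 then derivSymbol 1 ξ * fracLaplaceSymbol (-1 / 2) ξ
  else -derivSymbol 0 ξ * fracLaplaceSymbol (-1 / 2) ξ

lemma fracLaplaceSymbol_neg_half (ξ : Plane) :
    fracLaplaceSymbol (-1 / 2) ξ = (((2 * Real.pi * ‖ξ‖)⁻¹ : ℝ) : ℂ) := by
  rw [fracLaplaceSymbol, show (2 * (-1 / 2) : ℝ) = -1 by norm_num, Real.rpow_neg_one]

lemma abs_coord_le (ξ : Plane) (j : Fin 2) : |ξ j| ≤ ‖ξ‖ := by
  have := PiLp.norm_apply_le ξ j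
  rwa [Real.norm_eq_abs] at this

lemma norm_derivSymbol_le (j : Fin 2) (ξ : Plane) : ‖derivSymbol j ξ‖ ≤ w ξ := by
  unfold derivSymbol w
  rw [norm_mul, norm_mul, norm_mul, Complex.norm_I, Complex.norm_real, Complex.norm_real,
    Real.norm_eq_abs, Real.norm_eq_abs, abs_of_pos Real.pi_pos, mul_one]
  have := abs_coord_le ξ j
  simp only [Complex.norm_ofNat]
  gcongr

lemma norm_velSymbol_le (j : Fin 2) (ξ : Plane) : ‖velSymbol j ξ‖ ≤ 1 := by
  have key : ∀ i : Fin 2, ‖derivSymbol i ξ * fracLaplaceSymbol (-1 / 2) ξ‖ ≤ 1 := by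
    intro i
    rw [fracLaplaceSymbol_neg_half, norm_mul, Complex.norm_real, Real.norm_eq_abs,
      abs_of_nonneg (by positivity)]
    calc _ ≤ w ξ * (2 * Real.pi * ‖ξ‖)⁻¹ := by gcongr; exact norm_derivSymbol_le i ξ
      _ ≤ 1 := mul_inv_le_one
  unfold velSymbol
  split_ifs
  · exact key 1
  · rw [neg_mul, norm_neg]; exact key 0

lemma measurable_derivSymbol (j : Fin 2) : Measurable (derivSymbol j) := by
  unfold derivSymbol; fun_prop

lemma measurable_velSymbol (j : Fin 2) : Measurable (velSymbol j) := by
  have h0 := measurable_derivSymbol 0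
  have h1 := measurable_derivSymbol 1
  have h2 : Measurable (fracLaplaceSymbol (-1 / 2)) := by
    have := measurable_w_rpow (2 * (-1 / 2))
    exact Complex.measurable_ofReal.comp this
  unfold velSymbol
  split_ifs
  · exact h1.mul h2
  · exact h0.neg.mul h2

lemma velSymbol_mul_derivSymbol (a b : Plane) :
    velSymbol 0 a * derivSymbol 0 b + velSymbol 1 a * derivSymbol 1 b = (kerR a b : ℂ) := by
  unfold velSymbol
  simp only [if_true, if_neg (one_ne_zero : (1 : Fin 2) ≠ 0)]
  rw [fracLaplaceSymbol_neg_half]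
  unfold derivSymbol kerR
  rcases eq_or_ne a 0 with rfl | ha
  · simp
  · have hn : (‖a‖ : ℂ) ≠ 0 := by simpa using ha
    have hpi : (Real.pi : ℂ) ≠ 0 := by exact_mod_cast Real.pi_ne_zero
    push_cast
    field_simp
    linear_combination (a 1 * b 0 - a 0 * b 1 : ℂ) * Complex.I_sq

lemma isVelocity_iff {θ v₁ v₂ : Dist} : IsVelocity θ v₁ v₂ ↔
    IsMultiplier (velSymbol 0) θ v₁ ∧ IsMultiplier (velSymbol 1) θ v₂ := Iff.rfl

lemma fourier_partialDeriv {θ : Dist} {F : Plane → ℂ} (j : Fin 2) (hF : IsFunction (𝓕 θ) F)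
    (h2 : MemLp (fun ξ => derivSymbol j ξ * F ξ) 2 volume) :
    IsFunction (𝓕 (partialDeriv j θ)) (fun ξ => derivSymbol j ξ * F ξ) := by
  refine ⟨h2.locallyIntegrable (by norm_num), fun φ => ⟨(φ.memLp 2).integrable_mul h2, ?_⟩⟩
  rw [partialDeriv, TemperedDistribution.fourier_lineDerivOp_eq]
  change (2 * Real.pi * Complex.I) • (TemperedDistribution.smulLeftCLM ℂ
    (fun x : Plane => ((inner ℝ x (EuclideanSpace.single j (1 : ℝ)) : ℝ) : ℂ)) (𝓕 θ)) φ = _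
  have hg : Function.HasTemperateGrowth
      (fun x : Plane => ((inner ℝ x (EuclideanSpace.single j (1 : ℝ)) : ℝ) : ℂ)) := by fun_prop
  rw [TemperedDistribution.smulLeftCLM_apply_apply, (hF.2 _).2, smul_eq_mul,
    ← integral_const_mul]
  congr 1; ext ξ
  rw [SchwartzMap.smulLeftCLM_apply_apply hg, EuclideanSpace.inner_single_right]
  simp [derivSymbol]
  ring

lemma exists_isFunction_of_fourier_memLp {u : Dist} {G : Plane → ℂ} (hG : MemLp G 2 volume)
    (h : IsFunction (𝓕 u) G) : ∃ b, MemLp b 2 volume ∧ IsFunction u b := by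
  have e1 : (𝓕 u : Dist) = Lp.toTemperedDistribution (hG.toLp G) := by
    ext φ
    rw [(h.2 φ).2, Lp.toTemperedDistribution_apply]
    apply integral_congr_ae
    filter_upwards [hG.coeFn_toLp] with x hx
    rw [hx, smul_eq_mul]
  have hu : (𝓕⁻ (𝓕 u : Dist) : Dist) = u := FourierTransform.fourierInv_fourier_eq u
  have e2 : u = Lp.toTemperedDistribution (𝓕⁻ (hG.toLp G)) := by
    rw [← hu, e1, Lp.fourierInv_toTemperedDistribution_eq]
  have hb := Lp.memLp (𝓕⁻ (hG.toLp G))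
  refine ⟨_, hb, hb.locallyIntegrable (by norm_num), fun φ => ⟨(φ.memLp 2).integrable_mul hb, ?_⟩⟩
  nth_rewrite 1 [e2]
  rw [Lp.toTemperedDistribution_apply]
  simp only [smul_eq_mul]

section Advection

variable {α : ℝ} {θ N : Dist} {F : Plane → ℂ}

lemma Adm.deriv_memLp (hα0 : 0 < α) (hα1 : α < 1 / 2) (hF : Adm α F) (j : Fin 2) :
    MemLp (fun ξ => derivSymbol j ξ * F ξ) 2 volume := by
  have h1 : nrm 1 F < ⊤ := hF.nrm_lt_top (by linarith) (by linarith)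
  have h2 : MemLp (fun ξ => ((w ξ ^ (1 : ℝ) : ℝ) : ℂ) * F ξ) 2 volume :=
    ⟨(measurable_weight_mul hF.meas).aestronglyMeasurable, h1⟩
  refine h2.mono ((measurable_derivSymbol j).mul hF.meas).aestronglyMeasurable
    (ae_of_all _ fun ξ => ?_)
  rw [norm_mul, norm_mul, Complex.norm_real, Real.norm_eq_abs, Real.rpow_one,
    abs_of_nonneg (w_nonneg ξ)]
  gcongr
  exact norm_derivSymbol_le j ξ

lemma Adm.vel_integrable (hα0 : 0 < α) (hα1 : α < 1 / 2) (hF : Adm α F) (j : Fin 2) :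
    Integrable (fun ξ => velSymbol j ξ * F ξ) volume :=
  (hF.integrable hα0 hα1).bdd_mul (measurable_velSymbol j).aestronglyMeasurable
    (ae_of_all _ fun ξ => norm_velSymbol_le j ξ)

lemma IsMultiplier.isFunction {m : Plane → ℂ} {u v : Dist} (h : IsMultiplier m u v)
    (hF : IsFunction (𝓕 u) F) : IsFunction (𝓕 v) (fun ξ => m ξ * F ξ) := by
  obtain ⟨G, hG, hv⟩ := h
  refine hv.congr ?_
  filter_upwards [hG.ae_unique hF] with ξ hξ
  rw [hξ]

/-- The Fourier transform of the advection term. -/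
lemma IsAdvection.fourier (hα0 : 0 < α) (hα1 : α < 1 / 2) (hF : Adm α F)
    (hθ : IsFunction (𝓕 θ) F) (hN : IsAdvection θ N) : IsFunction (𝓕 N) (B F F) := by
  obtain ⟨v₁, v₂, hv, a₁, a₂, b₁, b₂, ha₁, ha₂, hb₁, hb₂, hN⟩ := hN
  obtain ⟨hv₁, hv₂⟩ := isVelocity_iff.1 hv
  have g₁ := hF.vel_integrable hα0 hα1 0
  have g₂ := hF.vel_integrable hα0 hα1 1
  have A₁ := ha₁.ae_unique (isFunction_fourierInv g₁ (hv₁.isFunction hθ))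
  have A₂ := ha₂.ae_unique (isFunction_fourierInv g₂ (hv₂.isFunction hθ))
  have D₁ := hF.deriv_memLp hα0 hα1 0
  have D₂ := hF.deriv_memLp hα0 hα1 1
  have hB := hF.B_memLp hα0 hα1 hF
  refine ⟨hB.locallyIntegrable (by norm_num), fun φ => ⟨(φ.memLp 2).integrable_mul hB, ?_⟩⟩
  obtain ⟨p₁, q₁, e₁⟩ := integral_fourier_mul_prod (g := fun ξ => velSymbol 0 ξ * F ξ)
    (G := fun ξ => derivSymbol 0 ξ * F ξ) ((measurable_velSymbol 0).mul hF.meas)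
    ((measurable_derivSymbol 0).mul hF.meas) g₁ D₁ hb₁ (fourier_partialDeriv 0 hθ D₁) φ
  obtain ⟨p₂, q₂, e₂⟩ := integral_fourier_mul_prod (g := fun ξ => velSymbol 1 ξ * F ξ)
    (G := fun ξ => derivSymbol 1 ξ * F ξ) ((measurable_velSymbol 1).mul hF.meas)
    ((measurable_derivSymbol 1).mul hF.meas) g₂ D₂ hb₂ (fourier_partialDeriv 1 hθ D₂) φ
  -- The two components are convolved separately, and only their sum has the kernel of `B`. Young's
  -- inequality makes each integrable in η for almost every ξ, so the inner integrals can be added.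
  have young : ∀ j : Fin 2, ∀ᵐ ξ, Integrable (fun η => velSymbol j η * F η *
      (derivSymbol j (ξ - η) * F (ξ - η))) volume := by
    intro j
    have hVm := (measurable_velSymbol j).mul hF.meas
    have hDm := (measurable_derivSymbol j).mul hF.meas
    refine (bilin_young (κ := fun ξ η => velSymbol j η * F η * (derivSymbol j (ξ - η) * F (ξ - η)))
      (p := fun η => ‖velSymbol j η * F η‖ₑ) (q := fun η => ‖derivSymbol j η * F η‖ₑ)
      hVm.enorm hDm.enorm (hF.vel_integrable hα0 hα1 j).2 ?_ ?_ ?_).1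
    · rw [← eLpNorm_two_eq_l2]; exact (hF.deriv_memLp hα0 hα1 j).2
    · exact (hVm.comp measurable_snd).mul (hDm.comp (measurable_fst.sub measurable_snd))
    · intro ξ η; rw [enorm_mul]
  rw [TemperedDistribution.fourier_apply, (hN.2 _).2]
  calc _ = ∫ x, (𝓕 φ x * (𝓕⁻ (fun ξ => velSymbol 0 ξ * F ξ) x * b₁ x) +
        𝓕 φ x * (𝓕⁻ (fun ξ => velSymbol 1 ξ * F ξ) x * b₂ x)) := by
        apply integral_congr_ae
        filter_upwards [A₁, A₂] with x h1 h2
        rw [h1, h2]; ring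
    _ = _ := integral_add q₁ q₂
    _ = _ := by rw [e₁, e₂]
    _ = _ := (integral_add p₁ p₂).symm
    _ = _ := by
        apply integral_congr_ae
        filter_upwards [young 0, young 1] with ξ y₁ y₂
        rw [← mul_add, ← integral_add y₁ y₂, B]
        congr 2; ext η
        rw [← velSymbol_mul_derivSymbol]; ring

/-- The velocity is bounded, being the inverse transform of an integrable function, and the gradient
is in L² because α ≤ 1 ≤ 2 - 2α. Hence their product is in L². -/
lemma exists_isAdvection (hα0 : 0 < α) (hα1 : α < 1 / 2) (hF : Adm α F)
    (hθ : IsFunction (𝓕 θ) F) : ∃ N, IsAdvection θ N := by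
  have : Fact ((1 : ℝ≥0∞) ≤ 1) := ⟨le_rfl⟩
  have vel : ∀ j, ∃ v : Dist, IsMultiplier (velSymbol j) θ v ∧
      IsFunction v (𝓕⁻ fun ξ => velSymbol j ξ * F ξ) := by
    intro j
    have g := hF.vel_integrable hα0 hα1 j
    obtain ⟨v, hv⟩ := exists_fourier_isFunction (memLp_one_iff_integrable.2 g)
    exact ⟨v, ⟨F, hθ, hv⟩, isFunction_fourierInv g hv⟩
  have der : ∀ j, ∃ b, MemLp b 2 volume ∧ IsFunction (partialDeriv j θ) b := fun j =>
    exists_isFunction_of_fourier_memLp (hF.deriv_memLp hα0 hα1 j)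
      (fourier_partialDeriv j hθ (hF.deriv_memLp hα0 hα1 j))
  obtain ⟨v₁, hv₁, ha₁⟩ := vel 0
  obtain ⟨v₂, hv₂, ha₂⟩ := vel 1
  obtain ⟨b₁, m₁, hb₁⟩ := der 0
  obtain ⟨b₂, m₂, hb₂⟩ := der 1
  have prod : ∀ (j : Fin 2) (b : Plane → ℂ), MemLp b 2 volume →
      MemLp (fun x => (𝓕⁻ fun ξ => velSymbol j ξ * F ξ) x * b x) 2 volume := by
    intro j b hb
    have g := hF.vel_integrable hα0 hα1 j
    refine (hb.const_mul ((∫ η, ‖velSymbol j η * F η‖ : ℝ) : ℂ)).mono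
      ((continuous_fourierInv g).aestronglyMeasurable.mul hb.1) (ae_of_all _ fun x => ?_)
    rw [norm_mul, norm_mul, Complex.norm_real, Real.norm_eq_abs,
      abs_of_nonneg (integral_nonneg fun _ => norm_nonneg _)]
    gcongr
    exact norm_fourierInv_le _ x
  obtain ⟨N, hN⟩ := exists_isFunction_of_memLp ((prod 0 b₁ m₁).add (prod 1 b₂ m₂))
  exact ⟨N, v₁, v₂, isVelocity_iff.2 ⟨hv₁, hv₂⟩, _, _, b₁, b₂, ha₁, ha₂, hb₁, hb₂, hN⟩

end Advection

/-! ### Return to distributions and well-posedness. -/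

section Solutions

variable {α : ℝ} {f θ : Dist} {F fh : Plane → ℂ}

lemma Adm.laplace_memLp (hα0 : 0 < α) (hα1 : α < 1 / 2) (hF : Adm α F) :
    MemLp (fun ξ => ((w ξ ^ (2 * α) : ℝ) : ℂ) * F ξ) 2 volume :=
  ⟨(measurable_weight_mul hF.meas).aestronglyMeasurable,
    hF.nrm_lt_top (by linarith) (by linarith)⟩

lemma exists_adm_of_solutionNorm (h : solutionNorm α θ < ⊤) :
    ∃ F, Adm α F ∧ IsFunction (𝓕 θ) F := by
  have h1 := ENNReal.add_lt_top.1 h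
  obtain ⟨F, hFm, hF⟩ := exists_of_sobolevNorm_lt_top h1.1
  refine ⟨F, ⟨hFm, ?_, ?_⟩, hF⟩
  · rw [← sobolevNorm_eq _ hF]; exact h1.1
  · rw [← sobolevNorm_eq _ hF]; exact h1.2

lemma Adm.solutionNorm_lt_top (hF : Adm α F) (hθ : IsFunction (𝓕 θ) F) : solutionNorm α θ < ⊤ := by
  rw [solutionNorm, sobolevNorm_eq _ hθ, sobolevNorm_eq _ hθ]
  exact ENNReal.add_lt_top.2 ⟨hF.low, hF.high⟩

lemma fourier_add_isFunction {L N : Dist} {g h : Plane → ℂ} (hL : IsFunction (𝓕 L) g)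
    (hN : IsFunction (𝓕 N) h) : IsFunction (𝓕 (L + N)) (fun ξ => g ξ + h ξ) := by
  rw [FourierTransform.fourier_add]
  exact hL.add hN

lemma IsSolution.solves (hα0 : 0 < α) (hα1 : α < 1 / 2) (h : IsSolution α f θ) (hF : Adm α F)
    (hθ : IsFunction (𝓕 θ) F) (hf : IsFunction (𝓕 f) fh) : Herm F ∧ Solves α F F fh := by
  obtain ⟨hreal, -, L, N, hL, hN, rfl⟩ := h
  refine ⟨(isReal_iff_herm hθ).1 hreal, ?_⟩
  have h1 := hL.isFunction hθ
  have h2 := hN.fourier hα0 hα1 hF hθ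
  exact (fourier_add_isFunction h1 h2).ae_unique hf

/-- All distributions are built from their transforms: F is integrable, and `w ^ (2 * α) * F` is in
L² because 2α lies between α and 2 - 2α. The equation then only has to be compared on the Fourier
side. -/
lemma isSolution_of_solves (hα0 : 0 < α) (hα1 : α < 1 / 2) (hF : Adm α F) (hH : Herm F)
    (hf : IsFunction (𝓕 f) fh) (h : Solves α F F fh) :
    ∃ θ, IsFunction (𝓕 θ) F ∧ IsSolution α f θ := by
  have : Fact ((1 : ℝ≥0∞) ≤ 1) := ⟨le_rfl⟩
  obtain ⟨θ, hθ⟩ := exists_fourier_isFunction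
    (memLp_one_iff_integrable.2 (hF.integrable hα0 hα1))
  obtain ⟨L, hL⟩ := exists_fourier_isFunction (hF.laplace_memLp hα0 hα1)
  obtain ⟨N, hN⟩ := exists_isAdvection hα0 hα1 hF hθ
  refine ⟨θ, hθ, (isReal_iff_herm hθ).2 hH, hF.solutionNorm_lt_top hθ, L, N, ⟨F, hθ, hL⟩, hN, ?_⟩
  exact dist_ext_of_fourier
    ((fourier_add_isFunction hL (hN.fourier hα0 hα1 hF hθ)).congr h) hf

/-- Well-posedness for forces that are small in `Ḣ^{2-4α}`. -/
theorem exists_solutionMap (hα0 : 0 < α) (hα1 : α < 1 / 2) :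
    ∃ δ η : ℝ, ∃ S : Dist → Dist, 0 < δ ∧ 0 < η ∧ IsSolutionMap α δ η S := by
  obtain ⟨R, hR, hRs⟩ := exists_pos_small α
  have key : ∀ f : Dist, ∃ θ : Dist, f ∈ smallData α (R / 4) →
      (IsSolution α f θ ∧ sobolevNorm (2 - 2 * α) θ ≤ ENNReal.ofReal R) ∧
        ∀ θ' : Dist, IsSolution α f θ' → sobolevNorm (2 - 2 * α) θ' ≤ ENNReal.ofReal R →
          θ' = θ := by
    intro f
    by_cases hf : f ∈ smallData α (R / 4)
    swap; · exact ⟨0, fun h => absurd h hf⟩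
    obtain ⟨hreal, hfin, hsmall⟩ := hf
    obtain ⟨fh, hfm, hfh⟩ := exists_of_sobolevNorm_lt_top (ENNReal.add_lt_top.1 hfin).1
    have hlow : nrm (-α) fh < ⊤ := by
      rw [← sobolevNorm_eq _ hfh]; exact (ENNReal.add_lt_top.1 hfin).1
    rw [sobolevNorm_eq _ hfh] at hsmall
    obtain ⟨F, hF, hFH, hFs, hFn⟩ := exists_nonlinear hα0 hα1 hR hRs hfm
      ((isReal_iff_herm hfh).1 hreal) hlow hsmall
    obtain ⟨θ, hθ, hsol⟩ := isSolution_of_solves hα0 hα1 hF hFH hfh hFs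
    refine ⟨θ, fun _ => ⟨⟨hsol, by rwa [sobolevNorm_eq _ hθ]⟩, fun θ' hθ' hn => ?_⟩⟩
    obtain ⟨F', hF', hFθ'⟩ := exists_adm_of_solutionNorm hθ'.2.1
    obtain ⟨hH', hs'⟩ := hθ'.solves hα0 hα1 hF' hFθ' hfh
    rw [sobolevNorm_eq _ hFθ'] at hn
    have := unique_nonlinear hα0 hα1 hRs hF hFH hF' hn hFs hs'
    exact dist_ext_of_fourier hFθ' (hθ.congr this)
  choose S hS using key
  exact ⟨R / 4, R, S, by positivity, hR, fun f hf => hS f hf⟩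

end Solutions

/-! ### Schwartz forces generated by smooth profiles. -/

section Smooth

variable {α : ℝ} {U F G : Plane → ℂ}

/-- Smooth functions with compact support that vanish near the origin. -/
structure SmoothAway (F : Plane → ℂ) : Prop where
  smooth : ContDiff ℝ ((⊤ : ℕ∞) : WithTop ℕ∞) F
  cpt : HasCompactSupport F
  away : F =ᶠ[𝓝 0] 0

lemma SmoothAway.add (hF : SmoothAway F) (hG : SmoothAway G) :
    SmoothAway (fun ξ => F ξ + G ξ) :=
  ⟨hF.smooth.add hG.smooth, hF.cpt.add hG.cpt, by
    filter_upwards [hF.away, hG.away] with ξ h1 h2; simp [h1, h2]⟩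

/-- Multiplication by a symbol that is smooth off the origin. -/
lemma SmoothAway.mul_left {m : Plane → ℂ}
    (hm : ∀ ξ ≠ 0, ContDiffAt ℝ ((⊤ : ℕ∞) : WithTop ℕ∞) m ξ) (hF : SmoothAway F) :
    SmoothAway (fun ξ => m ξ * F ξ) := by
  refine ⟨contDiff_iff_contDiffAt.2 fun ξ => ?_, hF.cpt.mul_left, ?_⟩
  · rcases eq_or_ne ξ 0 with rfl | h
    · refine (contDiffAt_const (c := (0 : ℂ))).congr_of_eventuallyEq ?_
      filter_upwards [hF.away] with η h; simp [h]
    · exact (hm ξ h).mul hF.smooth.contDiffAt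
  · filter_upwards [hF.away] with η h; simp [h]

lemma contDiffAt_w {ξ : Plane} (h : ξ ≠ 0) : ContDiffAt ℝ ((⊤ : ℕ∞) : WithTop ℕ∞) w ξ := by
  unfold w
  exact contDiffAt_const.mul (contDiffAt_norm ℝ h)

lemma contDiffAt_w_rpow (s : ℝ) {ξ : Plane} (h : ξ ≠ 0) :
    ContDiffAt ℝ ((⊤ : ℕ∞) : WithTop ℕ∞) (fun ξ => ((w ξ ^ s : ℝ) : ℂ)) ξ :=
  Complex.ofRealCLM.contDiff.contDiffAt.comp ξ
    ((contDiffAt_w h).rpow_const_of_ne (w_pos h).ne')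

lemma contDiff_derivSymbol (j : Fin 2) :
    ContDiff ℝ ((⊤ : ℕ∞) : WithTop ℕ∞) (derivSymbol j) := by
  have h : ContDiff ℝ ((⊤ : ℕ∞) : WithTop ℕ∞) fun ξ : Plane => ξ j := by fun_prop
  unfold derivSymbol
  exact contDiff_const.mul (Complex.ofRealCLM.contDiff.comp h)

lemma contDiffAt_velSymbol (j : Fin 2) {ξ : Plane} (h : ξ ≠ 0) :
    ContDiffAt ℝ ((⊤ : ℕ∞) : WithTop ℕ∞) (velSymbol j) ξ := by
  have h1 := contDiffAt_w_rpow (2 * (-1 / 2)) h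
  have d := fun j => (contDiff_derivSymbol j).contDiffAt (x := ξ)
  fin_cases j
  · exact (d 1).mul h1
  · exact (d 0).neg.mul h1

lemma SmoothAway.laplace (s : ℝ) (hF : SmoothAway F) :
    SmoothAway (fun ξ => ((w ξ ^ s : ℝ) : ℂ) * F ξ) :=
  hF.mul_left fun _ h => contDiffAt_w_rpow s h

lemma SmoothAway.vel (j : Fin 2) (hF : SmoothAway F) :
    SmoothAway (fun ξ => velSymbol j ξ * F ξ) :=
  hF.mul_left fun _ h => contDiffAt_velSymbol j h

lemma SmoothAway.deriv (j : Fin 2) (hF : SmoothAway F) :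
    SmoothAway (fun ξ => derivSymbol j ξ * F ξ) :=
  hF.mul_left fun _ _ => (contDiff_derivSymbol j).contDiffAt

lemma SmoothAway.integrable (hF : SmoothAway F) : Integrable F volume :=
  hF.smooth.continuous.integrable_of_hasCompactSupport hF.cpt

lemma SmoothAway.conv_integrable (hU : SmoothAway U) (hF : SmoothAway F) (j : Fin 2) (ξ : Plane) :
    Integrable (fun a => velSymbol j a * U a * (derivSymbol j (ξ - a) * F (ξ - a))) volume :=
  (hF.deriv j).cpt.convolutionExists_right (ContinuousLinearMap.mul ℝ ℂ)
    ((hU.vel j).integrable.locallyIntegrable) (hF.deriv j).smooth.continuous ξ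

lemma B_integrand_eq (U F : Plane → ℂ) (ξ a : Plane) :
    (kerR a (ξ - a) : ℂ) * U a * F (ξ - a) =
      velSymbol 0 a * U a * (derivSymbol 0 (ξ - a) * F (ξ - a)) +
        velSymbol 1 a * U a * (derivSymbol 1 (ξ - a) * F (ξ - a)) := by
  rw [← velSymbol_mul_derivSymbol]; ring

lemma SmoothAway.B_integrable (hU : SmoothAway U) (hF : SmoothAway F) (ξ : Plane) :
    Integrable (fun a => (kerR a (ξ - a) : ℂ) * U a * F (ξ - a)) volume := by
  simp only [B_integrand_eq]
  exact (hU.conv_integrable hF 0 ξ).add (hU.conv_integrable hF 1 ξ)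

lemma SmoothAway.B_add_right (hU : SmoothAway U) (hF : SmoothAway F) (hG : SmoothAway G)
    (ξ : Plane) : B U (fun ξ => F ξ + G ξ) ξ = B U F ξ + B U G ξ := by
  unfold B
  rw [← integral_add (hU.B_integrable hF ξ) (hU.B_integrable hG ξ)]
  congr 1; ext a; ring

lemma SmoothAway.B_add_left (hU : SmoothAway U) (hG : SmoothAway G) (hF : SmoothAway F)
    (ξ : Plane) : B (fun ξ => U ξ + G ξ) F ξ = B U F ξ + B G F ξ := by
  unfold B
  rw [← integral_add (hU.B_integrable hF ξ) (hG.B_integrable hF ξ)]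
  congr 1; ext a; ring

/-- Split by components, the kernel gives genuine convolutions of smooth compactly supported
functions, from which smoothness and compact support of `B U F` follow. -/
lemma SmoothAway.B_eq_convolution (hU : SmoothAway U) (hF : SmoothAway F) :
    B U F = convolution (fun ξ => velSymbol 0 ξ * U ξ) (fun ξ => derivSymbol 0 ξ * F ξ)
        (ContinuousLinearMap.mul ℝ ℂ) volume +
      convolution (fun ξ => velSymbol 1 ξ * U ξ) (fun ξ => derivSymbol 1 ξ * F ξ)
        (ContinuousLinearMap.mul ℝ ℂ) volume := by
  ext ξ
  simp only [B, B_integrand_eq]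
  exact integral_add (hU.conv_integrable hF 0 ξ) (hU.conv_integrable hF 1 ξ)

lemma SmoothAway.contDiff_B (hU : SmoothAway U) (hF : SmoothAway F) :
    ContDiff ℝ ((⊤ : ℕ∞) : WithTop ℕ∞) (B U F) := by
  rw [hU.B_eq_convolution hF]
  have h : ∀ j, ContDiff ℝ ((⊤ : ℕ∞) : WithTop ℕ∞)
      (convolution (fun ξ => velSymbol j ξ * U ξ) (fun ξ => derivSymbol j ξ * F ξ)
        (ContinuousLinearMap.mul ℝ ℂ) volume) := fun j =>
    (hF.deriv j).cpt.contDiff_convolution_right _ (hU.vel j).integrable.locallyIntegrable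
      (hF.deriv j).smooth
  exact (h 0).add (h 1)

lemma SmoothAway.hasCompactSupport_B (hU : SmoothAway U) (hF : SmoothAway F) :
    HasCompactSupport (B U F) := by
  rw [hU.B_eq_convolution hF]
  have h : ∀ j, HasCompactSupport
      (convolution (fun ξ => velSymbol j ξ * U ξ) (fun ξ => derivSymbol j ξ * F ξ)
        (ContinuousLinearMap.mul ℝ ℂ) volume) := fun j =>
    (hU.vel j).cpt.convolution _ (hF.deriv j).cpt
  exact (h 0).add (h 1)

lemma SmoothAway.adm (hα0 : 0 < α) (hα1 : α < 1 / 2) (hF : SmoothAway F) : Adm α F := by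
  obtain ⟨R, hR⟩ := hF.cpt.isCompact.isBounded.subset_closedBall (0 : Plane)
  obtain ⟨C, hC⟩ := hF.cpt.exists_bound_of_continuous hF.smooth.continuous
  refine adm_of_bounded hα0 hα1 hF.smooth.continuous.measurable (n := R) (C := C)
    (fun ξ _ => hC ξ) fun ξ h => ?_
  by_contra h0
  have := hR (subset_tsupport _ h0)
  rw [mem_closedBall_zero_iff] at this
  linarith

lemma Herm.B_neg (hU : Herm U) (hF : Herm F) (ξ : Plane) :
    B U F (-ξ) = starRingEnd ℂ (B U F ξ) := by
  have h : F =ᵐ[volume] refl F := by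
    filter_upwards [hF] with ξ h
    rw [refl, h, Complex.conj_conj]
  rw [B_congr (EventuallyEq.refl _ U) h, B_refl hU, neg_neg]

/-- The force that produces the solution with Fourier transform `F`. -/
def force (α : ℝ) (F : Plane → ℂ) (ξ : Plane) : ℂ := ((w ξ ^ (2 * α) : ℝ) : ℂ) * F ξ + B F F ξ

/-- Any such profile is an exact solution for the force obtained by inserting it into the equation.
Vanishing near the origin hides the singularities of the symbols; `B F F` may be nonzero there but
is still smooth, so the force is Schwartz. -/
lemma SmoothAway.exists_schwartz (hα0 : 0 < α) (hα1 : α < 1 / 2) (hF : SmoothAway F)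
    (hH : Herm F) : ∃ (f : 𝓢(Plane, ℂ)) (θ : Dist),
      IsFunction (𝓕 (ofSchwartz f)) (force α F) ∧ IsReal (ofSchwartz f) ∧
        IsFunction (𝓕 θ) F ∧ IsSolution α (ofSchwartz f) θ := by
  have hs : ContDiff ℝ ((⊤ : ℕ∞) : WithTop ℕ∞) (force α F) :=
    (hF.laplace (2 * α)).smooth.add (hF.contDiff_B hF)
  have hc : HasCompactSupport (force α F) := (hF.laplace (2 * α)).cpt.add (hF.hasCompactSupport_B hF)
  let f : 𝓢(Plane, ℂ) := 𝓕⁻ (hc.toSchwartzMap hs)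
  have hf : IsFunction (𝓕 (ofSchwartz f)) (force α F) := by
    rw [fourier_ofSchwartz, FourierTransform.fourier_fourierInv_eq]
    exact isFunction_ofSchwartz _
  have hreal : IsReal (ofSchwartz f) := by
    refine (isReal_iff_herm hf).2 ?_
    filter_upwards [hH] with ξ h
    rw [force, force, hH.B_neg hH, w_neg, h, map_add, map_mul, Complex.conj_ofReal]
  obtain ⟨θ, hθ, hsol⟩ := isSolution_of_solves hα0 hα1 (hF.adm hα0 hα1) hH hf
    (ae_of_all _ fun ξ => rfl)
  exact ⟨f, θ, hf, hreal, hθ, hsol⟩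

end Smooth

/-! ### Functions localized near multiples of a large frequency. -/

/-- The unit vector of the first axis. -/
def e₁ : Plane := EuclideanSpace.single 0 1

@[simp] lemma norm_e₁ : ‖e₁‖ = 1 := by simp [e₁]

/-- The union of the balls of radius `R` about the multiples `k N e₁` with `|k| ≤ m`. -/
def region (N : ℝ) (m : ℕ) (R : ℝ) : Set Plane :=
  ⋃ k ∈ Finset.Icc (-m : ℤ) m, Metric.closedBall ((k * N : ℝ) • e₁) R

lemma mem_region {N : ℝ} {m : ℕ} {R : ℝ} {ξ : Plane} :
    ξ ∈ region N m R ↔ ∃ k : ℤ, |k| ≤ m ∧ ‖ξ - (k * N : ℝ) • e₁‖ ≤ R := by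
  simp [region, abs_le, dist_eq_norm, and_assoc]

lemma measurableSet_region (N : ℝ) (m : ℕ) (R : ℝ) : MeasurableSet (region N m R) :=
  Finset.measurableSet_biUnion _ fun _ _ => Metric.isClosed_closedBall.measurableSet

/-- A bound for the volume of `region N m R`. -/
def regionVol (m : ℕ) (R : ℝ) : ℝ :=
  (Finset.Icc (-m : ℤ) m).card * (volume (Metric.closedBall (0 : Plane) R)).toReal

lemma regionVol_nonneg (m : ℕ) (R : ℝ) : 0 ≤ regionVol m R := by unfold regionVol; positivity

lemma volume_region_le (N : ℝ) (m : ℕ) (R : ℝ) :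
    volume (region N m R) ≤ ENNReal.ofReal (regionVol m R) := by
  refine (measure_biUnion_finset_le _ _).trans (le_of_eq ?_)
  simp only [Measure.addHaar_closedBall_center]
  rw [Finset.sum_const, nsmul_eq_mul, regionVol, ENNReal.ofReal_mul (by positivity),
    ENNReal.ofReal_toReal measure_closedBall_lt_top.ne, ENNReal.ofReal_natCast]

lemma norm_le_of_mem_region {N : ℝ} (hN : 0 ≤ N) {m : ℕ} {R : ℝ} {ξ : Plane}
    (h : ξ ∈ region N m R) : ‖ξ‖ ≤ m * N + R := by
  obtain ⟨k, hk, h⟩ := mem_region.1 h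
  have h1 : ‖ξ‖ ≤ ‖ξ - (k * N : ℝ) • e₁‖ + ‖(k * N : ℝ) • e₁‖ := norm_le_norm_sub_add _ _
  have h2 : ‖(k * N : ℝ) • e₁‖ ≤ m * N := by
    rw [norm_smul, norm_e₁, mul_one, Real.norm_eq_abs, abs_mul, abs_of_nonneg hN]
    gcongr
    exact_mod_cast hk
  linarith

/-- `F` is bounded by `M` and supported in `region N m R`. -/
structure Loc (N : ℝ) (m : ℕ) (R M : ℝ) (F : Plane → ℂ) : Prop where
  bound : ∀ ξ, ‖F ξ‖ ≤ M
  supp : ∀ ξ, F ξ ≠ 0 → ξ ∈ region N m R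

variable {N R R' M M' : ℝ} {m m' : ℕ} {U F G : Plane → ℂ}

lemma Loc.nonneg (hF : Loc N m R M F) : 0 ≤ M := (norm_nonneg _).trans (hF.bound 0)

lemma region_mono (hm : m ≤ m') (hR : R ≤ R') : region N m R ⊆ region N m' R' := by
  intro ξ h
  obtain ⟨k, hk, h⟩ := mem_region.1 h
  exact mem_region.2 ⟨k, hk.trans (by exact_mod_cast hm), h.trans hR⟩

lemma Loc.mono (hF : Loc N m R M F) (hm : m ≤ m') (hR : R ≤ R') (hM : M ≤ M') :
    Loc N m' R' M' F :=
  ⟨fun ξ => (hF.bound ξ).trans hM, fun ξ h => region_mono hm hR (hF.supp ξ h)⟩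

lemma Loc.add (hF : Loc N m R M F) (hG : Loc N m R M' G) :
    Loc N m R (M + M') (fun ξ => F ξ + G ξ) := by
  refine ⟨fun ξ => (norm_add_le _ _).trans (add_le_add (hF.bound ξ) (hG.bound ξ)), fun ξ h => ?_⟩
  by_cases h0 : F ξ = 0
  · exact hG.supp ξ fun h1 => h (by rw [h0, h1, add_zero])
  · exact hF.supp ξ h0

lemma Loc.weight (hN : 0 ≤ N) (hR : 0 ≤ R) {s : ℝ} (hs : 0 ≤ s) (hF : Loc N m R M F) (ξ : Plane) :
    ‖((w ξ ^ s : ℝ) : ℂ) * F ξ‖ ≤ (2 * Real.pi * (m * N + R)) ^ s * M := by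
  by_cases h : F ξ = 0
  swap
  · have h1 := norm_le_of_mem_region hN (hF.supp ξ h)
    have h0 := w_nonneg ξ
    rw [norm_mul, Complex.norm_real, Real.norm_eq_abs, abs_of_nonneg (by positivity)]
    have h2 : w ξ ≤ 2 * Real.pi * (m * N + R) := by unfold w; gcongr
    exact mul_le_mul (Real.rpow_le_rpow h0 h2 hs) (hF.bound ξ) (norm_nonneg _)
      (Real.rpow_nonneg (h0.trans h2) _)
  · rw [h, mul_zero, norm_zero]
    have := hF.nonneg
    positivity

/-- Frequencies add under convolution, so centres and radii add. The derivative costs a power of the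
frequency of F alone, which keeps the bound small when F has low frequency. -/
lemma Loc.B (hN : 0 ≤ N) (hR' : 0 ≤ R') (hU : Loc N m R M U) (hF : Loc N m' R' M' F) :
    Loc N (m + m') (R + R') (regionVol m R * (M * (2 * Real.pi * (m' * N + R') * M')))
      (B U F) := by
  have hM := hU.nonneg
  have hM' := hF.nonneg
  refine ⟨fun ξ => ?_, fun ξ h => ?_⟩
  · have e : QG.B U F ξ = ∫ a in region N m R, (kerR a (ξ - a) : ℂ) * U a * F (ξ - a) := by
      refine (setIntegral_eq_integral_of_forall_compl_eq_zero fun a ha => ?_).symm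
      rw [show U a = 0 by by_contra h; exact ha (hU.supp a h)]
      ring
    rw [e]
    have hv := volume_region_le N m R
    refine (norm_setIntegral_le_of_norm_le_const
      (C := M * (2 * Real.pi * (m' * N + R') * M')) (hv.trans_lt ENNReal.ofReal_lt_top)
      fun a _ => ?_).trans ?_
    · have h1 := hF.weight hN hR' zero_le_one (ξ - a)
      rw [Real.rpow_one, Real.rpow_one, norm_mul, Complex.norm_real, Real.norm_eq_abs,
        abs_of_nonneg (w_nonneg _)] at h1
      rw [norm_mul, norm_mul, Complex.norm_real, Real.norm_eq_abs]
      calc _ ≤ w (ξ - a) * ‖U a‖ * ‖F (ξ - a)‖ := by gcongr; exact abs_kerR_le _ _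
        _ = ‖U a‖ * (w (ξ - a) * ‖F (ξ - a)‖) := by ring
        _ ≤ _ := mul_le_mul (hU.bound a) h1 (mul_nonneg (w_nonneg _) (norm_nonneg _)) hM
    · rw [mul_comm]
      gcongr
      exact ENNReal.toReal_le_of_le_ofReal (regionVol_nonneg m R) hv
  · obtain ⟨a, ha⟩ : ∃ a, (kerR a (ξ - a) : ℂ) * U a * F (ξ - a) ≠ 0 := by
      by_contra! h'
      exact h (by simp [QG.B, h'])
    obtain ⟨k, hk, h1⟩ := mem_region.1 (hU.supp a (by rintro h; simp [h] at ha))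
    obtain ⟨k', hk', h2⟩ := mem_region.1 (hF.supp (ξ - a) (by rintro h; simp [h] at ha))
    refine mem_region.2 ⟨k + k', ?_, ?_⟩
    · push_cast
      exact (abs_add_le _ _).trans (add_le_add hk hk')
    · have : ξ - ((k + k' : ℤ) * N : ℝ) • e₁ =
          (a - (k * N : ℝ) • e₁) + (ξ - a - (k' * N : ℝ) • e₁) := by
        push_cast; module
      rw [this]
      exact (norm_add_le _ _).trans (add_le_add h1 h2)

/-- The support has a volume bounded independently of N, so the L² norm is controlled by the sup
norm. -/
lemma Loc.nrm_le (hN : 0 ≤ N) {s : ℝ} (hs : 0 ≤ s) (hR : 0 ≤ R) (hF : Loc N m R M F) :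
    nrm s F ≤ ENNReal.ofReal (regionVol m R) ^ (1 / 2 : ℝ) *
      ENNReal.ofReal ((2 * Real.pi * (m * N + R)) ^ s * M) := by
  unfold nrm
  rw [← eLpNorm_restrict_eq_of_support_subset (s := region N m R)]
  · refine (eLpNorm_le_of_ae_bound (ae_of_all _ (hF.weight hN hR hs))).trans ?_
    rw [Measure.restrict_apply_univ]
    simp only [ENNReal.toReal_ofNat, one_div]
    gcongr
    exact volume_region_le N m R
  · intro ξ h
    exact hF.supp ξ (right_ne_zero_of_mul h)

/-- The weight `w ^ (-α)` is at most one where w ≥ 1; where w ≤ 1 it equals `wt (1 - α) w 1`, whose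
square is integrable. -/
lemma Loc.nrm_neg_le {α : ℝ} (hα0 : 0 < α) (hα1 : α < 1 / 2) (hF : Loc N m R M F) :
    nrm (-α) F ^ 2 ≤ ENNReal.ofReal M ^ 2 *
      (ENNReal.ofReal (wtConst (1 - α)) + ENNReal.ofReal (regionVol m R)) := by
  rw [nrm_sq]
  have key : ∀ ξ, mag (-α) F ξ ^ 2 ≤ ENNReal.ofReal M ^ 2 *
      (ENNReal.ofReal (wt (1 - α) (w ξ) 1) ^ 2 + (region N m R).indicator 1 ξ) := by
    intro ξ
    by_cases h : F ξ = 0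
    · simp [mag, h]
    have h1 : ‖F ξ‖ₑ ≤ ENNReal.ofReal M := by
      rw [← ofReal_norm]; exact ENNReal.ofReal_le_ofReal (hF.bound ξ)
    rw [mag, mul_pow, mul_comm, Set.indicator_of_mem (hF.supp ξ h)]
    gcongr
    by_cases hw : w ξ ≤ 1
    · refine le_add_right (le_of_eq ?_)
      rw [wt, if_pos hw, Real.one_rpow, mul_one]
      congr 3; ring
    · refine le_add_left ?_
      have : ENNReal.ofReal (w ξ ^ (-α)) ≤ 1 := by
        rw [← ENNReal.ofReal_one]
        exact ENNReal.ofReal_le_ofReal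
          (Real.rpow_le_one_of_one_le_of_nonpos (not_le.1 hw).le (by linarith))
      simpa using pow_le_pow_left' this 2
  refine (lintegral_mono key).trans ?_
  rw [lintegral_const_mul' _ _ (by simp), lintegral_add_right _
    (measurable_one.indicator (measurableSet_region N m R)),
    lintegral_indicator_one (measurableSet_region N m R)]
  gcongr
  · exact lintegral_wt_sq_le (by linarith) zero_le_one
  · exact volume_region_le N m R

/-! ### The low-frequency perturbation, the wave and the response. -/

/-- The unit vector of the second axis. -/
def e₂ : Plane := EuclideanSpace.single 1 1

@[simp] lemma norm_e₂ : ‖e₂‖ = 1 := by simp [e₂]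

/-- A bump function supported in the unit ball. -/
def smallBump : ContDiffBump (0 : Plane) := ⟨1 / 2, 1, by norm_num, by norm_num⟩

/-- A bump function that equals `1` on the ball of radius `4`. -/
def bigBump : ContDiffBump (0 : Plane) := ⟨4, 5, by norm_num, by norm_num⟩

lemma norm_lt_of_smallBump {x : Plane} (h : smallBump x ≠ 0) : ‖x‖ < 1 := by
  by_contra! h'
  exact h (smallBump.zero_of_le_dist (by rwa [dist_zero_right]))

lemma norm_lt_of_bigBump {x : Plane} (h : bigBump x ≠ 0) : ‖x‖ < 5 := by
  by_contra! h'
  exact h (bigBump.zero_of_le_dist (by rwa [dist_zero_right]))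

lemma bigBump_eq_one {x : Plane} (h : ‖x‖ ≤ 4) : bigBump x = 1 :=
  bigBump.one_of_mem_closedBall (by rwa [mem_closedBall_zero_iff])

/-- The odd profile of the low-frequency perturbation. -/
def oddBump (a : Plane) : ℝ := smallBump (a - (2 : ℝ) • e₂) - smallBump (a + (2 : ℝ) • e₂)

/-- The even profile of the high-frequency wave. -/
def evenBump (N : ℝ) (ξ : Plane) : ℝ := bigBump (ξ - N • e₁) + bigBump (ξ + N • e₁)

/-- The low-frequency perturbation of size `N^{2α-1}`. -/
def lowPart (α N : ℝ) (a : Plane) : ℂ := Complex.I * ((N ^ (2 * α - 1) * oddBump a : ℝ) : ℂ)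

/-- The high-frequency wave. -/
def highPart (α κ N : ℝ) (ξ : Plane) : ℂ := ((κ * N ^ (-2 + 2 * α) * evenBump N ξ : ℝ) : ℂ)

/-- The first-order response of the high-frequency wave to the low-frequency perturbation. -/
def response (α κ N : ℝ) (ξ : Plane) : ℂ :=
  ((w ξ ^ (-(2 * α)) : ℝ) : ℂ) * B (lowPart α N) (highPart α κ N) ξ

variable {α κ N : ℝ}

lemma oddBump_neg (a : Plane) : oddBump (-a) = -oddBump a := by
  unfold oddBump
  rw [show -a - (2 : ℝ) • e₂ = -(a + (2 : ℝ) • e₂) by module,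
    show -a + (2 : ℝ) • e₂ = -(a - (2 : ℝ) • e₂) by module, smallBump.neg, smallBump.neg]
  ring

lemma evenBump_neg (N : ℝ) (a : Plane) : evenBump N (-a) = evenBump N a := by
  unfold evenBump
  rw [show -a - N • e₁ = -(a + N • e₁) by module,
    show -a + N • e₁ = -(a - N • e₁) by module, bigBump.neg, bigBump.neg]
  ring

/-- The factor i makes the odd real profile Hermitian. -/
lemma lowPart_neg (ξ : Plane) : lowPart α N (-ξ) = starRingEnd ℂ (lowPart α N ξ) := by
  simp [lowPart, oddBump_neg]

lemma highPart_neg (ξ : Plane) : highPart α κ N (-ξ) = starRingEnd ℂ (highPart α κ N ξ) := by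
  rw [highPart, highPart, evenBump_neg, Complex.conj_ofReal]

lemma herm_lowPart : Herm (lowPart α N) := ae_of_all _ lowPart_neg

lemma herm_highPart : Herm (highPart α κ N) := ae_of_all _ highPart_neg

lemma herm_response : Herm (response α κ N) := by
  refine ae_of_all _ fun ξ => ?_
  rw [response, response, herm_lowPart.B_neg herm_highPart, w_neg, map_mul, Complex.conj_ofReal]

lemma Herm.add {F G : Plane → ℂ} (hF : Herm F) (hG : Herm G) : Herm (fun ξ => F ξ + G ξ) := by
  filter_upwards [hF, hG] with ξ h1 h2
  rw [h1, h2, map_add]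

lemma norm_bounds_of_oddBump {a : Plane} (h : oddBump a ≠ 0) : 1 < ‖a‖ ∧ ‖a‖ < 3 := by
  have e : ‖(2 : ℝ) • e₂‖ = 2 := by rw [norm_smul, norm_e₂]; norm_num
  by_cases h1 : smallBump (a - (2 : ℝ) • e₂) = 0
  · have h2 : smallBump (a + (2 : ℝ) • e₂) ≠ 0 := fun h2 => h (by rw [oddBump, h1, h2, sub_zero])
    have h3 := norm_lt_of_smallBump h2
    have h4 := norm_le_add_norm_add a ((2 : ℝ) • e₂)
    have h5 := norm_sub_le (a + (2 : ℝ) • e₂) a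
    rw [add_sub_cancel_left] at h5
    constructor <;> linarith
  · have h3 := norm_lt_of_smallBump h1
    have h4 := norm_sub_norm_le a ((2 : ℝ) • e₂)
    have h5 := norm_sub_norm_le ((2 : ℝ) • e₂) a
    rw [norm_sub_rev] at h5
    constructor <;> linarith

lemma of_evenBump {ξ : Plane} (h : evenBump N ξ ≠ 0) :
    ‖ξ - N • e₁‖ < 5 ∨ ‖ξ + N • e₁‖ < 5 := by
  by_cases h1 : bigBump (ξ - N • e₁) = 0
  · exact Or.inr (norm_lt_of_bigBump fun h2 => h (by rw [evenBump, h1, h2, add_zero]))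
  · exact Or.inl (norm_lt_of_bigBump h1)

lemma norm_smul_e₁ (hN : 0 ≤ N) : ‖N • e₁‖ = N := by
  rw [norm_smul, norm_e₁, mul_one, Real.norm_eq_abs, abs_of_nonneg hN]

lemma lt_norm_of_evenBump (hN : 0 ≤ N) {ξ : Plane} (h : evenBump N ξ ≠ 0) : N - 5 < ‖ξ‖ := by
  have e := norm_smul_e₁ hN
  rcases of_evenBump h with h | h
  · have := norm_sub_norm_le (N • e₁) ξ
    rw [norm_sub_rev] at this; linarith
  · have := norm_sub_le (ξ + N • e₁) ξ
    rw [add_sub_cancel_left] at this; linarith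

lemma abs_oddBump_le (a : Plane) : |oddBump a| ≤ 1 := by
  unfold oddBump
  rw [abs_le]
  constructor <;> linarith [smallBump.nonneg' (a - (2 : ℝ) • e₂),
    smallBump.nonneg' (a + (2 : ℝ) • e₂), smallBump.le_one (x := a - (2 : ℝ) • e₂),
    smallBump.le_one (x := a + (2 : ℝ) • e₂)]

lemma abs_evenBump_le (N : ℝ) (ξ : Plane) : |evenBump N ξ| ≤ 2 := by
  unfold evenBump
  rw [abs_le]
  constructor <;> linarith [bigBump.nonneg' (ξ - N • e₁), bigBump.nonneg' (ξ + N • e₁),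
    bigBump.le_one (x := ξ - N • e₁), bigBump.le_one (x := ξ + N • e₁)]

lemma loc_lowPart (hN : 0 ≤ N) : Loc N 0 3 (N ^ (2 * α - 1)) (lowPart α N) := by
  refine ⟨fun ξ => ?_, fun ξ h => ?_⟩
  · rw [lowPart, norm_mul, Complex.norm_I, one_mul, Complex.norm_real, Real.norm_eq_abs, abs_mul,
      abs_of_nonneg (by positivity)]
    exact mul_le_of_le_one_right (by positivity) (abs_oddBump_le ξ)
  · have := norm_bounds_of_oddBump (a := ξ) (by rintro h'; simp [lowPart, h'] at h)
    exact mem_region.2 ⟨0, by simp, by simpa using this.2.le⟩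

lemma loc_highPart (hκ : 0 ≤ κ) (hN : 0 ≤ N) :
    Loc N 1 5 (2 * (κ * N ^ (-2 + 2 * α))) (highPart α κ N) := by
  refine ⟨fun ξ => ?_, fun ξ h => ?_⟩
  · rw [highPart, Complex.norm_real, Real.norm_eq_abs, abs_mul, abs_of_nonneg (by positivity),
      mul_comm]
    gcongr
    exact abs_evenBump_le N ξ
  · rcases of_evenBump (ξ := ξ) (N := N) (by rintro h'; simp [highPart, h'] at h) with h | h
    · exact mem_region.2 ⟨1, by simp, by simpa using h.le⟩
    · exact mem_region.2 ⟨-1, by simp, by simpa using h.le⟩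

lemma eventuallyEq_zero_of_norm {F : Plane → ℂ} {ρ : ℝ} (hρ : 0 < ρ)
    (h : ∀ ξ, F ξ ≠ 0 → ρ ≤ ‖ξ‖) : F =ᶠ[𝓝 0] 0 := by
  filter_upwards [Metric.ball_mem_nhds 0 hρ] with ξ hξ
  by_contra h'
  have := h ξ h'
  rw [mem_ball_zero_iff] at hξ
  linarith

lemma Loc.hasCompactSupport {R M : ℝ} {m : ℕ} {F : Plane → ℂ} (hN : 0 ≤ N)
    (hF : Loc N m R M F) : HasCompactSupport F :=
  HasCompactSupport.intro (isCompact_closedBall (0 : Plane) (m * N + R)) fun ξ h => by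
    by_contra h'
    exact h (mem_closedBall_zero_iff.2 (norm_le_of_mem_region hN (hF.supp ξ h')))

lemma smoothAway_lowPart (hN : 0 ≤ N) : SmoothAway (lowPart α N) := by
  refine ⟨?_, (loc_lowPart hN).hasCompactSupport hN, eventuallyEq_zero_of_norm one_pos
    fun ξ h => (norm_bounds_of_oddBump (by rintro h'; simp [lowPart, h'] at h)).1.le⟩
  refine contDiff_const.mul (Complex.ofRealCLM.contDiff.comp (contDiff_const.mul ?_))
  exact (smallBump.contDiff.comp (contDiff_id.sub contDiff_const)).sub
    (smallBump.contDiff.comp (contDiff_id.add contDiff_const))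

lemma smoothAway_highPart (hκ : 0 ≤ κ) (hN : 20 ≤ N) : SmoothAway (highPart α κ N) := by
  have hN0 : 0 ≤ N := by linarith
  refine ⟨?_, (loc_highPart hκ hN0).hasCompactSupport hN0, eventuallyEq_zero_of_norm
    (ρ := N - 5) (by linarith)
    fun ξ h => (lt_norm_of_evenBump hN0 (by rintro h'; simp [highPart, h'] at h)).le⟩
  refine Complex.ofRealCLM.contDiff.comp (contDiff_const.mul ?_)
  exact (bigBump.contDiff.comp (contDiff_id.sub contDiff_const)).add
    (bigBump.contDiff.comp (contDiff_id.add contDiff_const))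

/-- Frequencies of the wave exceed N - 5, and those of the perturbation are below 3. -/
lemma lt_norm_of_B (hN : 0 ≤ N) {ξ : Plane} (h : B (lowPart α N) (highPart α κ N) ξ ≠ 0) :
    N - 8 < ‖ξ‖ := by
  obtain ⟨a, ha⟩ : ∃ a, (kerR a (ξ - a) : ℂ) * lowPart α N a * highPart α κ N (ξ - a) ≠ 0 := by
    by_contra! h'
    exact h (by simp [B, h'])
  have h1 := (norm_bounds_of_oddBump (a := a) (by rintro h'; simp [lowPart, h'] at ha)).2
  have h2 := lt_norm_of_evenBump (ξ := ξ - a) hN (by rintro h'; simp [highPart, h'] at ha)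
  have := norm_sub_le ξ a
  linarith

lemma smoothAway_response (hκ : 0 ≤ κ) (hN : 20 ≤ N) : SmoothAway (response α κ N) := by
  have hN0 : 0 ≤ N := by linarith
  have h1 := smoothAway_lowPart (α := α) hN0
  have h2 := smoothAway_highPart (α := α) hκ hN
  exact SmoothAway.laplace _ ⟨h1.contDiff_B h2, h1.hasCompactSupport_B h2,
    eventuallyEq_zero_of_norm (ρ := N - 8) (by linarith) fun ξ h => (lt_norm_of_B hN0 h).le⟩

lemma le_w {ξ : Plane} {t : ℝ} (ht : t ≤ 2 * ‖ξ‖) : t ≤ w ξ := by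
  unfold w
  have := norm_nonneg ξ
  nlinarith [Real.pi_gt_three]

/-- The constant in the bound of the response. -/
def responseConst : ℝ := regionVol 0 3 * (8 * Real.pi)

lemma responseConst_nonneg : 0 ≤ responseConst := by
  have := regionVol_nonneg 0 3
  unfold responseConst; positivity

/-- The inverse dissipation gives N^{-2α}, the perturbation N^{2α-1} and the derivative on the wave
N. These powers cancel, so the response is of the order of the wave although the perturbation tends
to zero. -/
lemma loc_response (hα0 : 0 < α) (hκ : 0 ≤ κ) (hN : 20 ≤ N) :
    Loc N 1 8 (responseConst * (κ * N ^ (-2 + 2 * α))) (response α κ N) := by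
  have hN0 : 0 < N := by linarith
  have hB := (loc_lowPart (α := α) hN0.le).B hN0.le (by norm_num) (loc_highPart (α := α) hκ hN0.le)
  refine ⟨fun ξ => ?_, fun ξ h => ?_⟩
  · by_cases h : B (lowPart α N) (highPart α κ N) ξ = 0
    · rw [response, h, mul_zero, norm_zero]
      have := responseConst_nonneg
      positivity
    have h1 := lt_norm_of_B hN0.le h
    -- N ≥ 20 ensures 2(N - 8) ≥ N.
    have h2 : N ≤ w ξ := le_w (by linarith)
    have h3 : w ξ ^ (-(2 * α)) ≤ N ^ (-(2 * α)) :=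
      Real.rpow_le_rpow_of_nonpos hN0 h2 (by linarith)
    have hw := w_nonneg ξ
    have hV := regionVol_nonneg 0 3
    rw [response, norm_mul, Complex.norm_real, Real.norm_eq_abs, abs_of_nonneg (by positivity)]
    calc _ ≤ N ^ (-(2 * α)) * (regionVol 0 3 * (N ^ (2 * α - 1) * (2 * Real.pi *
          ((1 : ℕ) * N + 5) * (2 * (κ * N ^ (-2 + 2 * α)))))) := by
          gcongr; exact hB.bound ξ
      _ ≤ N ^ (-(2 * α)) * (regionVol 0 3 * (N ^ (2 * α - 1) * (2 * Real.pi *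
          (N ^ (1 : ℝ) * 2) * (2 * (κ * N ^ (-2 + 2 * α)))))) := by
          gcongr
          rw [Real.rpow_one]; push_cast; linarith
      _ = responseConst * (κ * N ^ (-2 + 2 * α)) *
            (N ^ (-(2 * α)) * N ^ (2 * α - 1) * N ^ (1 : ℝ)) := by
          rw [responseConst]; ring
      _ = _ := by
          rw [← Real.rpow_add hN0, ← Real.rpow_add hN0]
          ring_nf
          simp
  · have := hB.supp ξ (right_ne_zero_of_mul h)
    exact region_mono (by norm_num) (by norm_num) this

lemma norm_coords_le (x : Plane) : |x 0| ≤ ‖x‖ ∧ |x 1| ≤ ‖x‖ :=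
  ⟨PiLp.norm_apply_le x 0, PiLp.norm_apply_le x 1⟩

/-- The kernel does not vanish for orthogonal directions. -/
lemma le_neg_kerR (hN : 4 ≤ N) {a ξ : Plane} (hξ : ‖ξ - N • e₁‖ ≤ 1)
    (ha : ‖a - (2 : ℝ) • e₂‖ < 1) : N ≤ -kerR a ξ := by
  have h1 := norm_coords_le (ξ - N • e₁)
  have h2 := norm_coords_le (a - (2 : ℝ) • e₂)
  simp only [e₁, e₂, PiLp.sub_apply, PiLp.smul_apply, PiLp.single_apply, smul_eq_mul]
    at h1 h2
  simp at h1 h2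
  have h3 := abs_le.1 (h1.1.trans (by simpa [e₁] using hξ))
  have h4 := abs_le.1 (h1.2.trans (by simpa [e₁] using hξ))
  have h5 := abs_lt.1 (h2.1.trans_lt (by simpa [e₂] using ha))
  have h6 := abs_lt.1 (h2.2.trans_lt (by simpa [e₂] using ha))
  have e : ‖(2 : ℝ) • e₂‖ = 2 := by rw [norm_smul, norm_e₂]; norm_num
  have h7 := norm_sub_norm_le a ((2 : ℝ) • e₂)
  have h8 := norm_sub_norm_le ((2 : ℝ) • e₂) a
  rw [norm_sub_rev] at h8
  have hpos : 0 < ‖a‖ := by linarith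
  have h9 : N - 2 ≤ a 1 * ξ 0 - a 0 * ξ 1 := by
    have p1 : N - 1 ≤ a 1 * ξ 0 := by nlinarith
    have p2 : |a 0 * ξ 1| ≤ 1 := by
      rw [abs_mul]
      exact mul_le_one₀ (abs_le.2 ⟨by linarith, by linarith⟩) (abs_nonneg _)
        (abs_le.2 ⟨by linarith, by linarith⟩)
    have := (abs_le.1 p2).2
    linarith
  have h10 : -kerR a ξ = 2 * Real.pi * (a 1 * ξ 0 - a 0 * ξ 1) / ‖a‖ := by
    rw [kerR]; ring
  rw [h10, le_div_iff₀ hpos]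
  have hpi := Real.pi_gt_three
  -- From 2π ≥ 6 and |a| < 3 the quotient is at least 2(N - 2), hence at least N for N ≥ 4.
  have : 6 * (N - 2) ≤ 2 * Real.pi * (a 1 * ξ 0 - a 0 * ξ 1) := by
    have : 0 ≤ N - 2 := by linarith
    nlinarith
  nlinarith

/-- The kernel and `oddBump` are both odd in a, so the two bumps contribute with the same sign and
cannot cancel; the contribution of one is dropped. -/
lemma le_kerR_mul_oddBump (hN : 4 ≤ N) {ξ : Plane} (hξ : ‖ξ - N • e₁‖ ≤ 1) (a : Plane) :
    N * smallBump (a - (2 : ℝ) • e₂) ≤ -kerR a ξ * oddBump a := by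
  have p1 : N * smallBump (a - (2 : ℝ) • e₂) ≤ -kerR a ξ * smallBump (a - (2 : ℝ) • e₂) := by
    by_cases h : smallBump (a - (2 : ℝ) • e₂) = 0
    · simp [h]
    · gcongr
      · exact smallBump.nonneg
      · exact le_neg_kerR hN hξ (norm_lt_of_smallBump h)
  have p2 : 0 ≤ kerR a ξ * smallBump (a + (2 : ℝ) • e₂) := by
    by_cases h : smallBump (a + (2 : ℝ) • e₂) = 0
    · simp [h]
    · refine mul_nonneg ?_ smallBump.nonneg
      have h1 := norm_lt_of_smallBump h
      have h2 := le_neg_kerR (a := -a) hN hξ (by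
        rwa [show -a - (2 : ℝ) • e₂ = -(a + (2 : ℝ) • e₂) by module, norm_neg])
      rw [kerR_neg_left] at h2
      linarith
  rw [oddBump]
  linarith

/-- The response is bounded below near `N e₁`. -/
lemma le_norm_B (hκ : 0 ≤ κ) (hN : 20 ≤ N) {ξ : Plane} (hξ : ‖ξ - N • e₁‖ ≤ 1) :
    N ^ (2 * α - 1) * (κ * N ^ (-2 + 2 * α)) * (N * ∫ a, smallBump a) ≤
      ‖B (lowPart α N) (highPart α κ N) ξ‖ := by
  have hN0 : 0 < N := by linarith
  have e : B (lowPart α N) (highPart α κ N) ξ = Complex.I *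
      ((-(N ^ (2 * α - 1) * (κ * N ^ (-2 + 2 * α))) * ∫ a, -kerR a ξ * oddBump a : ℝ) : ℂ) := by
    rw [← integral_const_mul, ← integral_complex_ofReal, ← integral_const_mul]
    unfold B
    congr 1; ext a
    by_cases h : oddBump a = 0
    · simp [lowPart, h]
    have h1 := (norm_bounds_of_oddBump h).2
    have h2 : evenBump N (ξ - a) = 1 := by
      -- The plateau of radius 4 covers |ξ - N e₁| ≤ 1 plus |a| < 3, so here the wave is constant in
      -- the integral.
      have h3 : bigBump (ξ - a - N • e₁) = 1 := bigBump_eq_one (by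
        rw [show ξ - a - N • e₁ = (ξ - N • e₁) - a by module]
        have := norm_sub_le (ξ - N • e₁) a
        linarith)
      have h4 : bigBump (ξ - a + N • e₁) = 0 := by
        by_contra h4
        have h5 := norm_lt_of_bigBump h4
        have h6 : ‖(2 * N) • e₁‖ ≤ ‖ξ - a + N • e₁‖ + ‖ξ - N • e₁ - a‖ := by
          rw [show (2 * N) • e₁ = (ξ - a + N • e₁) - (ξ - N • e₁ - a) by module]
          exact norm_sub_le _ _
        have h7 := norm_sub_le (ξ - N • e₁) a
        rw [norm_smul_e₁ (by linarith)] at h6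
        linarith
      rw [evenBump, h3, h4, add_zero]
    rw [kerR_sub_self, lowPart, highPart, h2]
    push_cast
    ring
  have hint : ∫ a, smallBump (a - (2 : ℝ) • e₂) = ∫ a, smallBump a :=
    integral_sub_right_eq_self (fun a => smallBump a) _
  have hkint : Integrable (fun a => -kerR a ξ * oddBump a) volume := by
    have hm : Measurable fun a => kerR a ξ := measurable_kerR.comp (measurable_id.prodMk measurable_const)
    have ho : Integrable oddBump volume :=
      (smallBump.integrable.comp_sub_right _).sub (smallBump.integrable.comp_add_right _)
    refine ho.bdd_mul (c := w ξ) hm.neg.aestronglyMeasurable (ae_of_all _ fun a => ?_)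
    rw [norm_neg, Real.norm_eq_abs]
    exact abs_kerR_le a ξ
  have hI : N * ∫ a, smallBump a ≤ ∫ a, -kerR a ξ * oddBump a := by
    rw [← hint, ← integral_const_mul]
    exact integral_mono ((smallBump.integrable.comp_sub_right _).const_mul N) hkint
      (le_kerR_mul_oddBump (by linarith) hξ)
  rw [e, norm_mul, Complex.norm_I, one_mul, Complex.norm_real, Real.norm_eq_abs, abs_mul, abs_neg,
    abs_of_nonneg (by positivity)]
  gcongr
  exact hI.trans (le_abs_self _)

/-! ### Decay of norms from sup bounds and localization. -/

section Limits

variable {α κ N : ℝ}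

lemma tendsto_nrm_of_loc {m : ℕ} {R s : ℝ} {M : ℕ → ℝ} {F : ℕ → Plane → ℂ} (hR : 0 ≤ R)
    (hs : 0 ≤ s) (hF : ∀ᶠ n : ℕ in atTop, Loc n m R (M n) (F n))
    (hM : Tendsto (fun n : ℕ => (2 * Real.pi * (m * n + R)) ^ s * M n) atTop (𝓝 0)) :
    Tendsto (fun n => nrm s (F n)) atTop (𝓝 0) := by
  have h1 : Tendsto (fun n : ℕ => ENNReal.ofReal (regionVol m R) ^ (1 / 2 : ℝ) *
      ENNReal.ofReal ((2 * Real.pi * (m * n + R)) ^ s * M n)) atTop (𝓝 0) := by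
    have := ENNReal.Tendsto.const_mul (a := ENNReal.ofReal (regionVol m R) ^ (1 / 2 : ℝ))
      (ENNReal.tendsto_ofReal hM) (Or.inr (by simp))
    simpa using this
  refine tendsto_of_tendsto_of_tendsto_of_le_of_le' tendsto_const_nhds h1
    (Eventually.of_forall fun _ => zero_le) ?_
  filter_upwards [hF] with n h
  exact h.nrm_le n.cast_nonneg hs hR

lemma tendsto_nrm_neg_of_loc (hα0 : 0 < α) (hα1 : α < 1 / 2) {m : ℕ} {R : ℝ} {M : ℕ → ℝ}
    {F : ℕ → Plane → ℂ} (hF : ∀ᶠ n : ℕ in atTop, Loc n m R (M n) (F n))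
    (hM : Tendsto M atTop (𝓝 0)) : Tendsto (fun n => nrm (-α) (F n)) atTop (𝓝 0) := by
  have h1 : Tendsto (fun n : ℕ => (ENNReal.ofReal (M n) ^ 2 *
      (ENNReal.ofReal (wtConst (1 - α)) + ENNReal.ofReal (regionVol m R))) ^ (1 / 2 : ℝ))
      atTop (𝓝 0) := by
    have h2 : Tendsto (fun n : ℕ => ENNReal.ofReal (M n) ^ 2) atTop (𝓝 0) := by
      simpa using (ENNReal.tendsto_ofReal hM).ennrpow_const 2
    have h3 := ENNReal.Tendsto.mul_const
      (b := ENNReal.ofReal (wtConst (1 - α)) + ENNReal.ofReal (regionVol m R)) h2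
      (Or.inr (by simp))
    have h4 := h3.ennrpow_const (1 / 2)
    simpa using h4
  refine tendsto_of_tendsto_of_tendsto_of_le_of_le' tendsto_const_nhds h1
    (Eventually.of_forall fun _ => zero_le) ?_
  filter_upwards [hF] with n h
  have h2 := h.nrm_neg_le hα0 hα1
  have h3 := ENNReal.rpow_le_rpow h2 (by norm_num : (0 : ℝ) ≤ 1 / 2)
  rwa [← ENNReal.rpow_natCast, ← ENNReal.rpow_mul, Nat.cast_ofNat,
    mul_one_div_cancel (two_ne_zero), ENNReal.rpow_one] at h3

lemma tendsto_const_mul_rpow {p : ℝ} (hp : p < 0) (C : ℝ) :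
    Tendsto (fun n : ℕ => C * (n : ℝ) ^ p) atTop (𝓝 0) := by
  have h := (tendsto_rpow_neg_atTop (y := -p) (by linarith)).comp tendsto_natCast_atTop_atTop
  simpa using h.const_mul C

/-- Functions at bounded frequency whose sup norms tend to zero. -/
lemma tendsto_nrm_low (hα0 : 0 < α) (hα1 : α < 1 / 2) {R s p C : ℝ} {F : ℕ → Plane → ℂ}
    (hR : 0 ≤ R) (hs : 0 ≤ s) (hp : p < 0)
    (hF : ∀ᶠ n : ℕ in atTop, Loc n 0 R (C * (n : ℝ) ^ p) (F n)) :
    Tendsto (fun n => nrm s (F n)) atTop (𝓝 0) ∧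
      Tendsto (fun n => nrm (-α) (F n)) atTop (𝓝 0) := by
  refine ⟨tendsto_nrm_of_loc hR hs hF ?_,
    tendsto_nrm_neg_of_loc hα0 hα1 hF (tendsto_const_mul_rpow hp C)⟩
  simpa [mul_assoc] using tendsto_const_mul_rpow hp ((2 * Real.pi * R) ^ s * C)

/-- Functions at frequency `O(n)` whose sup norms are `o(n^{-s})`. -/
lemma tendsto_nrm_high (hα0 : 0 < α) (hα1 : α < 1 / 2) {m : ℕ} {R s p C : ℝ}
    {F : ℕ → Plane → ℂ} (hC : 0 ≤ C) (hR : 0 ≤ R) (hs : 0 ≤ s) (hps : p + s < 0)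
    (hF : ∀ᶠ n : ℕ in atTop, Loc n m R (C * (n : ℝ) ^ p) (F n)) :
    Tendsto (fun n => nrm s (F n)) atTop (𝓝 0) ∧
      Tendsto (fun n => nrm (-α) (F n)) atTop (𝓝 0) := by
  refine ⟨tendsto_nrm_of_loc hR hs hF ?_,
    tendsto_nrm_neg_of_loc hα0 hα1 hF (tendsto_const_mul_rpow (by linarith) C)⟩
  refine tendsto_of_tendsto_of_tendsto_of_le_of_le' tendsto_const_nhds
    (tendsto_const_mul_rpow hps ((2 * Real.pi * (m + R)) ^ s * C))
    (Eventually.of_forall fun n => by positivity) ?_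
  filter_upwards [eventually_ge_atTop 1] with n hn
  have hn1 : (1 : ℝ) ≤ n := by exact_mod_cast hn
  have h1 : (2 * Real.pi * (m * n + R)) ^ s ≤ (2 * Real.pi * (m + R)) ^ s * (n : ℝ) ^ s := by
    rw [← Real.mul_rpow (by positivity) (by positivity)]
    refine Real.rpow_le_rpow (by positivity) ?_ hs
    rw [mul_assoc (2 * Real.pi)]
    gcongr
    nlinarith
  calc _ ≤ (2 * Real.pi * (m + R)) ^ s * (n : ℝ) ^ s * (C * (n : ℝ) ^ p) := by gcongr
    _ = (2 * Real.pi * (m + R)) ^ s * C * ((n : ℝ) ^ p * (n : ℝ) ^ s) := by ring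
    _ = _ := by rw [← Real.rpow_add (by linarith)]

lemma tendsto_nrm_sum {s : ℝ} {F G : ℕ → Plane → ℂ} (mF : ∀ᶠ n in atTop, Measurable (F n))
    (mG : ∀ᶠ n in atTop, Measurable (G n)) (hF : Tendsto (fun n => nrm s (F n)) atTop (𝓝 0))
    (hG : Tendsto (fun n => nrm s (G n)) atTop (𝓝 0)) :
    Tendsto (fun n => nrm s (F n + G n)) atTop (𝓝 0) := by
  have h := hF.add hG
  rw [add_zero] at h
  refine tendsto_of_tendsto_of_tendsto_of_le_of_le' tendsto_const_nhds h
    (Eventually.of_forall fun _ => zero_le) ?_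
  filter_upwards [mF, mG] with n h1 h2
  exact nrm_add_le h1 h2

lemma tendsto_nrm_diff {s : ℝ} {F G : ℕ → Plane → ℂ} (mF : ∀ᶠ n in atTop, Measurable (F n))
    (mG : ∀ᶠ n in atTop, Measurable (G n)) (hF : Tendsto (fun n => nrm s (F n)) atTop (𝓝 0))
    (hG : Tendsto (fun n => nrm s (G n)) atTop (𝓝 0)) :
    Tendsto (fun n => nrm s (F n - G n)) atTop (𝓝 0) := by
  have h := hF.add hG
  rw [add_zero] at h
  refine tendsto_of_tendsto_of_tendsto_of_le_of_le' tendsto_const_nhds h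
    (Eventually.of_forall fun _ => zero_le) ?_
  filter_upwards [mF, mG] with n h1 h2
  exact nrm_sub_le h1 h2

end Limits

/-! ### The two profiles: difference of forces and separation. -/

section Waves

variable {α κ N : ℝ}

/-- The Fourier transform of the perturbed wave. -/
def waveL (α κ N : ℝ) (ξ : Plane) : ℂ := lowPart α N ξ + highPart α κ N ξ

/-- The Fourier transform of the wave corrected by the response. -/
def waveR (α κ N : ℝ) (ξ : Plane) : ℂ := highPart α κ N ξ + response α κ N ξ

lemma smoothAway_waveL (hκ : 0 ≤ κ) (hN : 20 ≤ N) : SmoothAway (waveL α κ N) :=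
  (smoothAway_lowPart (by linarith)).add (smoothAway_highPart hκ hN)

lemma smoothAway_waveR (hκ : 0 ≤ κ) (hN : 20 ≤ N) : SmoothAway (waveR α κ N) :=
  (smoothAway_highPart hκ hN).add (smoothAway_response hκ hN)

lemma herm_waveL : Herm (waveL α κ N) := herm_lowPart.add herm_highPart

lemma herm_waveR : Herm (waveR α κ N) := herm_highPart.add herm_response

lemma loc_waveR (hα0 : 0 < α) (hκ : 0 ≤ κ) (hN : 20 ≤ N) :
    Loc N 1 8 ((2 + responseConst) * (κ * N ^ (-2 + 2 * α))) (waveR α κ N) := by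
  have h := ((loc_highPart (α := α) hκ (by linarith)).mono le_rfl (by norm_num) le_rfl).add
    (loc_response hα0 hκ hN)
  rwa [← add_mul] at h

/-- The dissipation of the response equals B(low, high), the one interaction that does not tend to
zero in Ḣ^{2-4α}, and the dissipation of the wave is common to both forces; both drop out. -/
lemma force_sub_force (hκ : 0 ≤ κ) (hN : 20 ≤ N) (ξ : Plane) :
    force α (waveL α κ N) ξ - force α (waveR α κ N) ξ =
      ((w ξ ^ (2 * α) : ℝ) : ℂ) * lowPart α N ξ + B (lowPart α N) (lowPart α N) ξ +
        B (highPart α κ N) (lowPart α N) ξ + B (highPart α κ N) (highPart α κ N) ξ -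
        B (waveR α κ N) (waveR α κ N) ξ := by
  have hN0 : 0 ≤ N := by linarith
  have hl := smoothAway_lowPart (α := α) hN0
  have hh := smoothAway_highPart (α := α) hκ hN
  have e1 : B (waveL α κ N) (waveL α κ N) ξ =
      B (lowPart α N) (lowPart α N) ξ + B (lowPart α N) (highPart α κ N) ξ +
        (B (highPart α κ N) (lowPart α N) ξ + B (highPart α κ N) (highPart α κ N) ξ) := by
    rw [← hl.B_add_right hl hh, ← hh.B_add_right hl hh, ← hl.B_add_left hh (hl.add hh)]
    rfl
  have e2 : ((w ξ ^ (2 * α) : ℝ) : ℂ) * response α κ N ξ =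
      B (lowPart α N) (highPart α κ N) ξ := by
    -- The case distinction keeps ξ away from the origin, where the powers of `w ξ` would not
    -- cancel.
    by_cases h : B (lowPart α N) (highPart α κ N) ξ = 0
    · rw [response, h, mul_zero, mul_zero]
    have h1 := lt_norm_of_B hN0 h
    have h2 : 0 < w ξ := w_pos (norm_pos_iff.1 (by linarith))
    rw [response, ← mul_assoc, ← Complex.ofReal_mul, ← Real.rpow_add h2, add_neg_cancel,
      Real.rpow_zero, Complex.ofReal_one, one_mul]
  rw [force, force, e1, ← e2, waveL, waveR]
  ring

lemma nrm_weight_shift (s t : ℝ) (F : Plane → ℂ) :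
    nrm s (fun ξ => ((w ξ ^ t : ℝ) : ℂ) * F ξ) = nrm (s + t) F := by
  unfold nrm
  refine eLpNorm_congr_ae ?_
  filter_upwards [ae_ne_zero] with ξ h
  rw [← mul_assoc, ← Complex.ofReal_mul, ← Real.rpow_add (w_pos h)]

/-- Waves at frequency `N` of sup norm `O(N^{2α-2})` are bounded in `Ḣ^{2-2α}`. -/
lemma exists_nrm_wave_le (hα1 : α < 1 / 2) : ∃ K : ℝ, 0 ≤ K ∧ ∀ (κ N : ℝ) (F : Plane → ℂ),
    0 ≤ κ → 20 ≤ N → Loc N 1 8 ((2 + responseConst) * (κ * N ^ (-2 + 2 * α))) F →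
      nrm (2 - 2 * α) F ≤ ENNReal.ofReal (K * κ) := by
  have hV := regionVol_nonneg 1 8
  have hC := responseConst_nonneg
  refine ⟨regionVol 1 8 ^ (1 / 2 : ℝ) * ((4 * Real.pi) ^ (2 - 2 * α) * (2 + responseConst)),
    by positivity, fun κ N F hκ hN hF => ?_⟩
  have hN0 : 0 < N := by linarith
  refine (hF.nrm_le hN0.le (by linarith) (by norm_num)).trans ?_
  rw [ENNReal.ofReal_rpow_of_nonneg hV (by norm_num), ← ENNReal.ofReal_mul (by positivity)]
  apply ENNReal.ofReal_le_ofReal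
  calc _ ≤ regionVol 1 8 ^ (1 / 2 : ℝ) * ((4 * Real.pi * N) ^ (2 - 2 * α) *
        ((2 + responseConst) * (κ * N ^ (-2 + 2 * α)))) := by
        have : 2 * Real.pi * ((1 : ℕ) * N + 8) ≤ 4 * Real.pi * N := by
          push_cast; nlinarith [Real.pi_pos]
        gcongr
        linarith
    _ = regionVol 1 8 ^ (1 / 2 : ℝ) * ((4 * Real.pi) ^ (2 - 2 * α) * (2 + responseConst)) * κ *
        (N ^ (2 - 2 * α) * N ^ (-2 + 2 * α)) := by
        rw [Real.mul_rpow (by positivity) hN0.le]; ring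
    _ = _ := by
        rw [← Real.rpow_add hN0]
        ring_nf
        simp

/-- The two waves do not approach each other. -/
lemma exists_le_nrm_waveL_sub_waveR (hα0 : 0 < α) (hα1 : α < 1 / 2) (hκ : 0 < κ) :
    ∃ c : ℝ≥0∞, 0 < c ∧ ∀ N : ℝ, 20 ≤ N →
      c ≤ nrm (2 - 2 * α) (fun ξ => waveL α κ N ξ - waveR α κ N ξ) := by
  have hτ : 0 < ∫ a, smallBump a := smallBump.integral_pos
  set τ := ∫ a, smallBump a with hτdef
  refine ⟨ENNReal.ofReal (κ * τ) * volume (Metric.closedBall (0 : Plane) 1) ^ (1 / 2 : ℝ),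
    ?_, fun N hN => ?_⟩
  · refine ENNReal.mul_pos (by simpa using mul_pos hκ hτ) ?_
    have := (Metric.measure_closedBall_pos volume (0 : Plane) one_pos).ne'
    exact (ENNReal.rpow_pos (pos_iff_ne_zero.2 this) measure_closedBall_lt_top.ne).ne'
  have hN0 : 0 < N := by linarith
  -- It suffices to look at the unit ball about N e₁, whose volume does not depend on N. The
  -- perturbation vanishes there, and only the response is left.
  have e : eLpNorm ((Metric.closedBall (N • e₁) 1).indicator fun _ => κ * τ) 2 volume =
      ENNReal.ofReal (κ * τ) * volume (Metric.closedBall (0 : Plane) 1) ^ (1 / 2 : ℝ) := by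
    rw [eLpNorm_indicator_const Metric.isClosed_closedBall.measurableSet (by norm_num)
      (by norm_num), Measure.addHaar_closedBall_center, Real.enorm_eq_ofReal (by positivity)]
    simp
  rw [← e]
  refine eLpNorm_mono fun ξ => ?_
  by_cases hξ : ξ ∈ Metric.closedBall (N • e₁) 1
  swap; · rw [Set.indicator_of_notMem hξ, norm_zero]; exact norm_nonneg _
  rw [Set.indicator_of_mem hξ, Real.norm_eq_abs, abs_of_nonneg (by positivity)]
  rw [Metric.mem_closedBall, dist_eq_norm] at hξ
  have h1 : N - 1 ≤ ‖ξ‖ := by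
    have := norm_sub_norm_le (N • e₁) ξ
    rw [norm_smul_e₁ hN0.le, norm_sub_rev] at this; linarith
  have h2 : lowPart α N ξ = 0 := by
    by_contra h
    have := (norm_bounds_of_oddBump (a := ξ) (by rintro h'; simp [lowPart, h'] at h)).2
    linarith
  have hw : N ≤ w ξ := le_w (by linarith)
  have hw0 : 0 < w ξ := by linarith
  have hB := le_norm_B (α := α) hκ.le hN hξ
  have e3 : waveL α κ N ξ - waveR α κ N ξ = -response α κ N ξ := by
    rw [waveL, waveR, h2]; ring
  change _ ≤ ‖((w ξ ^ (2 - 2 * α) : ℝ) : ℂ) * (waveL α κ N ξ - waveR α κ N ξ)‖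
  rw [e3, response, mul_neg, norm_neg, ← mul_assoc, ← Complex.ofReal_mul, ← Real.rpow_add hw0,
    norm_mul, Complex.norm_real, Real.norm_eq_abs, abs_of_nonneg (by positivity)]
  calc κ * τ = N ^ (2 - 2 * α + -(2 * α)) *
        (N ^ (2 * α - 1) * (κ * N ^ (-2 + 2 * α)) * (N ^ (1 : ℝ) * τ)) := by
        have : N ^ (2 - 2 * α + -(2 * α)) * N ^ (2 * α - 1) * N ^ (-2 + 2 * α) * N ^ (1 : ℝ) = 1 := by
          rw [← Real.rpow_add hN0, ← Real.rpow_add hN0, ← Real.rpow_add hN0]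
          ring_nf
          simp
        linear_combination (-κ * τ) * this
    _ ≤ _ := by
        rw [Real.rpow_one]
        have : N ^ (2 - 2 * α + -(2 * α)) ≤ w ξ ^ (2 - 2 * α + -(2 * α)) :=
          Real.rpow_le_rpow hN0.le hw (by linarith)
        exact mul_le_mul this hB (by positivity) (by positivity)

end Waves

/-! ### Every remaining term in the difference of forces tends to zero. -/

section Sequences

variable {α κ : ℝ}

lemma eventually_ge_natCast (x : ℝ) : ∀ᶠ n : ℕ in atTop, x ≤ n :=
  tendsto_natCast_atTop_atTop.eventually_ge_atTop x

/-- Two amplitudes N^{2α-2} and one derivative give N^{-3+4α}, which beats the weight N^{2-4α} of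
the data norm by one power of N. -/
lemma loc_B_high {m : ℕ} {R C N : ℝ} {F : Plane → ℂ} (hN : 20 ≤ N) (hR : 0 ≤ R) (hR8 : R ≤ 8)
    (hC : 0 ≤ C) (hF : Loc N 1 R (C * N ^ (-2 + 2 * α)) F) (hm : m = 2) :
    Loc N m (R + R) ((regionVol 1 R * (C * (4 * Real.pi * C))) * N ^ (-3 + 4 * α)) (B F F) := by
  subst hm
  have hN0 : 0 < N := by linarith
  have hV := regionVol_nonneg 1 R
  refine (hF.B hN0.le hR hF).mono le_rfl le_rfl ?_
  calc _ ≤ regionVol 1 R * (C * N ^ (-2 + 2 * α) * (2 * Real.pi * (2 * N ^ (1 : ℝ)) *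
        (C * N ^ (-2 + 2 * α)))) := by
        gcongr
        rw [Real.rpow_one]; push_cast; linarith
    _ = (regionVol 1 R * (C * (4 * Real.pi * C))) *
        (N ^ (-2 + 2 * α) * N ^ (1 : ℝ) * N ^ (-2 + 2 * α)) := by ring
    _ = _ := by
        rw [← Real.rpow_add hN0, ← Real.rpow_add hN0]
        ring_nf

lemma tendsto_B_high (hα0 : 0 < α) (hα1 : α < 1 / 2) {R C : ℝ} {F : ℕ → Plane → ℂ}
    (hR : 0 ≤ R) (hR8 : R ≤ 8) (hC : 0 ≤ C)
    (hF : ∀ᶠ n : ℕ in atTop, Loc n 1 R (C * (n : ℝ) ^ (-2 + 2 * α)) (F n)) :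
    Tendsto (fun n => nrm (2 - 4 * α) (B (F n) (F n))) atTop (𝓝 0) ∧
      Tendsto (fun n => nrm (-α) (B (F n) (F n))) atTop (𝓝 0) := by
  have hV := regionVol_nonneg 1 R
  refine tendsto_nrm_high (m := 2) (R := R + R) (p := -3 + 4 * α)
    (C := regionVol 1 R * (C * (4 * Real.pi * C))) hα0 hα1 (by positivity)
    (by linarith) (by linarith) (by linarith) ?_
  filter_upwards [hF, eventually_ge_natCast 20] with n h hn
  exact loc_B_high hn hR hR8 hC h rfl

lemma tendsto_B_waveR (hα0 : 0 < α) (hα1 : α < 1 / 2) (hκ : 0 ≤ κ) :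
    Tendsto (fun n : ℕ => nrm (2 - 4 * α) (B (waveR α κ n) (waveR α κ n))) atTop (𝓝 0) ∧
      Tendsto (fun n : ℕ => nrm (-α) (B (waveR α κ n) (waveR α κ n))) atTop (𝓝 0) := by
  have := responseConst_nonneg
  refine tendsto_B_high (F := fun n : ℕ => waveR α κ n) (R := 8)
    (C := (2 + responseConst) * κ) hα0 hα1 (by norm_num) le_rfl (by positivity) ?_
  filter_upwards [eventually_ge_natCast 20] with n hn
  simpa only [mul_assoc] using loc_waveR hα0 hκ hn

lemma tendsto_B_highPart (hα0 : 0 < α) (hα1 : α < 1 / 2) (hκ : 0 ≤ κ) :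
    Tendsto (fun n : ℕ => nrm (2 - 4 * α) (B (highPart α κ n) (highPart α κ n))) atTop (𝓝 0) ∧
      Tendsto (fun n : ℕ => nrm (-α) (B (highPart α κ n) (highPart α κ n))) atTop (𝓝 0) := by
  refine tendsto_B_high (F := fun n : ℕ => highPart α κ n) (R := 5)
    (C := 2 * κ) hα0 hα1 (by norm_num) (by norm_num) (by positivity) ?_
  filter_upwards [eventually_ge_natCast 20] with n hn
  simpa only [mul_assoc] using loc_highPart hκ (by linarith)

/-- The derivative falls on the low frequency here, which saves a power of N compared with B(low,
high). -/
lemma tendsto_B_highPart_lowPart (hα0 : 0 < α) (hα1 : α < 1 / 2) (hκ : 0 ≤ κ) :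
    Tendsto (fun n : ℕ => nrm (2 - 4 * α) (B (highPart α κ n) (lowPart α n))) atTop (𝓝 0) ∧
      Tendsto (fun n : ℕ => nrm (-α) (B (highPart α κ n) (lowPart α n))) atTop (𝓝 0) := by
  have hV := regionVol_nonneg 1 5
  refine tendsto_nrm_high (m := 1) (R := 8) (p := -3 + 4 * α)
    (C := regionVol 1 5 * (2 * κ * (6 * Real.pi))) hα0 hα1 (by positivity)
    (by linarith) (by linarith) (by linarith) ?_
  filter_upwards [eventually_ge_natCast 20] with n hn
  have hn0 : (0 : ℝ) < n := by linarith
  refine ((loc_highPart (α := α) hκ hn0.le).B hn0.le (by norm_num) (loc_lowPart hn0.le)).mono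
    le_rfl (by norm_num) (le_of_eq ?_)
  have e : (n : ℝ) ^ (-3 + 4 * α) = (n : ℝ) ^ (-2 + 2 * α) * (n : ℝ) ^ (2 * α - 1) := by
    rw [← Real.rpow_add hn0]; ring_nf
  rw [e]
  push_cast
  ring

lemma tendsto_lowPart (hα0 : 0 < α) (hα1 : α < 1 / 2) {s : ℝ} (hs : 0 ≤ s) :
    Tendsto (fun n : ℕ => nrm s (lowPart α n)) atTop (𝓝 0) ∧
      Tendsto (fun n : ℕ => nrm (-α) (lowPart α n)) atTop (𝓝 0) := by
  refine tendsto_nrm_low (R := 3) (p := 2 * α - 1) (C := 1) hα0 hα1 (by norm_num) hs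
    (by linarith) (Eventually.of_forall fun n => ?_)
  rw [one_mul]
  exact loc_lowPart n.cast_nonneg

lemma tendsto_laplace_lowPart (hα0 : 0 < α) (hα1 : α < 1 / 2) :
    Tendsto (fun n : ℕ => nrm (2 - 4 * α)
        (fun ξ => ((w ξ ^ (2 * α) : ℝ) : ℂ) * lowPart α n ξ)) atTop (𝓝 0) ∧
      Tendsto (fun n : ℕ => nrm (-α)
        (fun ξ => ((w ξ ^ (2 * α) : ℝ) : ℂ) * lowPart α n ξ)) atTop (𝓝 0) := by
  simp only [nrm_weight_shift]
  exact ⟨(tendsto_lowPart hα0 hα1 (by linarith)).1, (tendsto_lowPart hα0 hα1 (by linarith)).1⟩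

lemma tendsto_B_lowPart (hα0 : 0 < α) (hα1 : α < 1 / 2) :
    Tendsto (fun n : ℕ => nrm (2 - 4 * α) (B (lowPart α n) (lowPart α n))) atTop (𝓝 0) ∧
      Tendsto (fun n : ℕ => nrm (-α) (B (lowPart α n) (lowPart α n))) atTop (𝓝 0) := by
  refine tendsto_nrm_low (R := 3 + 3) (p := (2 * α - 1) + (2 * α - 1))
    (C := regionVol 0 3 * (6 * Real.pi)) hα0 hα1
    (by norm_num) (by linarith) (by linarith) ?_
  filter_upwards [eventually_ge_natCast 20] with n hn
  have hn0 : (0 : ℝ) < n := by linarith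
  refine ((loc_lowPart (α := α) hn0.le).B hn0.le (by norm_num) (loc_lowPart hn0.le)).mono
    le_rfl le_rfl (le_of_eq ?_)
  rw [Real.rpow_add hn0]
  push_cast
  ring

/-- The forces of the two waves approach each other. -/
lemma tendsto_force_sub_force (hα0 : 0 < α) (hα1 : α < 1 / 2) (hκ : 0 ≤ κ) :
    Tendsto (fun n : ℕ => nrm (2 - 4 * α)
        (fun ξ => force α (waveL α κ n) ξ - force α (waveR α κ n) ξ)) atTop (𝓝 0) ∧
      Tendsto (fun n : ℕ => nrm (-α)
        (fun ξ => force α (waveL α κ n) ξ - force α (waveR α κ n) ξ)) atTop (𝓝 0) := by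
  have ml : ∀ᶠ n : ℕ in atTop, Measurable (lowPart α n) := Eventually.of_forall fun n =>
    (smoothAway_lowPart n.cast_nonneg).smooth.continuous.measurable
  have mh : ∀ᶠ n : ℕ in atTop, Measurable (highPart α κ n) := by
    filter_upwards [eventually_ge_natCast 20] with n hn
    exact (smoothAway_highPart hκ hn).smooth.continuous.measurable
  have mr : ∀ᶠ n : ℕ in atTop, Measurable (waveR α κ n) := by
    filter_upwards [eventually_ge_natCast 20] with n hn
    exact (smoothAway_waveR hκ hn).smooth.continuous.measurable
  have m1 : ∀ᶠ n : ℕ in atTop,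
      Measurable fun ξ => ((w ξ ^ (2 * α) : ℝ) : ℂ) * lowPart α n ξ :=
    ml.mono fun n h => measurable_weight_mul h
  have m2 : ∀ᶠ n : ℕ in atTop, Measurable (B (lowPart α n) (lowPart α n)) :=
    ml.mono fun n h => measurable_B h h
  have m3 : ∀ᶠ n : ℕ in atTop, Measurable (B (highPart α κ n) (lowPart α n)) := by
    filter_upwards [ml, mh] with n h h' using measurable_B h' h
  have m4 : ∀ᶠ n : ℕ in atTop, Measurable (B (highPart α κ n) (highPart α κ n)) :=
    mh.mono fun n h => measurable_B h h
  have m5 : ∀ᶠ n : ℕ in atTop, Measurable (B (waveR α κ n) (waveR α κ n)) :=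
    mr.mono fun n h => measurable_B h h
  have t1 := tendsto_laplace_lowPart hα0 hα1
  have t2 := tendsto_B_lowPart hα0 hα1
  have t3 := tendsto_B_highPart_lowPart hα0 hα1 hκ
  have t4 := tendsto_B_highPart hα0 hα1 hκ
  have t5 := tendsto_B_waveR hα0 hα1 hκ
  have a12 : ∀ᶠ n : ℕ in atTop, Measurable ((fun ξ => ((w ξ ^ (2 * α) : ℝ) : ℂ) * lowPart α n ξ) +
      B (lowPart α n) (lowPart α n)) := by filter_upwards [m1, m2] with n h h' using h.add h'
  have a123 : ∀ᶠ n : ℕ in atTop, Measurable ((fun ξ => ((w ξ ^ (2 * α) : ℝ) : ℂ) * lowPart α n ξ) +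
      B (lowPart α n) (lowPart α n) + B (highPart α κ n) (lowPart α n)) := by
    filter_upwards [a12, m3] with n h h' using h.add h'
  have a1234 : ∀ᶠ n : ℕ in atTop,
      Measurable ((fun ξ => ((w ξ ^ (2 * α) : ℝ) : ℂ) * lowPart α n ξ) +
      B (lowPart α n) (lowPart α n) + B (highPart α κ n) (lowPart α n) +
      B (highPart α κ n) (highPart α κ n)) := by
    filter_upwards [a123, m4] with n h h' using h.add h'
  have eq : ∀ᶠ n : ℕ in atTop, (fun ξ => ((w ξ ^ (2 * α) : ℝ) : ℂ) * lowPart α n ξ) +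
      B (lowPart α n) (lowPart α n) + B (highPart α κ n) (lowPart α n) +
      B (highPart α κ n) (highPart α κ n) - B (waveR α κ n) (waveR α κ n) =
      fun ξ => force α (waveL α κ n) ξ - force α (waveR α κ n) ξ := by
    filter_upwards [eventually_ge_natCast 20] with n hn
    ext ξ
    rw [force_sub_force hκ hn]
    rfl
  have total := fun s (h1 : Tendsto (fun n : ℕ => nrm s
      (fun ξ => ((w ξ ^ (2 * α) : ℝ) : ℂ) * lowPart α n ξ)) atTop (𝓝 0)) h2 h3 h4 h5 =>
    (tendsto_nrm_diff a1234 m5 (tendsto_nrm_sum a123 m4 (tendsto_nrm_sum a12 m3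
      (tendsto_nrm_sum m1 m2 h1 h2) h3) h4) h5).congr' (eq.mono fun n h => congrArg (nrm s) h)
  exact ⟨total _ t1.1 t2.1 t3.1 t4.1 t5.1, total _ t1.2 t2.2 t3.2 t4.2 t5.2⟩

end Sequences

/-! ### The sequences of forces for an arbitrary solution map. -/

section Conclusion

variable {α δ η : ℝ} {S : Dist → Dist}

lemma fourier_sub_isFunction {u v : Dist} {g h : Plane → ℂ} (hu : IsFunction (𝓕 u) g)
    (hv : IsFunction (𝓕 v) h) : IsFunction (𝓕 (u - v)) (fun ξ => g ξ - h ξ) := by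
  have e : (𝓕 (u - v) : Dist) = 𝓕 u - 𝓕 v := by
    ext φ
    simp only [TemperedDistribution.fourier_apply]
    rfl
  rw [e]
  exact hu.sub hv

lemma SmoothAway.nrm_neg_force_lt_top (hα0 : 0 < α) (hα1 : α < 1 / 2) {F : Plane → ℂ}
    (hF : SmoothAway F) : nrm (-α) (force α F) < ⊤ := by
  have hs : Continuous (force α F) :=
    ((hF.laplace (2 * α)).smooth.add (hF.contDiff_B hF)).continuous
  have hc : HasCompactSupport (force α F) := (hF.laplace (2 * α)).cpt.add (hF.hasCompactSupport_B hF)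
  obtain ⟨R, hR⟩ := hc.isCompact.isBounded.subset_closedBall (0 : Plane)
  obtain ⟨C, hC⟩ := hc.exists_bound_of_continuous hs
  -- With m = 0 the region is a single ball about the origin.
  have hl : Loc 0 0 R C (force α F) := ⟨hC, fun ξ h => mem_region.2 ⟨0, by simp, by
    simpa using hR (subset_tsupport _ h)⟩⟩
  have := (hl.nrm_neg_le hα0 hα1).trans_lt (ENNReal.mul_lt_top (by simp) (by simp))
  exact (ENNReal.pow_lt_top_iff.1 this).resolve_right (by norm_num)

/-- Test functions produce forces and solutions that are related by every solution map. -/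
lemma IsSolutionMap.exists_schwartz (hS : IsSolutionMap α δ η S) (hα0 : 0 < α) (hα1 : α < 1 / 2)
    {F : Plane → ℂ} (hF : SmoothAway F) (hH : Herm F)
    (h1 : nrm (2 - 4 * α) (force α F) ≤ ENNReal.ofReal δ)
    (h2 : nrm (2 - 2 * α) F ≤ ENNReal.ofReal η) : ∃ f : 𝓢(Plane, ℂ),
      ofSchwartz f ∈ smallData α δ ∧ IsFunction (𝓕 (ofSchwartz f)) (force α F) ∧
        IsFunction (𝓕 (S (ofSchwartz f))) F := by
  obtain ⟨f, θ, hf, hr, hθ, hsol⟩ := hF.exists_schwartz hα0 hα1 hH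
  have hmem : ofSchwartz f ∈ smallData α δ := by
    refine ⟨hr, ?_, by rwa [sobolevNorm_eq _ hf]⟩
    rw [dataNorm, sobolevNorm_eq _ hf, sobolevNorm_eq _ hf]
    exact ENNReal.add_lt_top.2
      ⟨hF.nrm_neg_force_lt_top hα0 hα1, h1.trans_lt ENNReal.ofReal_lt_top⟩
  -- Uniqueness among solutions of size at most η forces S to take the prescribed value.
  have := (hS _ hmem).2 θ hsol (by rwa [sobolevNorm_eq _ hθ])
  exact ⟨f, hmem, hf, this ▸ hθ⟩

/-- Two sequences of forces that approach each other while the solutions do not. -/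
theorem IsSolutionMap.exists_sequences (hS : IsSolutionMap α δ η S) (hα0 : 0 < α)
    (hα1 : α < 1 / 2) (hδ : 0 < δ) (hη : 0 < η) :
    ∃ c : ℝ≥0∞, 0 < c ∧ ∃ f g : ℕ → 𝓢(Plane, ℂ),
      (∀ n, ofSchwartz (f n) ∈ smallData α δ) ∧ (∀ n, ofSchwartz (g n) ∈ smallData α δ) ∧
        Tendsto (fun n => dataNorm α (ofSchwartz (f n) - ofSchwartz (g n))) atTop (𝓝 0) ∧
          ∀ n, c ≤ sobolevNorm (2 - 2 * α) (S (ofSchwartz (f n)) - S (ofSchwartz (g n))) := by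
  obtain ⟨K, hK, hKb⟩ := exists_nrm_wave_le hα1
  -- K depends neither on κ nor on N, so the wave and the corrected wave have size at most min δ η /
  -- 2. The rest of the room, in portions δ/4 and η/4, absorbs the terms that tend to zero.
  set κ := min δ η / (2 * (K + 1)) with hκdef
  have hmin : 0 < min δ η := lt_min hδ hη
  have hκ : 0 < κ := by positivity
  have hKκ : K * κ ≤ min δ η / 2 := by
    rw [hκdef, mul_div_assoc', div_le_div_iff₀ (by positivity) (by norm_num)]
    nlinarith
  obtain ⟨c, hc, hcb⟩ := exists_le_nrm_waveL_sub_waveR (α := α) hα0 hα1 hκ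
  have hd := tendsto_force_sub_force (κ := κ) hα0 hα1 hκ.le
  have hδ4 : 0 < ENNReal.ofReal (δ / 4) := by simpa using by linarith
  have hη4 : 0 < ENNReal.ofReal (η / 4) := by simpa using by linarith
  have small : ∀ (N : ℝ) (F : Plane → ℂ), 20 ≤ N →
      Loc N 1 8 ((2 + responseConst) * (κ * N ^ (-2 + 2 * α))) F →
        nrm (2 - 2 * α) F ≤ ENNReal.ofReal (min δ η / 2) := fun N F hN hF =>
    (hKb κ N F hκ.le hN hF).trans (ENNReal.ofReal_le_ofReal hKκ)
  have good : ∀ᶠ n : ℕ in atTop, ∃ f g : 𝓢(Plane, ℂ),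
      ofSchwartz f ∈ smallData α δ ∧ ofSchwartz g ∈ smallData α δ ∧
        dataNorm α (ofSchwartz f - ofSchwartz g) =
          nrm (-α) (fun ξ => force α (waveL α κ n) ξ - force α (waveR α κ n) ξ) +
          nrm (2 - 4 * α) (fun ξ => force α (waveL α κ n) ξ - force α (waveR α κ n) ξ) ∧
        c ≤ sobolevNorm (2 - 2 * α) (S (ofSchwartz f) - S (ofSchwartz g)) := by
    filter_upwards [eventually_ge_natCast 20, hd.1.eventually_le_const hδ4,
      (tendsto_B_waveR (κ := κ) hα0 hα1 hκ.le).1.eventually_le_const hδ4,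
      (tendsto_lowPart (s := 2 - 2 * α) hα0 hα1 (by linarith)).1.eventually_le_const hη4]
      with n hn b1 b2 b3
    have hn0 : (0 : ℝ) ≤ n := by linarith
    have sL := smoothAway_waveL (α := α) hκ.le hn
    have sR := smoothAway_waveR (α := α) hκ.le hn
    have sl := smoothAway_lowPart (α := α) hn0
    have sh := smoothAway_highPart (α := α) hκ.le hn
    have nR := small n _ hn (loc_waveR hα0 hκ.le hn)
    have nh := small n _ hn ((loc_highPart (α := α) hκ.le hn0).mono le_rfl (by norm_num) (by
      have := responseConst_nonneg
      gcongr
      linarith))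
    have rL : nrm (2 - 2 * α) (waveL α κ n) ≤ ENNReal.ofReal η := by
      refine (nrm_add_le sl.smooth.continuous.measurable sh.smooth.continuous.measurable).trans
        ((add_le_add b3 nh).trans ?_)
      rw [← ENNReal.ofReal_add (by positivity) (by positivity)]
      apply ENNReal.ofReal_le_ofReal
      linarith [min_le_right δ η]
    have rR : nrm (2 - 2 * α) (waveR α κ n) ≤ ENNReal.ofReal η :=
      nR.trans (ENNReal.ofReal_le_ofReal (by linarith [min_le_right δ η]))
    have mR := sR.smooth.continuous.measurable
    have fR' : nrm (2 - 4 * α) (force α (waveR α κ n)) ≤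
        ENNReal.ofReal (min δ η / 2) + ENNReal.ofReal (δ / 4) := by
      refine (nrm_add_le (measurable_weight_mul (s := 2 * α) mR) (measurable_B mR mR)).trans
        (add_le_add ?_ b2)
      rw [nrm_weight_shift, show 2 - 4 * α + 2 * α = 2 - 2 * α by ring]
      exact nR
    have mfR : Measurable (force α (waveR α κ n)) :=
      (measurable_weight_mul (s := 2 * α) mR).add (measurable_B mR mR)
    have mL := sL.smooth.continuous.measurable
    have mfL : Measurable (force α (waveL α κ n)) :=
      (measurable_weight_mul (s := 2 * α) mL).add (measurable_B mL mL)
    have fR : nrm (2 - 4 * α) (force α (waveR α κ n)) ≤ ENNReal.ofReal δ := by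
      refine fR'.trans ?_
      rw [← ENNReal.ofReal_add (by positivity) (by positivity)]
      apply ENNReal.ofReal_le_ofReal
      linarith [min_le_left δ η]
    have fL : nrm (2 - 4 * α) (force α (waveL α κ n)) ≤ ENNReal.ofReal δ := by
      have e : force α (waveL α κ n) = (fun ξ => force α (waveL α κ n) ξ -
          force α (waveR α κ n) ξ) + force α (waveR α κ n) := by
        ext ξ; simp
      rw [e]
      refine (nrm_add_le (mfL.sub mfR) mfR).trans ((add_le_add b1 fR').trans ?_)
      rw [← ENNReal.ofReal_add (by positivity) (by positivity),
        ← ENNReal.ofReal_add (by positivity) (by positivity)]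
      apply ENNReal.ofReal_le_ofReal
      linarith [min_le_left δ η]
    obtain ⟨f, hf, hf1, hf2⟩ := hS.exists_schwartz hα0 hα1 sL herm_waveL fL rL
    obtain ⟨g, hg, hg1, hg2⟩ := hS.exists_schwartz hα0 hα1 sR herm_waveR fR rR
    refine ⟨f, g, hf, hg, ?_, ?_⟩
    · have := fourier_sub_isFunction hf1 hg1
      rw [dataNorm, sobolevNorm_eq _ this, sobolevNorm_eq _ this]
    · rw [sobolevNorm_eq _ (fourier_sub_isFunction hf2 hg2)]
      exact hcb n hn
  -- The sequences are shifted by n₀ so that the smallness and the separation hold for every index.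
  obtain ⟨n₀, hn₀⟩ := eventually_atTop.1 good
  choose f g h1 h2 h3 h4 using fun n : ℕ => hn₀ (n + n₀) (Nat.le_add_left _ _)
  refine ⟨c, hc, f, g, h1, h2, ?_, h4⟩
  simp only [h3]
  have := (hd.2.add hd.1).comp (tendsto_add_atTop_nat n₀)
  rw [add_zero] at this
  exact this

end Conclusion

end QG

end

theorem theorem1p3 (α : ℝ) (hα0 : 0 < α) (hα1 : α < 1 / 2) :
    (∃ δ η : ℝ, ∃ S : QG.Dist → QG.Dist, 0 < δ ∧ 0 < η ∧ QG.IsSolutionMap α δ η S) ∧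
    ∀ (δ η : ℝ) (S : QG.Dist → QG.Dist), 0 < δ → 0 < η → QG.IsSolutionMap α δ η S →
      ¬ QG.UniformlyContinuousMap α δ S ∧
      ∃ f g : ℕ → 𝓢(QG.Plane, ℂ),
        (∀ n, QG.ofSchwartz (f n) ∈ QG.smallData α δ) ∧
        (∀ n, QG.ofSchwartz (g n) ∈ QG.smallData α δ) ∧
        Tendsto (fun n => QG.dataNorm α (QG.ofSchwartz (f n) - QG.ofSchwartz (g n)))
          atTop (𝓝 0) ∧
        0 < liminf (fun n => QG.sobolevNorm (2 - 2 * α)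
          (S (QG.ofSchwartz (f n)) - S (QG.ofSchwartz (g n)))) atTop := by
  refine ⟨QG.exists_solutionMap hα0 hα1, fun δ η S hδ hη hS => ?_⟩
  obtain ⟨c, hc, f, g, hf, hg, hlim, hsep⟩ := hS.exists_sequences hα0 hα1 hδ hη
  refine ⟨fun huc => ?_, f, g, hf, hg, hlim, hc.trans_le ?_⟩
  · obtain ⟨ρ, hρ, h⟩ := huc c hc
    obtain ⟨n, hn⟩ := (hlim.eventually_lt_const hρ).exists
    exact absurd (h _ (hf n) _ (hg n) hn)
      (not_lt.2 ((hsep n).trans (le_add_left le_rfl)))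
  · exact le_liminf_of_le (by isBoundedDefault) (Eventually.of_forall hsep)
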